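/- A \emph{Multiway Storage Modification Machine} (MWSMM) operates on a finite directed graph with a distinguished node, the center, in which every node has exactly one outgoing edge for each direction $d$ of a fixed finite set $D$; a string $x\in D^*$ denotes the node $p(x)$ reached from the center along $x$. Its program is a finite list of numbered instructions: \texttt{new} (create a node, all of whose edges point to the center, and make it the center), \texttt{set} $xd$ \texttt{to} $y$ (redirect the $d$ edge of $p(x)$ to $p(y)$), \texttt{center} $x$ (move the center to $p(x)$), \texttt{if} $x\,y$ \texttt{then} $l$ (jump to line $l$ if $p(x)=p(y)$), \texttt{stop}, and \texttt{match} $b$ (select all nodes of the graph which, as the center, satisfy the boolean expression $b$ in equations between paths, and execute the instructions that follow in parallel on all selected nodes, each as a local center). The program consists of a sequential prologue and of match-blocks, some of which are top-level. First the prologue is executed. Then the top-level match-blocks are executed in parallel, synchronously and with unit cost per parallel step, on all nodes which they select; executions that are at the same line with the same center are identified, and if several executions set the same edge simultaneously, a conflict-resolution strategy selects one of the proposed targets. When all these executions have stopped, the top-level blocks are started again on all nodes which they now select, and the machine halts when none is selected. The input string is given as a doubly linked list of nodes, in which a letter is encoded by directions pointing either to the node itself or to a fixed origin node; initially the last node of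 the list (the origin, if the string is empty) is the center. At halting the center (as left by the prologue) is different from the origin, and the answer is read from its direction $v$, which points to the origin for \emph{true} and to the center itself for \emph{false}. (1) ($\mathrm{PSPACE}\subseteq\mathrm{PTIME}(\mathrm{MWSMM})$.) Every language over a finite alphabet that is recognized in polynomial space by an off-line multi-tape Turing machine is recognized in polynomial time by a deterministic MWSMM: there are an MWSMM and a polynomial $q$ such that, for every conflict-resolution strategy and every input $x$, the machine halts within $q(|x|)$ steps and answers correctly whether $x$ belongs to the language. (2) There are a deterministic MWSMM and a constant $C$ such that, for every conflict-resolution strategy and every quantified boolean formula $Q_1x_1\cdots Q_nx_n\,F$, where each $Q_i$ is $\forall$ or $\exists$ and $F$ is built from the variables $x_1,\dots,x_n$ by binary \emph{and}, binary \emph{or} and \emph{not} and has nesting depth $d$ (variables having depth $0$), the machine, started on this formula written as a string (the quantifiers followed by $F$ in prefix notation, with variable indices in unary), halts within $C\,(n+d)$ steps and answers correctly whether the formula is true. -/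

import Mathlib

/-! ## Off-line multi-tape Turing machines and polynomial space -/

/-- Head moves. -/
inductive Move
  | left
  | stay
  | right

/-- Contents of a cell of the read-only input tape: a letter or one of the two end markers. -/
inductive InSym (α : Type*)
  | leftEnd
  | letter (a : α)
  | rightEnd

/-- A deterministic off-line Turing machine over the input alphabet `α`: a two-way read-only input
tape with end markers, and `k` one-way infinite read-write work tapes. When `δ` returns `none` the
machine halts; otherwise `δ` gives the new state, the move of the input head, and for each work
tape the symbol to write and the move of its head. -/
structure OfflineTM (α : Type*) where
  k : ℕ
  State : Type
  Sym : Type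
  finite_state : Finite State
  finite_sym : Finite Sym
  blank : Sym
  start : State
  accepting : Set State
  δ : State → InSym α → (Fin k → Sym) → Option (State × Move × (Fin k → Sym × Move))

namespace OfflineTM

variable {α : Type*}

/-- A configuration: state, position of the input head, positions of the work heads, and contents
of the work tapes. -/
structure Cfg (T : OfflineTM α) where
  state : T.State
  inPos : ℕ
  head : Fin T.k → ℕ
  tape : Fin T.k → ℕ → T.Sym

/-- The input tape for `w`: cell `0` holds the left end marker, cells `1, …, |w|` hold `w`, and
cell `|w| + 1` holds the right end marker. -/
def inputCell (w : List α) : ℕ → InSym α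
  | 0 => .leftEnd
  | i + 1 => match w[i]? with
    | some a => .letter a
    | none => .rightEnd

/-- Move a head on a one-way infinite tape; a left move on cell `0` leaves the head there. -/
def moveHead : Move → ℕ → ℕ
  | .left, i => i - 1
  | .stay, i => i
  | .right, i => i + 1

/-- The initial configuration. -/
def init (T : OfflineTM α) : T.Cfg where
  state := T.start
  inPos := 0
  head := fun _ => 0
  tape := fun _ _ => T.blank

/-- The action prescribed in a configuration on input `w`, if any. -/
def action (T : OfflineTM α) (w : List α) (c : T.Cfg) :
    Option (T.State × Move × (Fin T.k → T.Sym × Move)) :=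
  T.δ c.state (inputCell w c.inPos) (fun i => c.tape i (c.head i))

/-- One step on input `w`; a halted configuration does not change. The input head never leaves the
cells `0, …, |w| + 1`. -/
def step (T : OfflineTM α) (w : List α) (c : T.Cfg) : T.Cfg :=
  match T.action w c with
  | none => c
  | some (q, m, f) =>
    { state := q
      inPos := min (moveHead m c.inPos) (w.length + 1)
      head := fun i => moveHead (f i).2 (c.head i)
      tape := fun i => Function.update (c.tape i) (c.head i) (f i).1 }

/-- The configuration after `t` steps on input `w`. -/
def run (T : OfflineTM α) (w : List α) (t : ℕ) : T.Cfg :=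
  (T.step w)^[t] T.init

/-- `T` halts on `w` in an accepting state. -/
def Accepts (T : OfflineTM α) (w : List α) : Prop :=
  ∃ t, T.action w (T.run w t) = none ∧ (T.run w t).state ∈ T.accepting

/-- On input `w`, `T` scans at most the first `s` cells of each work tape. -/
def UsesSpace (T : OfflineTM α) (w : List α) (s : ℕ) : Prop :=
  ∀ t i, (T.run w t).head i < s

end OfflineTM

/-- `L` is recognized in polynomial space by an off-line multi-tape Turing machine. (The machine
need not halt on words outside `L`.) -/
def RecognizedInPolySpace {α : Type*} (L : Language α) : Prop :=
  ∃ (T : OfflineTM α) (p : Polynomial ℕ), ∀ w : List α,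
    (w ∈ L ↔ T.Accepts w) ∧ T.UsesSpace w (p.eval w.length)

/-! ## Multiway Storage Modification Machines -/

/-- The directions of a machine over the input alphabet `α`: `o` (origin), `e` and `w` (eastern and
western neighbour in a string), `v` (result value), `sym a` (is the letter here `a`?), and `m`
further ones. -/
inductive Dir (α : Type*) (m : ℕ)
  | o
  | e
  | w
  | v
  | sym (a : α)
  | aux (i : Fin m)

/-- Names of nodes: the origin, the cells of the input string, and the unique identifier of the
node created at time `t` by the execution at line `l` with center `c`. -/
inductive Node
  | origin
  | cell (i : ℕ)
  | fresh (t l : ℕ) (c : Node)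

/-- The center of the execution that created a node (the node itself if it was not created by an
instruction). -/
def Node.creator : Node → Node
  | .origin => .origin
  | .cell i => .cell i
  | .fresh _ _ c => c

/-- A directed graph on named nodes with one outgoing edge per direction (the values of `edge` at
names outside `nodes` are irrelevant). -/
structure PGraph (D : Type*) where
  nodes : Set Node
  edge : Node → D → Node

/-- The node `p(x)` reached from `c` along the path `x`. -/
def PGraph.follow {D : Type*} (G : PGraph D) (c : Node) (x : List D) : Node :=
  x.foldl G.edge c

/-- Boolean expressions on paths. -/
inductive PathExpr (D : Type*)
  | eq (x y : List D)
  | not (b : PathExpr D)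
  | and (b c : PathExpr D)
  | or (b c : PathExpr D)

/-- Truth of a boolean expression on paths, with `c` as the center. -/
def PathExpr.Holds {D : Type*} (G : PGraph D) (c : Node) : PathExpr D → Prop
  | .eq x y => G.follow c x = G.follow c y
  | .not b => ¬ b.Holds G c
  | .and b b' => b.Holds G c ∧ b'.Holds G c
  | .or b b' => b.Holds G c ∨ b'.Holds G c

/-- The instructions. Labels of nodes and the messages printed on halting are only displayed,
and therefore omitted; line numbers are absolute and start from `0`. -/
inductive Instr (D : Type*)
  /-- create a node, with all its edges to the center, and make it the center -/
  | new
  /-- `set x d y` : set the `d` edge of `p(x)` to `p(y)` -/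
  | set (x : List D) (d : D) (y : List D)
  /-- move the center to `p(x)` -/
  | center (x : List D)
  /-- jump to line `l` if `p(x) = p(y)` -/
  | ifEq (x y : List D) (l : ℕ)
  /-- end this execution (`stop`) -/
  | halt
  /-- fork: execute what follows on all nodes that satisfy `b`, each as the center -/
  | fork (b : PathExpr D)

/-- A machine over the input alphabet `α`: the number of its auxiliary directions, its program,
and the lines of the `match` instructions that head the top-level match-blocks. The prologue starts
on line `0`. -/
structure MWSMM (α : Type*) where
  m : ℕ
  prog : List (Instr (Dir α m))
  top : List ℕ
  top_match : ∀ l ∈ top, ∃ b, prog[l]? = some (.fork b)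

/-- One of the parallel executions: its current line and its center. -/
structure Thread where
  line : ℕ
  ctr : Node

/-- A conflict-resolution strategy: given the graph, the current executions, and an edge that is
being set by some of them, it selects one of the proposed targets of this edge. -/
structure Resolution (D : Type*) where
  choose : PGraph D → Set Thread → Node → D → Set Node → Node
  choose_mem : ∀ G E u d S, S.Nonempty → choose G E u d S ∈ S

namespace MWSMM

variable {α : Type*}

/-- The `d` edge of `u` is set to `y` by one of the executions in `E`. -/
def Sets (M : MWSMM α) (G : PGraph (Dir α M.m)) (E : Set Thread) (u : Node) (d : Dir α M.m)
    (y : Node) : Prop :=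
  ∃ θ ∈ E, ∃ x z, M.prog[θ.line]? = some (.set x d z) ∧
    G.follow θ.ctr x = u ∧ G.follow θ.ctr z = y

/-- `u` is created at time `t` by one of the executions in `E`. -/
def Creates (M : MWSMM α) (t : ℕ) (E : Set Thread) (u : Node) : Prop :=
  ∃ θ ∈ E, M.prog[θ.line]? = some .new ∧ u = .fresh t θ.line θ.ctr

open Classical in
/-- The graph after all executions in `E` have simultaneously performed their current
instruction at time `t`. All paths refer to the graph before this step. -/
noncomputable def update (M : MWSMM α) (ρ : Resolution (Dir α M.m)) (t : ℕ)
    (G : PGraph (Dir α M.m)) (E : Set Thread) : PGraph (Dir α M.m) where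
  nodes := G.nodes ∪ {u | M.Creates t E u}
  edge := fun u d =>
    if M.Creates t E u then u.creator
    else if {y | M.Sets G E u d y}.Nonempty then ρ.choose G E u d {y | M.Sets G E u d y}
    else G.edge u d

open Classical in
/-- Where an execution continues after an instruction other than `match`; `none` if it ends. An
execution that runs off the program ends. -/
noncomputable def next (M : MWSMM α) (t : ℕ) (G : PGraph (Dir α M.m)) (θ : Thread) :
    Option Thread :=
  match M.prog[θ.line]? with
  | some .new => some ⟨θ.line + 1, .fresh t θ.line θ.ctr⟩
  | some (.set _ _ _) => some ⟨θ.line + 1, θ.ctr⟩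
  | some (.center x) => some ⟨θ.line + 1, G.follow θ.ctr x⟩
  | some (.ifEq x y l) =>
      some ⟨if G.follow θ.ctr x = G.follow θ.ctr y then l else θ.line + 1, θ.ctr⟩
  | some .halt => none
  | some (.fork _) => none
  | none => none

/-- The executions started by the `match` instruction on line `l` (none if there is no such
instruction on this line). -/
def forked (M : MWSMM α) (G : PGraph (Dir α M.m)) (l : ℕ) : Set Thread :=
  {θ | ∃ b, M.prog[l]? = some (.fork b) ∧ θ.ctr ∈ G.nodes ∧ b.Holds G θ.ctr ∧ θ.line = l + 1}

/-- What is being executed: the prologue, at some line, or a set of executions of match-blocks. -/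
inductive Control
  | prologue (l : ℕ)
  | blocks (E : Set Thread)

/-- A configuration: elapsed time, graph, center of the machine, and control. Only the prologue
moves the center; match-blocks are executed with local centers. -/
structure Cfg (M : MWSMM α) where
  time : ℕ
  graph : PGraph (Dir α M.m)
  center : Node
  control : Control

open Classical in
/-- One parallel step. The prologue ends at a `halt`, at the first match-block or at the end of the
program. Match-blocks are executed in lockstep; when all their executions have ended, the top-level
blocks are started again, simultaneously, on all nodes that they select in the current graph. -/
noncomputable def step (M : MWSMM α) (ρ : Resolution (Dir α M.m)) (c : M.Cfg) : M.Cfg :=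
  match c.control with
  | .prologue l =>
    { time := c.time + 1
      graph := M.update ρ c.time c.graph {⟨l, c.center⟩}
      center := match M.next c.time c.graph ⟨l, c.center⟩ with
        | some θ => θ.ctr
        | none => c.center
      control := match M.next c.time c.graph ⟨l, c.center⟩ with
        | some θ => .prologue θ.line
        | none => .blocks ∅ }
  | .blocks E =>
    { time := c.time + 1
      graph := M.update ρ c.time c.graph E
      center := c.center
      control :=
        if E = ∅ then .blocks {θ | ∃ l ∈ M.top, θ ∈ M.forked c.graph l}
        else .blocks {θ | ∃ θ' ∈ E, M.next c.time c.graph θ' = some θ ∨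
          θ ∈ M.forked c.graph θ'.line} }

/-- Nothing is being executed, and no top-level `match` selects a node. -/
def Halted (M : MWSMM α) (c : M.Cfg) : Prop :=
  c.control = .blocks ∅ ∧ ∀ l ∈ M.top, M.forked c.graph l = ∅

open Classical in
/-- The graph that represents the input string `x`: a doubly linked list of cells; a letter is
encoded by directions that point to the cell itself or to the origin. Every direction `o`, every
missing neighbour and all remaining directions point to the origin, and so do all edges of the
origin. -/
noncomputable def inputGraph (m : ℕ) (x : List α) : PGraph (Dir α m) where
  nodes := {u | u = .origin ∨ ∃ i < x.length, u = .cell i}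
  edge := fun u d =>
    match u, d with
    | .cell i, .e => if i + 1 < x.length then .cell (i + 1) else .origin
    | .cell i, .w => if 0 < i then .cell (i - 1) else .origin
    | .cell i, .sym a => if x[i]? = some a then .cell i else .origin
    | _, _ => .origin

/-- The initial configuration on input `x`: the center is the last cell of the string (the origin
if the string is empty), and the prologue is about to be executed. -/
noncomputable def init (M : MWSMM α) (x : List α) : M.Cfg where
  time := 0
  graph := inputGraph M.m x
  center := if x = [] then .origin else .cell (x.length - 1)
  control := .prologue 0

/-- The configuration after `t` steps on input `x`. -/
noncomputable def run (M : MWSMM α) (ρ : Resolution (Dir α M.m)) (x : List α) (t : ℕ) : M.Cfg :=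
  (M.step ρ)^[t] (M.init x)

/-- On input `x` the machine halts after at most `t` steps, and the direction `v` of its center
then gives the truth value of `P`: it points to the origin for true, to the center itself for
false. -/
def DecidesWithin (M : MWSMM α) (ρ : Resolution (Dir α M.m)) (x : List α) (t : ℕ) (P : Prop) :
    Prop :=
  ∃ s ≤ t, M.Halted (M.run ρ x s) ∧ (M.run ρ x s).center ≠ .origin ∧
    (P → (M.run ρ x s).graph.edge (M.run ρ x s).center .v = .origin) ∧
    (¬ P → (M.run ρ x s).graph.edge (M.run ρ x s).center .v = (M.run ρ x s).center)

end MWSMM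

/-- `L` is recognized in polynomial time by a deterministic MWSMM, whatever the strategy by which
conflicts are resolved. -/
def RecognizedInPolyTimeMWSMM {α : Type*} (L : Language α) : Prop :=
  ∃ (M : MWSMM α) (p : Polynomial ℕ), ∀ (ρ : Resolution (Dir α M.m)) (x : List α),
    M.DecidesWithin ρ x (p.eval x.length) (x ∈ L)

/-! ## Quantified boolean formulas -/

/-- Unquantified boolean formulas in the variables `x_0, …, x_{n-1}`. -/
inductive BoolForm (n : ℕ)
  | var (i : Fin n)
  | not (f : BoolForm n)
  | and (f g : BoolForm n)
  | or (f g : BoolForm n)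

/-- The letters in which quantified boolean formulas are written. -/
inductive QSym
  | all
  | ex
  | not
  | and
  | or
  | var
  | tick

namespace BoolForm

variable {n : ℕ}

/-- The value under an assignment. -/
def eval (a : Fin n → Bool) : BoolForm n → Bool
  | .var i => a i
  | .not f => !(f.eval a)
  | .and f g => f.eval a && g.eval a
  | .or f g => f.eval a || g.eval a

/-- The nesting depth. -/
def depth : BoolForm n → ℕ
  | .var _ => 0
  | .not f => f.depth + 1
  | .and f g => max f.depth g.depth + 1
  | .or f g => max f.depth g.depth + 1

/-- Prefix notation; the variable `x_i` is written as `var` followed by `i` ticks. -/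
def encode : BoolForm n → List QSym
  | .var i => .var :: List.replicate i .tick
  | .not f => .not :: f.encode
  | .and f g => .and :: (f.encode ++ g.encode)
  | .or f g => .or :: (f.encode ++ g.encode)

end BoolForm

/-- The two quantifiers. -/
inductive Quantifier
  | all
  | ex

/-- The letter for a quantifier. -/
def Quantifier.toQSym : Quantifier → QSym
  | .all => .all
  | .ex => .ex

/-- The truth of `Q_0 x_0 … Q_{n-1} x_{n-1} P(x_0, …, x_{n-1})`. -/
def quantify : (n : ℕ) → (Fin n → Quantifier) → ((Fin n → Bool) → Prop) → Prop
  | 0, _, P => P Fin.elim0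
  | n + 1, q, P =>
    match q 0 with
    | .all => ∀ b : Bool, quantify n (fun i => q i.succ) (fun a => P (Fin.cons b a))
    | .ex => ∃ b : Bool, quantify n (fun i => q i.succ) (fun a => P (Fin.cons b a))

/-- A quantified boolean formula `Q_0 x_0 … Q_{n-1} x_{n-1} F`. -/
structure QBF where
  n : ℕ
  quant : Fin n → Quantifier
  matrix : BoolForm n

/-- The truth value of a quantified boolean formula. -/
def QBF.IsTrue (φ : QBF) : Prop :=
  quantify φ.n φ.quant (fun a => φ.matrix.eval a = true)

/-- A quantified boolean formula as a string: the quantifiers, in order, followed by the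
unquantified part. -/
def QBF.encode (φ : QBF) : List QSym :=
  List.ofFn (fun i => (φ.quant i).toQSym) ++ φ.matrix.encode

/-! Both machines have a program of the same kind, a `RuleSet`: guarded rules that all nodes obey in
lockstep. All match-blocks have the same length, so five machine steps form one synchronous round
(`exists_round`): guards and paths are read in the old graph, and an edge either takes one of the
targets proposed for it or, without proposals, stays. Conflict resolution is harmless wherever all
proposals for an edge agree (`step_eq`), and this is shown for every edge that matters. All edges of
a new node lead to its creator. This provides parent pointers, and a recognizable default for edges
that are not yet computed.

Quantified formulas. The cells of the string parse it: they compute where the code that starts at a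
cell ends, where the second argument of a connective begins, and which quantifier a variable belongs
to. Arguments are treated in parallel, so the time is governed by the number of variables and the
depth, not by the length. A binary evaluation tree grows from the center. Both children of a
quantifier evaluate the same formula, one for each value of the variable; the children of a
connective evaluate its arguments. The tree may have exponentially many nodes, but its depth is `n +
d`. A leaf climbs to the node of its quantifier and reads off its value from the side on which it
arrives; the values then move up to the center. Soundness is the invariant that every computed edge
is either undefined or right (`Base`, `CellInv`, `TreeInv`), independently of timing. Progress
(`lst_done`, `known_of_cell`) bounds the number of rounds.

Polynomial space. A configuration is a word of columns, each showing one position of all tapes.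
Given the state and the scanned symbols, a step rewrites the columns locally; these data are treated
as a guess, and exactly one guess is compatible with all columns of a configuration
(`isRun_window`). Let `W` be a power of the input length plus 2 that bounds the space, and `c` the
number of letters. The machine grows the trie of all words of length at most `W`, one level per
round, and for every node and guess it computes a pointer to the rewritten word (`edge_img`). This
is possible in step with the growth, since the image of a word extends the image of its prefix by
one letter. For leaves this yields a pointer `jmp` for one computation step. Replacing `jmp` by its
`c ^ 2`-fold iterate in `W - 1` rounds gives jumps of `(c ^ 2) ^ (W - 1)` steps (`edge_jmp`). By the
pigeonhole principle (`IsRun.exists_le`) `c ^ W` steps decide acceptance, so the answer can be read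
at the leaf reached by one jump from the initial word. The phases are timed by an odometer whose
digits are pointers into the input list (`Inv`). -/

/-! ## Synchronous rule machines -/

namespace MWSMM

/-! ### The effect of one parallel step on nodes and edges -/

section Update

variable {α : Type*} (M : MWSMM α) (ρ : Resolution (Dir α M.m)) (t : ℕ)
  (G : PGraph (Dir α M.m)) (E : Set Thread)

theorem update_nodes (u : Node) :
    u ∈ (M.update ρ t G E).nodes ↔ u ∈ G.nodes ∨ M.Creates t E u := Iff.rfl

theorem update_edge_of_creates {u : Node} (h : M.Creates t E u) (d : Dir α M.m) :
    (M.update ρ t G E).edge u d = u.creator := by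
  simp [update, h]

theorem update_edge_of_not_sets {u : Node} {d : Dir α M.m} (h : ¬ M.Creates t E u)
    (hs : ∀ y, ¬ M.Sets G E u d y) : (M.update ρ t G E).edge u d = G.edge u d := by
  have : ¬ {y | M.Sets G E u d y}.Nonempty := by
    rintro ⟨y, hy⟩; exact hs y hy
  simp [update, h, this]

theorem update_edge_of_sets {u : Node} {d : Dir α M.m} (h : ¬ M.Creates t E u)
    {y : Node} (hs : M.Sets G E u d y) :
    M.Sets G E u d ((M.update ρ t G E).edge u d) := by
  have hne : {y | M.Sets G E u d y}.Nonempty := ⟨y, hs⟩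
  have := ρ.choose_mem G E u d _ hne
  simpa [update, h, hne] using this

theorem update_edge_of_unique {u : Node} {d : Dir α M.m} (h : ¬ M.Creates t E u)
    {y : Node} (hs : M.Sets G E u d y) (hu : ∀ y', M.Sets G E u d y' → y' = y) :
    (M.update ρ t G E).edge u d = y :=
  hu _ (M.update_edge_of_sets ρ t G E h hs)

theorem update_empty : M.update ρ t G ∅ = G := by
  have hc : ∀ u, ¬ M.Creates t ∅ u := by rintro u ⟨θ, hθ, -⟩; exact hθ
  have hs : ∀ u d y, ¬ M.Sets G ∅ u d y := by rintro u d y ⟨θ, hθ, -⟩; exact hθ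
  have h1 : (M.update ρ t G ∅).nodes = G.nodes := by
    ext u; rw [update_nodes]; simp [hc u]
  have h2 : (M.update ρ t G ∅).edge = G.edge := by
    funext u d; exact M.update_edge_of_not_sets ρ t G ∅ (hc u) (hs u d)
  calc M.update ρ t G ∅ = ⟨(M.update ρ t G ∅).nodes, (M.update ρ t G ∅).edge⟩ := rfl
    _ = G := by rw [h1, h2]

end Update

end MWSMM

/-- A list of guarded rules that all nodes of a graph carry out synchronously, as long as `live`
holds. A rule in `news` creates a child of the node and lets the given direction point to it; a
rule in `sets` redirects one edge. The prologue creates the center, points its direction `nil` to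
the origin, and points the direction `ctr` of the origin to it. -/
structure RuleSet (α : Type*) (m : ℕ) where
  live : PathExpr (Dir α m)
  news : List (PathExpr (Dir α m) × Dir α m)
  sets : List (PathExpr (Dir α m) × List (Dir α m) × Dir α m × List (Dir α m))
  nil : Dir α m
  ctr : Dir α m
  nil_ne : nil ≠ .o
  ctr_ne : ctr ≠ .o
  news_ne : ∀ p ∈ news, p.2 ≠ .o
  sets_ne : ∀ p ∈ sets, p.2.2.1 ≠ .o

namespace RuleSet

variable {α : Type*} {m : ℕ}

/-- The lines after the `match` of a rule that creates a child. -/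
def newCode (d : Dir α m) : ℕ → Instr (Dir α m)
  | 1 => .new
  -- Every edge of the new center leads to its creator, so `[.o]` is the creator here. The next line
  -- restores the rule that `.o` leads to the origin.
  | 2 => .set [.o] d []
  | 3 => .set [] .o [.o, .o]
  | _ => .halt

/-- The lines after the `match` of a rule that redirects an edge. -/
def setCode (x : List (Dir α m)) (d : Dir α m) (y : List (Dir α m)) : ℕ → Instr (Dir α m)
  | 1 => .set x d y
  -- Idle lines, which keep the two kinds of blocks in lockstep.
  | 2 => .center []
  | 3 => .center []
  | _ => .halt

variable (R : RuleSet α m)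

/-- All rules, as guards with the lines that follow them. -/
def body : List (PathExpr (Dir α m) × (ℕ → Instr (Dir α m))) :=
  R.news.map (fun p => (p.1, newCode p.2)) ++
    R.sets.map (fun p => (p.1, setCode p.2.1 p.2.2.1 p.2.2.2))

/-- The lines of the prologue. -/
def prologue : ℕ → Instr (Dir α m)
  | 0 => .new
  | 1 => .set [] .o [.o, .o]
  -- Since `.o` of the new center has been repaired, `[.o]` is the origin here and on the next line.
  | 2 => .set [] R.nil [.o]
  | 3 => .set [.o] R.ctr []
  | _ => .halt

/-- The instruction on a line. -/
def instrAt (k : ℕ) : Instr (Dir α m) :=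
  if k < 5 then R.prologue k else
    match R.body[k / 5 - 1]? with
    | none => .halt
    | some (b, c) => if k % 5 = 0 then .fork (.and R.live b) else c (k % 5)

theorem instrAt_block {i j : ℕ} {b c} (h : R.body[i]? = some (b, c)) (hj : j < 5) :
    R.instrAt (5 * (i + 1) + j) = if j = 0 then .fork (.and R.live b) else c j := by
  have h1 : (5 * (i + 1) + j) / 5 - 1 = i := by omega
  have h2 : (5 * (i + 1) + j) % 5 = j := by omega
  have h3 : ¬ (5 * (i + 1) + j < 5) := by omega
  simp only [instrAt, h1, h2, h3, if_false, h]

/-- The machine with the given rules. -/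
abbrev machine : MWSMM α where
  m := m
  prog := (List.range (5 * (R.body.length + 1))).map R.instrAt
  top := (List.range R.body.length).map fun i => 5 * (i + 1)
  top_match := by
    intro l hl
    simp only [List.mem_map, List.mem_range] at hl
    obtain ⟨i, hi, rfl⟩ := hl
    refine ⟨.and R.live (R.body[i]).1, ?_⟩
    have h := R.instrAt_block (i := i) (j := 0) (List.getElem?_eq_getElem hi) (by omega)
    have hr : 5 * (i + 1) < 5 * (R.body.length + 1) := by omega
    simp only [add_zero, if_true] at h
    simp [List.getElem?_map, List.getElem?_range hr, h]

theorem prog_block {i j : ℕ} {b c} (h : R.body[i]? = some (b, c)) (hj : j < 5) :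
    R.machine.prog[5 * (i + 1) + j]? =
      some (if j = 0 then .fork (.and R.live b) else c j) := by
  have hi : i < R.body.length := by
    by_contra hh; rw [List.getElem?_eq_none (by omega)] at h; simp at h
  have hr : 5 * (i + 1) + j < 5 * (R.body.length + 1) := by omega
  simp only [List.getElem?_map, List.getElem?_range hr, Option.map_some, R.instrAt_block h hj]

theorem prog_prologue {k : ℕ} (hk : k < 5) : R.machine.prog[k]? = some (R.prologue k) := by
  have hr : k < 5 * (R.body.length + 1) := by omega
  simp only [List.getElem?_map, List.getElem?_range hr, Option.map_some, instrAt, hk, if_true]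

theorem body_cases {i : ℕ} {b c} (h : R.body[i]? = some (b, c)) :
    (∃ d, R.news[i]? = some (b, d) ∧ i < R.news.length ∧ c = newCode d) ∨
      ∃ x d y, (b, x, d, y) ∈ R.sets ∧ R.news.length ≤ i ∧ c = setCode x d y := by
  unfold body at h
  by_cases hi : i < R.news.length
  · left
    rw [List.getElem?_append_left (by simpa using hi), List.getElem?_map,
      List.getElem?_eq_getElem hi] at h
    simp only [Option.map_some, Option.some.injEq, Prod.mk.injEq] at h
    exact ⟨R.news[i].2, by rw [List.getElem?_eq_getElem hi, ← h.1], hi, h.2.symm⟩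
  · right
    rw [List.getElem?_append_right (by simpa using hi), List.getElem?_map] at h
    simp only [List.length_map, Option.map_eq_some_iff] at h
    obtain ⟨p, hp, hp2⟩ := h
    obtain ⟨rfl, rfl⟩ := Prod.mk.inj hp2
    exact ⟨p.2.1, p.2.2.1, p.2.2.2, List.mem_of_getElem? hp, by omega, rfl⟩

theorem body_news {i : ℕ} {b d} (h : R.news[i]? = some (b, d)) :
    R.body[i]? = some (b, newCode d) ∧ i < R.news.length := by
  have hi : i < R.news.length := by
    by_contra hh; rw [List.getElem?_eq_none (by omega)] at h; simp at h
  refine ⟨?_, hi⟩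
  unfold body
  rw [List.getElem?_append_left (by simpa using hi), List.getElem?_map, h]; rfl

theorem body_sets {b x d y} (h : (b, x, d, y) ∈ R.sets) :
    ∃ i, R.body[i]? = some (b, setCode x d y) ∧ R.news.length ≤ i := by
  obtain ⟨k, hk⟩ := List.mem_iff_getElem?.1 h
  refine ⟨R.news.length + k, ?_, by omega⟩
  unfold body
  rw [List.getElem?_append_right (by simp), List.getElem?_map]
  simp [hk]

/-- The guard `b` selects the node `u`. -/
def Fires (G : PGraph (Dir α m)) (b : PathExpr (Dir α m)) (u : Node) : Prop :=
  u ∈ G.nodes ∧ R.live.Holds G u ∧ b.Holds G u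

/-- `u` is created in a round that starts at time `t`. -/
def Born (t : ℕ) (G : PGraph (Dir α m)) (u : Node) : Prop :=
  ∃ i b d c, R.news[i]? = some (b, d) ∧ R.Fires G b c ∧ u = .fresh (t + 1) (5 * (i + 1) + 1) c

/-- Some rule wants the `d` edge of `u` to point to `y` after a round that starts at time `t`. -/
def Proposed (t : ℕ) (G : PGraph (Dir α m)) (u : Node) (d : Dir α m) (y : Node) : Prop :=
  (∃ b x z, (b, x, d, z) ∈ R.sets ∧ ∃ c, R.Fires G b c ∧ G.follow c x = u ∧ G.follow c z = y) ∨
    ∃ i b, R.news[i]? = some (b, d) ∧ R.Fires G b u ∧ y = .fresh (t + 1) (5 * (i + 1) + 1) u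

/-- The graph `G'` results from `G` by one round that starts at time `t`. -/
structure Round (t : ℕ) (G G' : PGraph (Dir α m)) : Prop where
  nodes : ∀ u, u ∈ G'.nodes ↔ u ∈ G.nodes ∨ R.Born t G u
  old : ∀ u ∈ G.nodes, ∀ d, R.Proposed t G u d (G'.edge u d) ∨
    ((∀ y, ¬ R.Proposed t G u d y) ∧ G'.edge u d = G.edge u d)
  born : ∀ u, R.Born t G u → ∀ d, d ≠ .o → G'.edge u d = u.creator
  born_o : ∀ u, R.Born t G u → G'.edge u .o = G.edge u.creator .o

/-- The executions `j` lines after the `match` instructions of a round. -/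
def threads (t : ℕ) (G : PGraph (Dir α m)) (j : ℕ) : Set Thread :=
  {θ | ∃ i b c u, R.body[i]? = some (b, c) ∧ R.Fires G b u ∧
    θ = ⟨5 * (i + 1) + j,
      -- `new` moves the local center to the child, so from the second line on a creating execution
      -- sits there.
      if i < R.news.length ∧ 2 ≤ j then .fresh (t + 1) (5 * (i + 1) + 1) u else u⟩}

theorem threads_nonempty {t : ℕ} {G : PGraph (Dir α m)} {j k : ℕ}
    (h : (R.threads t G j).Nonempty) : (R.threads t G k).Nonempty := by
  obtain ⟨_, i, b, c, u, h1, h2, -⟩ := h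
  exact ⟨_, i, b, c, u, h1, h2, rfl⟩

theorem forked_top (G : PGraph (Dir α m)) (t : ℕ) :
    {θ | ∃ l ∈ R.machine.top, θ ∈ R.machine.forked G l} = R.threads t G 1 := by
  ext θ
  constructor
  · rintro ⟨l, hl, b, hb, h1, h2, h3⟩
    simp only [List.mem_map, List.mem_range] at hl
    obtain ⟨i, hi, rfl⟩ := hl
    have hget : R.body[i]? = some ((R.body[i]).1, (R.body[i]).2) := List.getElem?_eq_getElem hi
    have := R.prog_block (j := 0) hget (by omega)
    rw [add_zero, hb] at this
    simp only [if_true, Option.some.injEq, Instr.fork.injEq] at this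
    subst this
    exact ⟨i, _, _, θ.ctr, hget, ⟨h1, h2.1, h2.2⟩, by cases θ; simp_all⟩
  · rintro ⟨i, b, c, u, hb, hf, rfl⟩
    have hi : i < R.body.length := by
      by_contra hh; rw [List.getElem?_eq_none (by omega)] at hb; simp at hb
    refine ⟨5 * (i + 1), by simp only [List.mem_map, List.mem_range]; exact ⟨i, hi, rfl⟩, ?_⟩
    refine ⟨.and R.live b, ?_, ?_⟩
    · simpa using R.prog_block (j := 0) hb (by omega)
    · simp only [show ¬ (i < R.news.length ∧ 2 ≤ 1) by omega, if_false]
      exact ⟨hf.1, ⟨hf.2.1, hf.2.2⟩, trivial⟩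

/-! ### Five machine steps as one round -/

variable (ρ : Resolution (Dir α m))

theorem step_empty (t : ℕ) (G : PGraph (Dir α m)) (N : Node) :
    R.machine.step ρ ⟨t, G, N, .blocks ∅⟩ = ⟨t + 1, G, N, .blocks (R.threads t G 1)⟩ := by
  simp only [MWSMM.step, MWSMM.update_empty, if_true, R.forked_top G t]

theorem code_ne_fork {i j : ℕ} {b c} (h : R.body[i]? = some (b, c)) (b') : c j ≠ .fork b' := by
  rcases R.body_cases h with ⟨d, -, -, rfl⟩ | ⟨x, d, y, -, -, rfl⟩ <;>
    rcases j with _ | _ | _ | _ | j <;> simp [newCode, setCode]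

theorem next_code {i j : ℕ} {b c} (h : R.body[i]? = some (b, c)) (hj1 : 1 ≤ j) (hj : j < 4)
    (t : ℕ) (u : Node) (G' : PGraph (Dir α m)) :
    R.machine.next (t + j) G' ⟨5 * (i + 1) + j,
      if i < R.news.length ∧ 2 ≤ j then .fresh (t + 1) (5 * (i + 1) + 1) u else u⟩ =
    some ⟨5 * (i + 1) + (j + 1),
      if i < R.news.length ∧ 2 ≤ j + 1 then .fresh (t + 1) (5 * (i + 1) + 1) u else u⟩ := by
  have hp := R.prog_block h (j := j) (by omega)
  rw [if_neg (by omega)] at hp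
  rcases R.body_cases h with ⟨d, -, hi, rfl⟩ | ⟨x, d, y, -, hi, rfl⟩
  · interval_cases j <;> simp [MWSMM.next, hp, newCode, hi, add_assoc]
  · have hi' : ¬ i < R.news.length := by omega
    interval_cases j <;> simp [MWSMM.next, hp, setCode, hi', add_assoc, PGraph.follow]

theorem creates_threads {t : ℕ} {G : PGraph (Dir α m)} {j : ℕ} (hj1 : 1 ≤ j) (hj : j < 5)
    (u : Node) :
    R.machine.Creates (t + j) (R.threads t G j) u ↔ j = 1 ∧ R.Born t G u := by
  constructor
  · rintro ⟨_, ⟨i, b, c, v, hb, hf, rfl⟩, hp, rfl⟩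
    rw [R.prog_block hb hj, if_neg (by omega)] at hp
    rcases R.body_cases hb with ⟨d, hn, hi, rfl⟩ | ⟨x, d, y, -, hi, rfl⟩
    · obtain rfl : j = 1 := by
        interval_cases j <;> simp [newCode] at hp ⊢
      exact ⟨rfl, i, b, d, v, hn, hf, by simp⟩
    · interval_cases j <;> simp [setCode] at hp
  · rintro ⟨rfl, i, b, d, c, hn, hf, rfl⟩
    obtain ⟨hb, hi⟩ := R.body_news hn
    refine ⟨_, ⟨i, b, _, c, hb, hf, rfl⟩, ?_, by simp⟩
    rw [R.prog_block hb hj]; rfl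

theorem sets_threads_one {t : ℕ} {G G' : PGraph (Dir α m)} {u : Node} {d : Dir α m} {y : Node} :
    R.machine.Sets G' (R.threads t G 1) u d y ↔
      ∃ b x z, (b, x, d, z) ∈ R.sets ∧ ∃ c, R.Fires G b c ∧
        G'.follow c x = u ∧ G'.follow c z = y := by
  constructor
  · rintro ⟨_, ⟨i, b, c, v, hb, hf, rfl⟩, x, z, hp, h1, h2⟩
    rw [R.prog_block hb (by omega), if_neg (by omega)] at hp
    rcases R.body_cases hb with ⟨d, hn, hi, rfl⟩ | ⟨x, d, y, hs, hi, rfl⟩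
    · simp [newCode] at hp
    · simp only [setCode, Option.some.injEq, Instr.set.injEq] at hp
      obtain ⟨rfl, rfl, rfl⟩ := hp
      simp only [show ¬ (i < R.news.length ∧ 2 ≤ 1) by omega, if_false] at h1 h2
      exact ⟨b, _, _, hs, v, hf, h1, h2⟩
  · rintro ⟨b, x, z, hs, c, hf, h1, h2⟩
    obtain ⟨i, hb, hi⟩ := R.body_sets hs
    refine ⟨_, ⟨i, b, _, c, hb, hf, rfl⟩, x, z, ?_, ?_⟩
    · rw [R.prog_block hb (by omega)]; rfl
    · simp only [show ¬ (i < R.news.length ∧ 2 ≤ 1) by omega, if_false]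
      exact ⟨h1, h2⟩

theorem sets_threads_two {t : ℕ} {G G' : PGraph (Dir α m)} {u : Node} {d : Dir α m} {y : Node} :
    R.machine.Sets G' (R.threads t G 2) u d y ↔
      ∃ i b c, R.news[i]? = some (b, d) ∧ R.Fires G b c ∧
        G'.edge (.fresh (t + 1) (5 * (i + 1) + 1) c) .o = u ∧
        y = .fresh (t + 1) (5 * (i + 1) + 1) c := by
  constructor
  · rintro ⟨_, ⟨i, b, c, v, hb, hf, rfl⟩, x, z, hp, h1, h2⟩
    rw [R.prog_block hb (by omega), if_neg (by omega)] at hp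
    rcases R.body_cases hb with ⟨d, hn, hi, rfl⟩ | ⟨x, d, y, hs, hi, rfl⟩
    · simp only [newCode, Option.some.injEq, Instr.set.injEq] at hp
      obtain ⟨rfl, rfl, rfl⟩ := hp
      simp only [hi, le_refl, and_self, if_true, PGraph.follow, List.foldl] at h1 h2
      exact ⟨i, b, v, hn, hf, h1, h2.symm⟩
    · simp [setCode] at hp
  · rintro ⟨i, b, c, hn, hf, h1, h2⟩
    obtain ⟨hb, hi⟩ := R.body_news hn
    refine ⟨_, ⟨i, b, _, c, hb, hf, rfl⟩, [.o], [], ?_, ?_⟩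
    · rw [R.prog_block hb (by omega)]; rfl
    · simp only [hi, le_refl, and_self, if_true, PGraph.follow, List.foldl]
      exact ⟨h1, h2.symm⟩

theorem sets_threads_three {t : ℕ} {G G' : PGraph (Dir α m)} {u : Node} {d : Dir α m}
    {y : Node} :
    R.machine.Sets G' (R.threads t G 3) u d y ↔
      d = .o ∧ R.Born t G u ∧ y = G'.edge (G'.edge u .o) .o := by
  constructor
  · rintro ⟨_, ⟨i, b, c, v, hb, hf, rfl⟩, x, z, hp, h1, h2⟩
    rw [R.prog_block hb (by omega), if_neg (by omega)] at hp
    rcases R.body_cases hb with ⟨d, hn, hi, rfl⟩ | ⟨x, d, y, hs, hi, rfl⟩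
    · simp only [newCode, Option.some.injEq, Instr.set.injEq] at hp
      obtain ⟨rfl, rfl, rfl⟩ := hp
      simp only [hi, show 2 ≤ 3 by omega, and_self, if_true, PGraph.follow, List.foldl] at h1 h2
      subst h1
      exact ⟨rfl, ⟨i, b, _, v, hn, hf, rfl⟩, h2.symm⟩
    · simp [setCode] at hp
  · rintro ⟨rfl, ⟨i, b, d, c, hn, hf, rfl⟩, rfl⟩
    obtain ⟨hb, hi⟩ := R.body_news hn
    refine ⟨_, ⟨i, b, _, c, hb, hf, rfl⟩, [], [.o, .o], ?_, ?_⟩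
    · rw [R.prog_block hb (by omega)]; rfl
    · simp [hi, PGraph.follow]

theorem sets_threads_four {t : ℕ} {G G' : PGraph (Dir α m)} {u : Node} {d : Dir α m}
    {y : Node} : ¬ R.machine.Sets G' (R.threads t G 4) u d y := by
  rintro ⟨_, ⟨i, b, c, v, hb, hf, rfl⟩, x, z, hp, h1, h2⟩
  rw [R.prog_block hb (by omega), if_neg (by omega)] at hp
  rcases R.body_cases hb with ⟨d, hn, hi, rfl⟩ | ⟨x, d, y, hs, hi, rfl⟩
  · simp [newCode] at hp
  · simp [setCode] at hp

theorem forked_threads {t : ℕ} {G G' : PGraph (Dir α m)} {j : ℕ} (hj1 : 1 ≤ j) (hj : j < 5)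
    {θ θ' : Thread} (h : θ' ∈ R.threads t G j) : θ ∉ R.machine.forked G' θ'.line := by
  rintro ⟨b', hp, -⟩
  obtain ⟨i, b, c, v, hb, hf, rfl⟩ := h
  rw [R.prog_block hb hj, if_neg (by omega)] at hp
  exact R.code_ne_fork hb b' (Option.some.inj hp)

theorem step_threads {t : ℕ} {G G' : PGraph (Dir α m)} {j : ℕ} (hj1 : 1 ≤ j) (hj : j < 4)
    (hne : (R.threads t G j).Nonempty) (N : Node) :
    R.machine.step ρ ⟨t + j, G', N, .blocks (R.threads t G j)⟩ =
      ⟨t + (j + 1), R.machine.update ρ (t + j) G' (R.threads t G j), N,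
        .blocks (R.threads t G (j + 1))⟩ := by
  simp only [MWSMM.step, hne.ne_empty, if_false]
  refine congrArg (fun E => MWSMM.Cfg.mk (M := R.machine) (t + (j + 1))
    (R.machine.update ρ (t + j) G' (R.threads t G j)) N (.blocks E)) ?_
  ext θ
  constructor
  · rintro ⟨θ', h', hn | hk⟩
    · obtain ⟨i, b, c, v, hb, hf, rfl⟩ := h'
      rw [R.next_code hb hj1 hj] at hn
      exact ⟨i, b, c, v, hb, hf, (Option.some.inj hn).symm⟩
    · exact absurd hk (R.forked_threads hj1 (by omega) h')
  · rintro ⟨i, b, c, v, hb, hf, rfl⟩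
    exact ⟨_, ⟨i, b, c, v, hb, hf, rfl⟩, .inl (R.next_code hb hj1 hj t v G')⟩

theorem step_threads_four {t : ℕ} {G G' : PGraph (Dir α m)}
    (hne : (R.threads t G 4).Nonempty) (N : Node) :
    R.machine.step ρ ⟨t + 4, G', N, .blocks (R.threads t G 4)⟩ =
      ⟨t + 5, R.machine.update ρ (t + 4) G' (R.threads t G 4), N, .blocks ∅⟩ := by
  simp only [MWSMM.step, hne.ne_empty, if_false]
  congr 2
  rw [Set.eq_empty_iff_forall_notMem]
  rintro θ ⟨θ', h', hn | hk⟩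
  · obtain ⟨i, b, c, v, hb, hf, rfl⟩ := h'
    have hp := R.prog_block hb (j := 4) (by omega)
    rw [if_neg (by omega)] at hp
    rcases R.body_cases hb with ⟨d, -, hi, rfl⟩ | ⟨x, d, y, -, hi, rfl⟩
    · simp [MWSMM.next, hp, newCode] at hn
    · simp [MWSMM.next, hp, setCode] at hn
  · exact absurd hk (R.forked_threads (by omega) (by omega) h')

/-- Five steps of the machine are one synchronous round. -/
theorem exists_round {t : ℕ} {G : PGraph (Dir α m)}
    (hG : ∀ t' l c, Node.fresh t' l c ∈ G.nodes → t' ≤ t) (N : Node) :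
    ∃ G', (R.machine.step ρ)^[5] ⟨t, G, N, .blocks ∅⟩ = ⟨t + 5, G', N, .blocks ∅⟩ ∧
      R.Round t G G' := by
  by_cases hne : (R.threads t G 1).Nonempty
  swap
  · have hE : R.threads t G 1 = ∅ := Set.not_nonempty_iff_eq_empty.1 hne
    -- Nothing is selected, whatever the time; each of the five steps restarts the empty set of
    -- executions and leaves the graph alone.
    have hs : ∀ t', R.threads t' G 1 = ∅ := by
      intro t'
      rw [← hE, ← R.forked_top G t, ← R.forked_top G t']
    have hno : ∀ i b c u, R.body[i]? = some (b, c) → ¬ R.Fires G b u :=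
      fun i b c u hb hf => hne ⟨_, i, b, c, u, hb, hf, rfl⟩
    have hborn : ∀ u, ¬ R.Born t G u := by
      rintro u ⟨i, b, d, c, hn, hf, -⟩
      exact hno _ _ _ _ (R.body_news hn).1 hf
    refine ⟨G, ?_, ⟨fun u => by simp [hborn u], fun u _ d => .inr ⟨?_, rfl⟩,
      fun u h => absurd h (hborn u), fun u h => absurd h (hborn u)⟩⟩
    · simp only [Function.iterate_succ, Function.iterate_zero, Function.comp, id, step_empty, hs]
    · rintro y (⟨b, x, z, hb, c, hf, -⟩ | ⟨i, b, hn, hf, -⟩)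
      · obtain ⟨i, hb, -⟩ := R.body_sets hb
        exact hno _ _ _ _ hb hf
      · exact hno _ _ _ _ (R.body_news hn).1 hf
  set G2 := R.machine.update ρ (t + 1) G (R.threads t G 1) with hG2
  set G3 := R.machine.update ρ (t + 2) G2 (R.threads t G 2) with hG3
  set G4 := R.machine.update ρ (t + 3) G3 (R.threads t G 3) with hG4
  set G5 := R.machine.update ρ (t + 4) G4 (R.threads t G 4) with hG5
  have c1 : ∀ u, R.machine.Creates (t + 1) (R.threads t G 1) u ↔ R.Born t G u := fun u => by
    rw [R.creates_threads (by omega) (by omega)]; simp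
  have c2 : ∀ u, ¬ R.machine.Creates (t + 2) (R.threads t G 2) u := fun u => by
    rw [R.creates_threads (by omega) (by omega)]; simp
  have c3 : ∀ u, ¬ R.machine.Creates (t + 3) (R.threads t G 3) u := fun u => by
    rw [R.creates_threads (by omega) (by omega)]; simp
  have c4 : ∀ u, ¬ R.machine.Creates (t + 4) (R.threads t G 4) u := fun u => by
    rw [R.creates_threads (by omega) (by omega)]; simp
  -- The name of a new node contains the time `t + 1`, later than that of any existing node.
  have hold : ∀ u ∈ G.nodes, ¬ R.Born t G u := by
    rintro u hu ⟨i, b, d, c, -, -, rfl⟩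
    have := hG _ _ _ hu; omega
  have e2b : ∀ u d, R.Born t G u → G2.edge u d = u.creator := fun u d h =>
    MWSMM.update_edge_of_creates _ _ _ _ _ ((c1 u).2 h) d
  have e5 : G5.edge = G4.edge := by
    funext u d
    exact MWSMM.update_edge_of_not_sets _ _ _ _ _ (c4 u) fun y => R.sets_threads_four
  have e4 : ∀ u d, d ≠ .o → G4.edge u d = G3.edge u d := fun u d hd =>
    MWSMM.update_edge_of_not_sets _ _ _ _ _ (c3 u) fun y hy =>
      hd (R.sets_threads_three.1 hy).1
  have e4o : ∀ u d, ¬ R.Born t G u → G4.edge u d = G3.edge u d := fun u d hu =>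
    MWSMM.update_edge_of_not_sets _ _ _ _ _ (c3 u) fun y hy =>
      hu (R.sets_threads_three.1 hy).2.1
  have e4b : ∀ u, R.Born t G u → G4.edge u .o = G3.edge (G3.edge u .o) .o := fun u hu =>
    MWSMM.update_edge_of_unique _ _ _ _ _ (c3 u) (R.sets_threads_three.2 ⟨rfl, hu, rfl⟩)
      fun y hy => (R.sets_threads_three.1 hy).2.2
  -- On the second line `.o` of a child still leads to its creator, so the edge that is set belongs
  -- to the creator.
  have link : ∀ u d y, R.machine.Sets G2 (R.threads t G 2) u d y ↔
      ∃ i b, R.news[i]? = some (b, d) ∧ R.Fires G b u ∧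
        y = .fresh (t + 1) (5 * (i + 1) + 1) u := by
    intro u d y
    rw [R.sets_threads_two]
    constructor
    · rintro ⟨i, b, c, hn, hf, h1, h2⟩
      rw [e2b _ _ ⟨i, b, d, c, hn, hf, rfl⟩] at h1
      simp only [Node.creator] at h1
      subst h1
      exact ⟨i, b, hn, hf, h2⟩
    · rintro ⟨i, b, hn, hf, h2⟩
      exact ⟨i, b, u, hn, hf, e2b _ _ ⟨i, b, d, u, hn, hf, rfl⟩, h2⟩
  have e3n : ∀ u d, u ∉ G.nodes ∨ d = .o → G3.edge u d = G2.edge u d := fun u d h =>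
    MWSMM.update_edge_of_not_sets _ _ _ _ _ (c2 u) fun y hy => by
      obtain ⟨i, b, hn, hf, -⟩ := (link u d y).1 hy
      rcases h with h | rfl
      · exact h hf.1
      · exact R.news_ne _ (List.mem_of_getElem? hn) rfl
  have e2o : ∀ u, ¬ R.Born t G u → G2.edge u .o = G.edge u .o := fun u hu =>
    MWSMM.update_edge_of_not_sets _ _ _ _ _ (fun h => hu ((c1 u).1 h)) fun y hy => by
      obtain ⟨b, x, z, hs, -⟩ := R.sets_threads_one.1 hy
      exact R.sets_ne _ hs rfl
  have hbn : ∀ u, R.Born t G u → u ∉ G.nodes := fun u h h' => hold u h' h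
  refine ⟨G5, ?_, ⟨?_, ?_, ?_, ?_⟩⟩
  · have hh : ∀ j, (R.threads t G j).Nonempty := fun j => R.threads_nonempty hne
    simp only [Function.iterate_succ, Function.iterate_zero, Function.comp, id]
    rw [step_empty, R.step_threads ρ (by omega) (by omega) hne,
      R.step_threads ρ (j := 2) (by omega) (by omega) (hh 2),
      R.step_threads ρ (j := 3) (by omega) (by omega) (hh 3),
      R.step_threads_four ρ (hh 4)]
  · intro u
    rw [hG5, MWSMM.update_nodes, hG4, MWSMM.update_nodes, hG3, MWSMM.update_nodes, hG2,
      MWSMM.update_nodes, c1]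
    simp only [c2, c3, c4, or_false]
  · intro u hu d
    have hb := hold u hu
    rw [e5, e4o u d hb]
    -- Links to children are written one step after the redirections and override them; either value
    -- counts as a proposal.
    by_cases hl : ∃ y, R.machine.Sets G2 (R.threads t G 2) u d y
    · obtain ⟨y, hy⟩ := hl
      exact .inl (.inr ((link _ _ _).1
        (MWSMM.update_edge_of_sets _ ρ (t + 2) G2 (R.threads t G 2) (c2 u) hy)))
    · have h3 : G3.edge u d = G2.edge u d :=
        MWSMM.update_edge_of_not_sets _ _ _ _ _ (c2 u) fun y hy => hl ⟨y, hy⟩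
      rw [h3]
      have hc1 : ¬ R.machine.Creates (t + 1) (R.threads t G 1) u := fun h => hb ((c1 u).1 h)
      by_cases hs : ∃ y, R.machine.Sets G (R.threads t G 1) u d y
      · obtain ⟨y, hy⟩ := hs
        exact .inl (.inl (R.sets_threads_one.1
          (MWSMM.update_edge_of_sets _ ρ (t + 1) G (R.threads t G 1) hc1 hy)))
      · refine .inr ⟨?_, MWSMM.update_edge_of_not_sets _ _ _ _ _ hc1 fun y hy => hs ⟨y, hy⟩⟩
        rintro y (h | h)
        · exact hs ⟨y, R.sets_threads_one.2 h⟩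
        · exact hl ⟨y, (link _ _ _).2 h⟩
  · intro u hu d hd
    rw [e5, e4 u d hd, e3n u d (.inl (hbn u hu)), e2b u d hu]
  · intro u hu
    rw [e5, e4b u hu, e3n u _ (.inr rfl), e2b u _ hu]
    obtain ⟨i, b, d, c, hn, hf, rfl⟩ := hu
    rw [Node.creator, e3n c _ (.inr rfl), e2o c (hold c hf.1)]

/-- The initial center. -/
def base (x : List α) : Node := if x = [] then .origin else .cell (x.length - 1)

/-- The center that the prologue creates. -/
def root (x : List α) : Node := .fresh 0 0 (base x)

open Classical in
/-- The graph after the prologue. -/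
noncomputable def startGraph (x : List α) : PGraph (Dir α m) where
  nodes := {u | u ∈ (MWSMM.inputGraph m x).nodes ∨ u = root x}
  edge := fun u d =>
    if u = root x then (if d = .o ∨ d = R.nil then .origin else base x)
    else if u = .origin ∧ d = R.ctr then root x
    else (MWSMM.inputGraph m x).edge u d

theorem inputGraph_origin (x : List α) (d : Dir α m) :
    (MWSMM.inputGraph m x).edge .origin d = .origin := by
  simp [MWSMM.inputGraph]

theorem inputGraph_o (x : List α) (u : Node) :
    (MWSMM.inputGraph m x).edge u .o = .origin := by
  cases u <;> simp [MWSMM.inputGraph]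

theorem creates_single {t k : ℕ} {N u : Node} (hk : k < 5) :
    R.machine.Creates t {⟨k, N⟩} u ↔ k = 0 ∧ u = .fresh t 0 N := by
  constructor
  · rintro ⟨_, rfl, hp, rfl⟩
    rw [R.prog_prologue hk] at hp
    obtain rfl : k = 0 := by interval_cases k <;> simp [prologue] at hp ⊢
    exact ⟨rfl, rfl⟩
  · rintro ⟨rfl, rfl⟩
    exact ⟨_, rfl, by rw [R.prog_prologue (by omega)]; rfl, rfl⟩

theorem sets_single {k : ℕ} {G : PGraph (Dir α m)} {N u y : Node} {d : Dir α m} (hk : k < 5) :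
    R.machine.Sets G {⟨k, N⟩} u d y ↔
      (k = 1 ∧ u = N ∧ d = .o ∧ y = G.edge (G.edge N .o) .o) ∨
      (k = 2 ∧ u = N ∧ d = R.nil ∧ y = G.edge N .o) ∨
      (k = 3 ∧ u = G.edge N .o ∧ d = R.ctr ∧ y = N) := by
  constructor
  · rintro ⟨_, rfl, x, z, hp, h1, h2⟩
    rw [R.prog_prologue hk] at hp
    interval_cases k <;> simp [prologue] at hp <;> obtain ⟨rfl, rfl, rfl⟩ := hp <;>
      simp_all [PGraph.follow]
  · rintro (⟨rfl, rfl, rfl, rfl⟩ | ⟨rfl, rfl, rfl, rfl⟩ | ⟨rfl, rfl, rfl, rfl⟩)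
    · exact ⟨_, rfl, [], [.o, .o], by rw [R.prog_prologue (by omega)]; rfl, rfl, rfl⟩
    · exact ⟨_, rfl, [], [.o], by rw [R.prog_prologue (by omega)]; rfl, rfl, rfl⟩
    · exact ⟨_, rfl, [.o], [], by rw [R.prog_prologue (by omega)]; rfl, rfl, rfl⟩

theorem base_ne_root (x : List α) : base x ≠ root x := by
  unfold root base; split_ifs <;> simp

/-- The edge `.o` of the new node first leads to the old center, whose own `.o` is the origin, also
when the input is empty and the old center is the origin itself. -/
theorem prologue_run (x : List α) :
    (R.machine.step ρ)^[5] (R.machine.init x) = ⟨5, R.startGraph x, root x, .blocks ∅⟩ := by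
  set g0 : PGraph (Dir α m) := MWSMM.inputGraph m x with hg0
  set g1 := R.machine.update ρ 0 g0 {⟨0, base x⟩} with hg1
  set g2 := R.machine.update ρ 1 g1 {⟨1, root x⟩} with hg2
  set g3 := R.machine.update ρ 2 g2 {⟨2, root x⟩} with hg3
  set g4 := R.machine.update ρ 3 g3 {⟨3, root x⟩} with hg4
  set g5 := R.machine.update ρ 4 g4 {⟨4, root x⟩} with hg5
  have hp : ∀ k, k < 5 → R.machine.prog[k]? = some (R.prologue k) := fun k => R.prog_prologue
  have hstep : (R.machine.step ρ)^[5] (R.machine.init x) = ⟨5, g5, root x, .blocks ∅⟩ := by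
    have h0 : R.machine.step ρ (R.machine.init x) = ⟨1, g1, root x, .prologue 1⟩ := by
      simp only [MWSMM.step, MWSMM.init, MWSMM.next, hp 0 (by omega), prologue, zero_add]; rfl
    have h1 : R.machine.step ρ ⟨1, g1, root x, .prologue 1⟩ = ⟨2, g2, root x, .prologue 2⟩ := by
      simp only [MWSMM.step, MWSMM.next, hp 1 (by omega), prologue]; rfl
    have h2 : R.machine.step ρ ⟨2, g2, root x, .prologue 2⟩ = ⟨3, g3, root x, .prologue 3⟩ := by
      simp only [MWSMM.step, MWSMM.next, hp 2 (by omega), prologue]; rfl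
    have h3 : R.machine.step ρ ⟨3, g3, root x, .prologue 3⟩ = ⟨4, g4, root x, .prologue 4⟩ := by
      simp only [MWSMM.step, MWSMM.next, hp 3 (by omega), prologue]; rfl
    have h4 : R.machine.step ρ ⟨4, g4, root x, .prologue 4⟩ = ⟨5, g5, root x, .blocks ∅⟩ := by
      simp only [MWSMM.step, MWSMM.next, hp 4 (by omega), prologue]; rfl
    simp only [Function.iterate_succ, Function.iterate_zero, Function.comp, id, h0, h1, h2, h3, h4]
  have hr : (root x : Node) = .fresh 0 0 (base x) := rfl
  have hbr := base_ne_root x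
  have n0 : ∀ k t u, k < 5 → 0 < k → ¬ R.machine.Creates t {⟨k, root x⟩} u := by
    intro k t u hk hk0 h
    have := (R.creates_single hk).1 h; omega
  have c1 : ∀ u, R.machine.Creates 0 {⟨0, base x⟩} u ↔ u = root x := fun u => by
    rw [R.creates_single (by omega)]; simp [hr]
  have hk := R.nil_ne
  have e1 : ∀ d, g1.edge (root x) d = base x := fun d =>
    MWSMM.update_edge_of_creates _ _ _ _ _ ((c1 _).2 rfl) d
  have e1' : ∀ u d, u ≠ root x → g1.edge u d = g0.edge u d := fun u d hu =>
    MWSMM.update_edge_of_not_sets _ _ _ _ _ (fun h => hu ((c1 u).1 h)) fun y hy => by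
      have := (R.sets_single (by omega)).1 hy; simp at this
  have e2 : g2.edge (root x) .o = .origin := by
    refine MWSMM.update_edge_of_unique _ _ _ _ _ (n0 _ _ _ (by omega) (by omega))
      ((R.sets_single (by omega)).2 (.inl ⟨rfl, rfl, rfl, ?_⟩)) fun y hy => ?_
    · rw [e1, e1' _ _ hbr, hg0, inputGraph_o]
    · have := (R.sets_single (by omega)).1 hy
      simp only [true_and, OfNat.one_ne_ofNat, false_and, or_false] at this
      rw [this, e1, e1' _ _ hbr, hg0, inputGraph_o]
  have e2' : ∀ u d, ¬ (u = root x ∧ d = .o) → g2.edge u d = g1.edge u d := fun u d hu =>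
    MWSMM.update_edge_of_not_sets _ _ _ _ _ (n0 _ _ _ (by omega) (by omega)) fun y hy => by
      have := (R.sets_single (by omega)).1 hy
      simp only [true_and, OfNat.one_ne_ofNat, false_and, or_false] at this
      exact hu ⟨this.1, this.2.1⟩
  have e3 : g3.edge (root x) R.nil = .origin := by
    refine MWSMM.update_edge_of_unique _ _ _ _ _ (n0 _ _ _ (by omega) (by omega))
      ((R.sets_single (by omega)).2 (.inr (.inl ⟨rfl, rfl, rfl, e2.symm⟩))) fun y hy => ?_
    have := (R.sets_single (by omega)).1 hy
    simp only [OfNat.ofNat_ne_one, false_and, true_and, Nat.reduceEqDiff, or_false,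
      false_or] at this
    rw [this, e2]
  have e3' : ∀ u d, ¬ (u = root x ∧ d = R.nil) → g3.edge u d = g2.edge u d := fun u d hu =>
    MWSMM.update_edge_of_not_sets _ _ _ _ _ (n0 _ _ _ (by omega) (by omega)) fun y hy => by
      have := (R.sets_single (by omega)).1 hy
      simp only [OfNat.ofNat_ne_one, false_and, true_and, Nat.reduceEqDiff, or_false,
        false_or] at this
      exact hu ⟨this.1, this.2.1⟩
  have e3o : g3.edge (root x) .o = .origin := by
    rw [e3' _ _ (fun h => R.nil_ne h.2.symm), e2]
  have e4 : g4.edge .origin R.ctr = root x := by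
    refine MWSMM.update_edge_of_unique _ _ _ _ _ (n0 _ _ _ (by omega) (by omega))
      ((R.sets_single (by omega)).2 (.inr (.inr ⟨rfl, e3o.symm, rfl, rfl⟩))) fun y hy => ?_
    have := (R.sets_single (by omega)).1 hy
    simp only [OfNat.ofNat_ne_one, false_and, true_and, Nat.reduceEqDiff, false_or] at this
    exact this.2
  have e4' : ∀ u d, ¬ (u = .origin ∧ d = R.ctr) → g4.edge u d = g3.edge u d := fun u d hu =>
    MWSMM.update_edge_of_not_sets _ _ _ _ _ (n0 _ _ _ (by omega) (by omega)) fun y hy => by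
      have := (R.sets_single (by omega)).1 hy
      simp only [OfNat.ofNat_ne_one, false_and, true_and, Nat.reduceEqDiff, false_or] at this
      exact hu ⟨this.1.trans e3o, this.2.1⟩
  have e5 : ∀ u d, g5.edge u d = g4.edge u d := fun u d =>
    MWSMM.update_edge_of_not_sets _ _ _ _ _ (n0 _ _ _ (by omega) (by omega)) fun y hy => by
      have := (R.sets_single (by omega)).1 hy; simp at this
  have hne : (Node.origin : Node) ≠ root x := by simp [hr]
  have hedge : g5.edge = (R.startGraph x).edge := by
    funext u d
    rw [e5]
    simp only [startGraph]
    by_cases hu : u = root x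
    · subst hu
      rw [if_pos rfl, e4' _ _ (fun h => hne h.1.symm)]
      by_cases hd : d = .o
      · subst hd; rw [if_pos (.inl rfl), e3o]
      · by_cases hd' : d = R.nil
        · subst hd'; rw [if_pos (.inr rfl), e3]
        · rw [if_neg (by tauto), e3' _ _ (fun h => hd' h.2), e2' _ _ (fun h => hd h.2), e1]
    · rw [if_neg hu]
      by_cases ho : u = .origin ∧ d = R.ctr
      · obtain ⟨rfl, rfl⟩ := ho
        rw [if_pos ⟨rfl, rfl⟩, e4]
      · rw [if_neg ho, e4' _ _ ho, e3' _ _ (fun h => hu h.1), e2' _ _ (fun h => hu h.1),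
          e1' _ _ hu]
  have hnodes : g5.nodes = (R.startGraph x).nodes := by
    ext u
    rw [hg5, MWSMM.update_nodes, hg4, MWSMM.update_nodes, hg3, MWSMM.update_nodes, hg2,
      MWSMM.update_nodes, hg1, MWSMM.update_nodes, c1]
    simp only [n0 1 1 u (by omega) (by omega), n0 2 2 u (by omega) (by omega),
      n0 3 3 u (by omega) (by omega), n0 4 4 u (by omega) (by omega), or_false]
    rfl
  have : g5 = R.startGraph x := by
    calc g5 = ⟨g5.nodes, g5.edge⟩ := rfl
      _ = R.startGraph x := by rw [hedge, hnodes]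
  rw [hstep, this]

/-- The graph after `r` rounds. -/
noncomputable def graphAt (x : List α) (r : ℕ) : PGraph (Dir α m) :=
  (R.machine.run ρ x (5 + 5 * r)).graph

theorem fresh_startGraph (x : List α) {t l : ℕ} {c : Node}
    (h : Node.fresh t l c ∈ (R.startGraph x).nodes) : Node.fresh t l c = root x := by
  rcases h with h | h
  · simp [MWSMM.inputGraph] at h
  · exact h

/-- The bound on creation times is carried through the induction because it guarantees that the
names given in the next round are new. -/
theorem run_rounds (x : List α) (r : ℕ) :
    R.machine.run ρ x (5 + 5 * r) = ⟨5 + 5 * r, R.graphAt ρ x r, root x, .blocks ∅⟩ ∧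
      (∀ t' l c, Node.fresh t' l c ∈ (R.graphAt ρ x r).nodes → t' ≤ 5 + 5 * r) := by
  induction r with
  | zero =>
    have h : R.machine.run ρ x (5 + 5 * 0) = ⟨5, R.startGraph x, root x, .blocks ∅⟩ :=
      R.prologue_run ρ x
    refine ⟨by rw [graphAt, h], fun t' l c hc => ?_⟩
    rw [graphAt, h] at hc
    have := R.fresh_startGraph x hc
    simp only [root, Node.fresh.injEq] at this; omega
  | succ r ih =>
    obtain ⟨h1, h2⟩ := ih
    obtain ⟨G', h3, h4⟩ := R.exists_round ρ h2 (root x)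
    have h : R.machine.run ρ x (5 + 5 * (r + 1)) = ⟨5 + 5 * r + 5, G', root x, .blocks ∅⟩ := by
      rw [← h3, ← h1]
      rw [MWSMM.run, MWSMM.run, ← Function.iterate_add_apply]
      congr 2; ring
    have hg : R.graphAt ρ x (r + 1) = G' := by rw [graphAt, h]
    refine ⟨by rw [h, hg]; rfl, fun t' l c hc => ?_⟩
    rw [hg] at hc
    rcases (h4.nodes _).1 hc with hc | ⟨i, b, d, v, -, -, hv⟩
    · have := h2 _ _ _ hc; omega
    · simp only [Node.fresh.injEq] at hv; omega

theorem round_graphAt (x : List α) (r : ℕ) :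
    R.Round (5 + 5 * r) (R.graphAt ρ x r) (R.graphAt ρ x (r + 1)) := by
  obtain ⟨h1, h2⟩ := R.run_rounds ρ x r
  obtain ⟨G', h3, h4⟩ := R.exists_round ρ h2 (root x)
  have h : R.machine.run ρ x (5 + 5 * (r + 1)) = ⟨5 + 5 * r + 5, G', root x, .blocks ∅⟩ := by
    rw [← h3, ← h1]
    rw [MWSMM.run, MWSMM.run, ← Function.iterate_add_apply]
    congr 2; ring
  have hg : R.graphAt ρ x (r + 1) = G' := by rw [graphAt, h]
  rw [hg]; exact h4

theorem graphAt_zero (x : List α) : R.graphAt ρ x 0 = R.startGraph x := by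
  have h : R.machine.run ρ x (5 + 5 * 0) = ⟨5, R.startGraph x, root x, .blocks ∅⟩ :=
    R.prologue_run ρ x
  rw [graphAt, h]

/-- If `live` fails at all nodes after `r` rounds, the machine has halted. -/
theorem decidesWithin (x : List α) (r t : ℕ) (P : Prop) (ht : 5 + 5 * r ≤ t)
    (hl : ∀ u ∈ (R.graphAt ρ x r).nodes, ¬ R.live.Holds (R.graphAt ρ x r) u)
    (hP : P → (R.graphAt ρ x r).edge (root x) .v = .origin)
    (hP' : ¬ P → (R.graphAt ρ x r).edge (root x) .v = root x) :
    R.machine.DecidesWithin ρ x t P := by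
  obtain ⟨h, -⟩ := R.run_rounds ρ x r
  refine ⟨5 + 5 * r, ht, ?_, ?_, ?_, ?_⟩
  · rw [h]
    refine ⟨rfl, fun l hl' => ?_⟩
    rw [Set.eq_empty_iff_forall_notMem]
    intro θ hθ
    have : θ ∈ R.threads 0 (R.graphAt ρ x r) 1 := by
      rw [← R.forked_top]; exact ⟨l, hl', hθ⟩
    obtain ⟨i, b, c, u, -, hf, -⟩ := this
    exact hl u hf.1 hf.2.1
  · rw [h]; simp [root]
  · rw [h]; exact hP
  · rw [h]; exact hP'

/-! ### Directions that no rule changes -/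

/-- Nodes persist. -/
theorem mem_of_le (x : List α) {r s : ℕ} (h : r ≤ s) {u : Node}
    (hu : u ∈ (R.graphAt ρ x r).nodes) : u ∈ (R.graphAt ρ x s).nodes := by
  induction s, h using Nat.le_induction with
  | base => exact hu
  | succ s _ ih => exact ((R.round_graphAt ρ x s).nodes u).2 (.inl ih)

theorem mem_start (x : List α) (r : ℕ) {u : Node} (hu : u ∈ (R.startGraph x).nodes) :
    u ∈ (R.graphAt ρ x r).nodes :=
  R.mem_of_le ρ x (Nat.zero_le r) (by rwa [R.graphAt_zero])

/-- No rule changes the direction `d`. -/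
def Unwritten (d : Dir α m) : Prop :=
  (∀ b x z, (b, x, d, z) ∉ R.sets) ∧ ∀ b, (b, d) ∉ R.news

theorem unwritten_o : R.Unwritten .o :=
  ⟨fun _ _ _ h => R.sets_ne _ h rfl, fun _ h => R.news_ne _ h rfl⟩

variable {R} in
theorem Unwritten.not_proposed {d : Dir α m} (hd : R.Unwritten d) {t G u y} :
    ¬ R.Proposed t G u d y := by
  rintro (⟨b, x, z, h, -⟩ | ⟨i, b, h, -⟩)
  · exact hd.1 _ _ _ h
  · exact hd.2 _ (List.mem_of_getElem? h)

theorem unwritten_start {d : Dir α m} (hd : R.Unwritten d) (x : List α) (r : ℕ) {u : Node}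
    (hu : u ∈ (R.startGraph x).nodes) :
    (R.graphAt ρ x r).edge u d = (R.startGraph x).edge u d := by
  induction r with
  | zero => rw [R.graphAt_zero]
  | succ r ih =>
    rcases (R.round_graphAt ρ x r).old u (R.mem_start ρ x r hu) d with h | ⟨-, h⟩
    · exact absurd h hd.not_proposed
    · rw [h, ih]

theorem edge_o (x : List α) (r : ℕ) {u : Node} (hu : u ∈ (R.graphAt ρ x r).nodes) :
    (R.graphAt ρ x r).edge u .o = .origin := by
  induction r generalizing u with
  | zero =>
    rw [R.graphAt_zero] at hu ⊢
    simp only [startGraph, true_or, if_true]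
    split_ifs with h1 h2
    · rfl
    · exact absurd h2.2.symm R.ctr_ne
    · exact inputGraph_o x u
  | succ r ih =>
    have hR := R.round_graphAt ρ x r
    rcases (hR.nodes u).1 hu with h | h
    · rcases hR.old u h .o with h' | ⟨-, h'⟩
      · exact absurd h' R.unwritten_o.not_proposed
      · rw [h', ih h]
    · rw [hR.born_o u h]
      obtain ⟨i, b, d, c, -, hf, rfl⟩ := h
      exact ih hf.1

/-- A created node starts with all edges at its creator. Hence a direction that no rule writes is a
permanent pointer to the creator; `.o`, and `nil` at the center, are the exceptions made by the
code. -/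
theorem unwritten_fresh {d : Dir α m} (hd : R.Unwritten d) (ho : d ≠ .o) (hn : d ≠ R.nil)
    (x : List α) (r : ℕ) {t l : ℕ} {c : Node}
    (hu : Node.fresh t l c ∈ (R.graphAt ρ x r).nodes) :
    (R.graphAt ρ x r).edge (.fresh t l c) d = c := by
  induction r with
  | zero =>
    rw [R.graphAt_zero] at hu ⊢
    have h := R.fresh_startGraph x hu
    have hc : c = base x := by simp only [root, Node.fresh.injEq] at h; exact h.2.2
    rw [h]
    simp [startGraph, ho, hn, hc]
  | succ r ih =>
    have hR := R.round_graphAt ρ x r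
    rcases (hR.nodes _).1 hu with h | h
    · rcases hR.old _ h d with h' | ⟨-, h'⟩
      · exact absurd h' hd.not_proposed
      · rw [h', ih h]
    · rw [hR.born _ h d ho]; rfl

-- The way in which conflicts are resolved is irrelevant as soon as all proposals for an edge
-- coincide. Every statement about a computed edge rests on this.
variable {R} in
theorem step_eq {t : ℕ} {G G' : PGraph (Dir α m)} (hR : R.Round t G G') {u : Node}
    (hu : u ∈ G.nodes) {d : Dir α m} {y : Node} (hp : ∃ y', R.Proposed t G u d y')
    (h : ∀ y', R.Proposed t G u d y' → y' = y) : G'.edge u d = y := by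
  obtain ⟨y', hp⟩ := hp
  rcases hR.old u hu d with h' | ⟨h', -⟩
  · exact h _ h'
  · exact absurd hp (h' _)

variable {R} in
theorem step_keep {t : ℕ} {G G' : PGraph (Dir α m)} (hR : R.Round t G G') {u : Node}
    (hu : u ∈ G.nodes) {d : Dir α m} (h : ∀ y', ¬ R.Proposed t G u d y') :
    G'.edge u d = G.edge u d := by
  rcases hR.old u hu d with h' | ⟨-, h'⟩
  · exact absurd h' (h _)
  · exact h'

variable {R} in
theorem step_cases {t : ℕ} {G G' : PGraph (Dir α m)} (hR : R.Round t G G') {u : Node}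
    (hu : u ∈ G.nodes) (d : Dir α m) :
    R.Proposed t G u d (G'.edge u d) ∨ G'.edge u d = G.edge u d := by
  rcases hR.old u hu d with h' | ⟨-, h'⟩
  · exact .inl h'
  · exact .inr h'

/-- Origin, cells, the center, and nodes created by rules. -/
theorem node_cases (x : List α) (r : ℕ) {u : Node} (hu : u ∈ (R.graphAt ρ x r).nodes) :
    u = .origin ∨ (∃ i < x.length, u = .cell i) ∨ u = root x ∨
      ∃ s < r, ∃ i b d c, R.news[i]? = some (b, d) ∧ R.Fires (R.graphAt ρ x s) b c ∧
        u = .fresh (5 + 5 * s + 1) (5 * (i + 1) + 1) c := by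
  induction r with
  | zero =>
    rw [R.graphAt_zero] at hu
    rcases hu with (h | h) | h
    · exact .inl h
    · exact .inr (.inl h)
    · exact .inr (.inr (.inl h))
  | succ r ih =>
    rcases ((R.round_graphAt ρ x r).nodes u).1 hu with h | ⟨i, b, d, c, hb, hf, rfl⟩
    · rcases ih h with h | h | h | ⟨s, hs, h⟩
      · exact .inl h
      · exact .inr (.inl h)
      · exact .inr (.inr (.inl h))
      · exact .inr (.inr (.inr ⟨s, by omega, h⟩))
    · exact .inr (.inr (.inr ⟨r, by omega, i, b, d, c, hb, hf, rfl⟩))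

end RuleSet

/-! ## Quantified boolean formulas as trees -/

/-- Letters with one argument. -/
def QSym.isUn : QSym → Bool
  | .all | .ex | .not => true
  | _ => false

/-- Letters with two arguments. -/
def QSym.isBin : QSym → Bool
  | .and | .or => true
  | _ => false

theorem QSym.isUn_cases {s : QSym} (h : s.isUn = true) : s = .all ∨ s = .ex ∨ s = .not := by
  cases s <;> simp_all [QSym.isUn]

theorem QSym.isBin_cases {s : QSym} (h : s.isBin = true) : s = .and ∨ s = .or := by
  cases s <;> simp_all [QSym.isBin]

/-- The value of a node of an evaluation tree, given the values of its two children. -/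
def QSym.comb : QSym → Bool → Bool → Bool
  | .all, a, b | .and, a, b => a && b
  | .ex, a, b | .or, a, b => a || b
  | .not, a, _ => !a
  | _, _, _ => false

/-- Formulas in which quantifiers and connectives are treated alike. -/
inductive QF
  | var (i : ℕ)
  | un (s : QSym) (hs : s.isUn = true) (f : QF)
  | bin (s : QSym) (hs : s.isBin = true) (f g : QF)

namespace QF

/-- Prefix notation. -/
def encode : QF → List QSym
  | .var i => .var :: List.replicate i .tick
  | .un s _ f => s :: f.encode
  | .bin s _ f g => s :: (f.encode ++ g.encode)

/-- The nesting depth. -/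
def depth : QF → ℕ
  | .var _ => 0
  | .un _ _ f => f.depth + 1
  | .bin _ _ f g => max f.depth g.depth + 1

/-- The value at the address `β` (the last branch first) in an evaluation tree, in which every node
has two children; the first branches give the values of the variables. -/
def eval : QF → List Bool → Bool
  | .var i, β => β.reverse.getD i false
  | .un s _ f, β => s.comb (f.eval (false :: β)) (f.eval (true :: β))
  | .bin s _ f g, β => s.comb (f.eval (false :: β)) (g.eval (true :: β))

/-- All variables have an index below `n`. -/
def VarsLt (n : ℕ) : QF → Prop
  | .var i => i < n
  | .un _ _ f => f.VarsLt n
  | .bin _ _ f g => f.VarsLt n ∧ g.VarsLt n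

/-- The formula starts with at least `n` letters with one argument. -/
def Prefixed : ℕ → QF → Prop
  | 0, _ => True
  | k + 1, .un _ _ f => f.Prefixed k
  | _ + 1, _ => False

theorem encode_pos (f : QF) : 0 < f.encode.length := by
  cases f <;> simp [encode]

/-- Ticks occur only behind `var`, so no code begins with one. Hence the first argument of a
connective is not followed by a tick, and the index of a variable can be read off without looking
further. -/
theorem encode_head (f : QF) (l : List QSym) : (f.encode ++ l).head? ≠ some .tick := by
  cases f with
  | var i => simp [encode]
  | un s hs f => cases s <;> first | (simp [encode]; done) | exact absurd hs (by decide)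
  | bin s hs f g => cases s <;> first | (simp [encode]; done) | exact absurd hs (by decide)

/-- The code of `f` occurs in `x` from position `p` on and is not followed by a tick. -/
def Seg (x : List QSym) (p : ℕ) (f : QF) : Prop :=
  ∃ pre post, x = pre ++ (f.encode ++ post) ∧ pre.length = p ∧ post.head? ≠ some .tick

variable {x : List QSym} {p : ℕ}

theorem Seg.le {f : QF} (h : Seg x p f) : p + f.encode.length ≤ x.length := by
  obtain ⟨pre, post, rfl, rfl, -⟩ := h
  simp

theorem Seg.lt {f : QF} (h : Seg x p f) : p < x.length := by
  have := h.le; have := f.encode_pos; omega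

theorem Seg.get_un {s hs f} (h : Seg x p (.un s hs f)) : x[p]? = some s := by
  obtain ⟨pre, post, rfl, rfl, -⟩ := h
  simp [encode]

theorem Seg.get_bin {s hs f g} (h : Seg x p (.bin s hs f g)) : x[p]? = some s := by
  obtain ⟨pre, post, rfl, rfl, -⟩ := h
  simp [encode]

theorem Seg.get_var {i} (h : Seg x p (.var i)) : x[p]? = some .var := by
  obtain ⟨pre, post, rfl, rfl, -⟩ := h
  simp [encode]

theorem Seg.get_tick {i j} (h : Seg x p (.var i)) (hj0 : 0 < j) (hj : j ≤ i) :
    x[p + j]? = some .tick := by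
  obtain ⟨pre, post, rfl, rfl, -⟩ := h
  obtain ⟨j, rfl⟩ := Nat.exists_eq_succ_of_ne_zero hj0.ne'
  rw [List.getElem?_append_right (by omega)]
  simp only [encode, Nat.add_sub_cancel_left, List.cons_append, Nat.succ_eq_add_one,
    List.getElem?_cons_succ]
  rw [List.getElem?_append_left (by simpa using hj), List.getElem?_replicate]
  simp; omega

theorem Seg.get_after {i} (h : Seg x p (.var i)) : x[p + i + 1]? ≠ some .tick := by
  obtain ⟨pre, post, rfl, rfl, h⟩ := h
  rw [add_assoc, List.getElem?_append_right (by omega)]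
  simp only [encode, Nat.add_sub_cancel_left, List.cons_append, List.getElem?_cons_succ]
  rw [List.getElem?_append_right (by simp)]
  simpa [List.head?_eq_getElem?] using h

theorem Seg.un {s hs f} (h : Seg x p (.un s hs f)) : Seg x (p + 1) f := by
  obtain ⟨pre, post, rfl, rfl, h⟩ := h
  exact ⟨pre ++ [s], post, by simp [encode], by simp, h⟩

theorem Seg.bin_left {s hs f g} (h : Seg x p (.bin s hs f g)) : Seg x (p + 1) f := by
  obtain ⟨pre, post, rfl, rfl, h⟩ := h
  exact ⟨pre ++ [s], g.encode ++ post, by simp [encode], by simp, g.encode_head _⟩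

theorem Seg.bin_right {s hs f g} (h : Seg x p (.bin s hs f g)) :
    Seg x (p + 1 + f.encode.length) g := by
  obtain ⟨pre, post, rfl, rfl, h⟩ := h
  exact ⟨pre ++ (s :: f.encode), post, by simp [encode], by simp; omega, h⟩

/-- The position and the formula at an address of the evaluation tree. -/
def item (F : QF) : List Bool → Option (ℕ × QF)
  | [] => some (0, F)
  | b :: β =>
    match F.item β with
    | some (p, .un _ _ f) => some (p + 1, f)
    | some (p, .bin _ _ f g) => if b then some (p + 1 + f.encode.length, g) else some (p + 1, f)
    | _ => none

variable {F : QF}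

theorem item_un {β : List Bool} {s hs f} (h : F.item β = some (p, .un s hs f)) (b : Bool) :
    F.item (b :: β) = some (p + 1, f) := by simp [item, h]

theorem item_bin {β : List Bool} {s hs f g} (h : F.item β = some (p, .bin s hs f g)) (b : Bool) :
    F.item (b :: β) = if b then some (p + 1 + f.encode.length, g) else some (p + 1, f) := by
  simp [item, h]

/-- A property of positions, addresses and formulas that is passed on to arguments holds
everywhere. -/
theorem item_induction (P : List Bool → ℕ → QF → Prop) (h0 : P [] 0 F)
    (h1 : ∀ β p s hs f b, P β p (.un s hs f) → P (b :: β) (p + 1) f)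
    (h2 : ∀ β p s hs f g, P β p (.bin s hs f g) →
      P (false :: β) (p + 1) f ∧ P (true :: β) (p + 1 + f.encode.length) g)
    {β : List Bool} {f : QF} (h : F.item β = some (p, f)) : P β p f := by
  induction β generalizing p f with
  | nil => simp only [item, Option.some.injEq, Prod.mk.injEq] at h; obtain ⟨rfl, rfl⟩ := h; exact h0
  | cons b β ih =>
    rw [item] at h
    split at h
    · rename_i q s hs f' hq
      simp only [Option.some.injEq, Prod.mk.injEq] at h
      obtain ⟨rfl, rfl⟩ := h
      exact h1 _ _ _ _ _ _ (ih hq)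
    · rename_i q s hs f' g' hq
      cases b
      · simp only [Bool.false_eq_true, if_false, Option.some.injEq, Prod.mk.injEq] at h
        obtain ⟨rfl, rfl⟩ := h
        exact (h2 _ _ _ _ _ _ (ih hq)).1
      · simp only [if_true, Option.some.injEq, Prod.mk.injEq] at h
        obtain ⟨rfl, rfl⟩ := h
        exact (h2 _ _ _ _ _ _ (ih hq)).2
    · simp at h

theorem item_seg (hF : Seg x 0 F) {β : List Bool} {f : QF} (h : F.item β = some (p, f)) :
    Seg x p f :=
  item_induction (fun _ p f => Seg x p f) hF (fun _ _ _ _ _ _ h => h.un)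
    (fun _ _ _ _ _ _ h => ⟨h.bin_left, h.bin_right⟩) h

theorem item_depth {β : List Bool} {f : QF} (h : F.item β = some (p, f)) :
    β.length + f.depth ≤ F.depth :=
  item_induction (fun β _ f => β.length + f.depth ≤ F.depth) (by simp)
    (fun β p s hs f b h => by simp only [depth, List.length_cons] at h ⊢; omega)
    (fun β p s hs f g h => by simp only [depth, List.length_cons] at h ⊢; omega) h

theorem item_varsLt {n : ℕ} (hF : F.VarsLt n) {β : List Bool} {f : QF}
    (h : F.item β = some (p, f)) : f.VarsLt n :=
  item_induction (fun _ _ f => f.VarsLt n) hF (fun _ _ _ _ _ _ h => h) (fun _ _ _ _ _ _ h => h) h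

/-- In the quantifier prefix every branch advances by exactly one cell, on either side, so depth and
position agree. Behind the prefix, positions never fall below `n`. -/
theorem item_prefixed {n : ℕ} (hF : F.Prefixed n) {β : List Bool} {f : QF}
    (h : F.item β = some (p, f)) :
    (β.length < n → p = β.length ∧ f.Prefixed (n - β.length)) ∧ (n ≤ β.length → n ≤ p) := by
  refine item_induction (fun β p f =>
    (β.length < n → p = β.length ∧ f.Prefixed (n - β.length)) ∧ (n ≤ β.length → n ≤ p))
    ?_ ?_ ?_ h
  · exact ⟨fun _ => ⟨rfl, hF⟩, fun h => h⟩
  · intro β p s hs f b ⟨h1, h2⟩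
    simp only [List.length_cons]
    constructor
    · intro hl
      obtain ⟨h3, h4⟩ := h1 (by omega)
      rw [show n - β.length = (n - (β.length + 1)) + 1 by omega] at h4
      exact ⟨by omega, h4⟩
    · intro hl
      by_cases hb : n ≤ β.length
      · have := h2 hb; omega
      · have := (h1 (by omega)).1; omega
  · intro β p s hs f g ⟨h1, h2⟩
    have hb : n ≤ β.length := by
      by_contra hb
      have h4 := (h1 (by omega)).2
      rw [show n - β.length = (n - (β.length + 1)) + 1 by omega] at h4
      exact h4
    have := h2 hb
    simp only [List.length_cons]
    constructor <;> constructor <;> omega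

end QF

/-- An unquantified formula as a tree. -/
def BoolForm.toQF {n : ℕ} : BoolForm n → QF
  | .var i => .var i
  | .not f => .un .not rfl f.toQF
  | .and f g => .bin .and rfl f.toQF g.toQF
  | .or f g => .bin .or rfl f.toQF g.toQF

namespace BoolForm

variable {n : ℕ}

theorem encode_toQF (f : BoolForm n) : f.toQF.encode = f.encode := by
  induction f <;> simp_all [toQF, QF.encode, encode]

theorem depth_toQF (f : BoolForm n) : f.toQF.depth = f.depth := by
  induction f <;> simp_all [toQF, QF.depth, depth]

theorem varsLt_toQF (f : BoolForm n) : f.toQF.VarsLt n := by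
  induction f <;> simp_all [toQF, QF.VarsLt]

/-- The variables are read from the first `n` branches only, so the branches `γ` taken inside the
matrix do not affect them. -/
theorem eval_toQF (f : BoolForm n) (a : Fin n → Bool) (γ : List Bool) :
    f.toQF.eval (γ ++ (List.ofFn a).reverse) = f.eval a := by
  induction f generalizing γ with
  | var i => simp [toQF, QF.eval, eval, List.getElem?_append_left]
  | not f ih => simp only [toQF, QF.eval, eval, QSym.comb]; rw [← ih (false :: γ)]; rfl
  | and f g ih1 ih2 =>
    simp only [toQF, QF.eval, eval, QSym.comb]
    rw [← ih1 (false :: γ), ← ih2 (true :: γ)]; rfl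
  | or f g ih1 ih2 =>
    simp only [toQF, QF.eval, eval, QSym.comb]
    rw [← ih1 (false :: γ), ← ih2 (true :: γ)]; rfl

end BoolForm

theorem Quantifier.isUn_toQSym (q : Quantifier) : q.toQSym.isUn = true := by cases q <;> rfl

/-- A tree with quantifiers in front. -/
def QF.quantified : List Quantifier → QF → QF
  | [], f => f
  | q :: l, f => .un q.toQSym q.isUn_toQSym (QF.quantified l f)

namespace QF

theorem encode_quantified (l : List Quantifier) (f : QF) :
    (QF.quantified l f).encode = l.map Quantifier.toQSym ++ f.encode := by
  induction l <;> simp_all [QF.quantified, encode]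

theorem depth_quantified (l : List Quantifier) (f : QF) :
    (QF.quantified l f).depth = l.length + f.depth := by
  induction l <;> simp_all [QF.quantified, depth]; omega

theorem varsLt_quantified {n : ℕ} (l : List Quantifier) {f : QF} (hf : f.VarsLt n) :
    (QF.quantified l f).VarsLt n := by
  induction l <;> simp_all [QF.quantified, VarsLt]

theorem prefixed_quantified (l : List Quantifier) (f : QF) : (QF.quantified l f).Prefixed l.length := by
  induction l with
  | nil => trivial
  | cons q l ih => exact ih

/-- Each quantifier puts the value of its variable in front of the address. Behind all of them the
address is therefore the assignment in reverse, on top of `β`. -/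
theorem eval_quantified {k : ℕ} (q : Fin k → Quantifier) (P : (Fin k → Bool) → Prop) (f : QF)
    (β : List Bool) (h : ∀ a, f.eval ((List.ofFn a).reverse ++ β) = true ↔ P a) :
    (QF.quantified (List.ofFn q) f).eval β = true ↔ quantify k q P := by
  induction k generalizing β with
  | zero => simpa [QF.quantified, quantify, Subsingleton.elim (default : Fin 0 → Bool)] using h Fin.elim0
  | succ k ih =>
    have key : ∀ b, (QF.quantified (List.ofFn fun i : Fin k => q i.succ) f).eval (b :: β) = true ↔
        quantify k (fun i => q i.succ) (fun a => P (Fin.cons b a)) := by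
      intro b
      refine ih _ _ _ fun a => ?_
      rw [← h]
      simp [List.ofFn_succ]
    simp only [List.ofFn_succ, QF.quantified, eval, quantify]
    cases hq : q 0
    · simp [Quantifier.toQSym, QSym.comb, key, Bool.forall_bool]
    · simp [Quantifier.toQSym, QSym.comb, key, Bool.exists_bool]

end QF

/-- A quantified boolean formula as a tree. -/
def QBF.toQF (φ : QBF) : QF := QF.quantified (List.ofFn φ.quant) φ.matrix.toQF

namespace QBF

variable (φ : QBF)

theorem encode_toQF : φ.toQF.encode = φ.encode := by
  simp [toQF, QF.encode_quantified, BoolForm.encode_toQF, encode, List.map_ofFn, Function.comp_def]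

theorem depth_toQF : φ.toQF.depth = φ.n + φ.matrix.depth := by
  simp [toQF, QF.depth_quantified, BoolForm.depth_toQF]

theorem varsLt_toQF : φ.toQF.VarsLt φ.n := QF.varsLt_quantified _ φ.matrix.varsLt_toQF

theorem prefixed_toQF : φ.toQF.Prefixed φ.n := by
  simpa [toQF] using QF.prefixed_quantified (List.ofFn φ.quant) φ.matrix.toQF

theorem eval_toQF : φ.toQF.eval [] = true ↔ φ.IsTrue :=
  QF.eval_quantified _ _ _ _ fun a => by
    simpa using congrArg (· = true) (φ.matrix.eval_toQF a [])

theorem n_pos : 0 < φ.n := by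
  have h : ∀ {n}, BoolForm n → 0 < n := by
    intro n f
    induction f with
    | var i => exact i.pos
    | not f ih => exact ih
    | and f g ih _ => exact ih
    | or f g ih _ => exact ih
  exact h φ.matrix

end QBF

/-! ## Evaluation of quantified boolean formulas -/

namespace QBFMachine

/-- The directions. -/
abbrev D := Dir QSym 10
-- Tree nodes use `up` (parent), `cell` (the cell where the formula to evaluate starts), `ch`
-- (children) and `wk` (the node reached in the search for a quantifier). Cells use `lst` (last cell
-- of the code that starts here), `rgt` (start of the argument for the `true` child) and `qv` (at
-- the `j`-th tick, the `j`-th quantifier, so at the last tick of a variable its own). The origin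
-- uses `ctr` and `fst` (first quantifier).
abbrev up : D := .aux 0
abbrev cell : D := .aux 1
def ch : Bool → D
  | false => .aux 2
  | true => .aux 3
abbrev rgt : D := .aux 4
abbrev lst : D := .aux 5
abbrev qv : D := .aux 6
abbrev wk : D := .aux 7
abbrev ctr : D := .aux 8
abbrev fst : D := .aux 9

/-- Disjunction of a list. -/
def anyOf : List (PathExpr D) → PathExpr D
  | [] => .not (.eq [] [])
  | b :: l => .or b (anyOf l)

theorem anyOf_holds (G : PGraph D) (u : Node) (l : List (PathExpr D)) :
    (anyOf l).Holds G u ↔ ∃ b ∈ l, b.Holds G u := by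
  induction l with
  | nil => simp [anyOf, PathExpr.Holds]
  | cons b l ih => simp [anyOf, PathExpr.Holds, ih]

/-- The node is a cell with one of the given letters. -/
def letter (l : List QSym) : PathExpr D :=
  .and (anyOf (l.map fun s => .eq [.sym s] [])) (.not (.eq [.o] []))

/-- The node evaluates at a cell with one of the given letters. -/
def at' (l : List QSym) : PathExpr D :=
  .and (anyOf (l.map fun s => .eq [cell, .sym s] [cell])) (.not (.eq [cell] [.o]))

def nextTick : PathExpr D := .and (.eq [.e, .sym .tick] [.e]) (.not (.eq [.e] [.o]))

/-- A missing child shows as `ch b = up`. The edge `.v` of an existing child first leads to its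
creator, that is, to the present node, and later to the origin or to the child. So neither this
guard nor `childFalse` holds while the value is open. -/
def childTrue (b : Bool) : PathExpr D := .and (.eq [ch b, .v] [.o]) (.not (.eq [ch b] [up]))
def childFalse (b : Bool) : PathExpr D := .and (.eq [ch b, .v] [ch b]) (.not (.eq [ch b] [up]))

/-- Either the parent itself, or for `found` the parent of the node under `wk`, stands for the
quantifier of the variable. -/
def found0 : PathExpr D := .eq [up, cell] [cell, lst, qv]
def found : PathExpr D := .eq [wk, up, cell] [cell, lst, qv]
def varReady : PathExpr D := .and (at' [.var]) (.not (.eq [cell, lst, qv] [.o]))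

/-- The value of a variable occurrence has been found and is `b`. -/
def varVal (b : Bool) : PathExpr D :=
  .and varReady (.or (.and found0 (.eq [up, ch b] []))
    (.and (.and (.not found0) found) (.eq [wk, up, ch b] [wk])))

/-- Evaluation is lazy: one child may decide a conjunction or a disjunction. Values can thus appear
in any order, which is why soundness is proved without reference to time. -/
def valTrue : PathExpr D :=
  anyOf [.and (at' [.all, .and]) (.and (childTrue false) (childTrue true)),
    .and (at' [.ex, .or]) (.or (childTrue false) (childTrue true)),
    .and (at' [.not]) (childFalse false), varVal true]

def valFalse : PathExpr D :=
  anyOf [.and (at' [.all, .and]) (.or (childFalse false) (childFalse true)),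
    .and (at' [.ex, .or]) (.and (childFalse false) (childFalse true)),
    .and (at' [.not]) (childTrue false), varVal false]

/-- Waiting for `rgt` makes sure that a child finds its cell as soon as it exists. -/
def sprout (b : Bool) : PathExpr D :=
  .and (at' [.all, .ex, .not, .and, .or]) (.and (.not (.eq [cell, rgt] [.o])) (.eq [ch b] [up]))

def isChild (b : Bool) : PathExpr D := .and (.eq [up, ch b] []) (.not (.eq [.o] []))

/-- The redirections of `lst`, `rgt`, `qv` and `fst` parse the string; those of `cell` and `wk`
place the tree nodes and search for quantifiers; those of `.v` evaluate. Repeating a redirection in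
later rounds does no harm, since it again yields a right or an undefined value. Only the rule for
`fst` redirects an edge of another node. -/
def rules : RuleSet QSym 10 where
  -- At the center both `.v` and `up` lead to the creator until the result is known.
  live := .eq [.o, ctr, .v] [.o, ctr, up]
  news := [(sprout false, ch false), (sprout true, ch true)]
  sets := [
    (.and (letter [.var, .tick]) nextTick, [], lst, [.e, lst]),
    (.and (letter [.var, .tick]) (.not nextTick), [], lst, []),
    (letter [.all, .ex, .not, .and, .or], [], lst, [rgt, lst]),
    (letter [.all, .ex, .not], [], rgt, [.e]),
    (.and (letter [.and, .or]) (.not (.eq [.e, lst] [.o])), [], rgt, [.e, lst, .e]),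
    (letter [.var], [], qv, [.o, fst]),
    (letter [.tick], [], qv, [.w, qv, .e]),
    (.and (letter [.all, .ex]) (.eq [.w] [.o]), [.o], fst, []),
    (.and (.eq [.o, ctr] []) (.not (.eq [.o, fst] [.o])), [], cell, [.o, fst]),
    (isChild false, [], cell, [up, cell, .e]),
    (isChild true, [], cell, [up, cell, rgt]),
    (.and varReady (.and (.not found0) (.not found)), [], wk, [wk, up]),
    (valTrue, [], .v, [.o]),
    (valFalse, [], .v, [])]
  -- By default `cell` of the center would lead to its creator, the last cell of the input, and pass
  -- for a cell to evaluate.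
  nil := cell
  ctr := ctr
  nil_ne := by simp
  ctr_ne := by simp
  news_ne := by simp [ch]
  sets_ne := by simp


theorem ch_inj {b b' : Bool} : ch b = ch b' ↔ b = b' := by cases b <;> cases b' <;> simp [ch]

/-- The line on which a child is created. -/
def line (b : Bool) : ℕ := if b then 11 else 6

/-! ### What the rules propose for each direction -/

section

variable {t : ℕ} {G : PGraph D} {u y : Node} {d : D}

theorem proposed_set (h : rules.Proposed t G u d y) (hc : ∀ b, d ≠ ch b) (hf : d ≠ fst) :
    ∃ b z, (b, [], d, z) ∈ rules.sets ∧ rules.Fires G b u ∧ y = G.follow u z := by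
  rcases h with ⟨b, x, z, h, c, hf', h1, h2⟩ | ⟨i, b, h, -⟩
  · obtain rfl : x = [] := by
      simp only [rules, List.mem_cons, Prod.mk.injEq, List.not_mem_nil, or_false] at h
      simp only [hf, false_and, and_false, false_or] at h
      tauto
    simp only [PGraph.follow, List.foldl] at h1 h2
    subst h1 h2
    exact ⟨b, z, h, hf', rfl⟩
  · have := List.mem_of_getElem? h
    simp only [rules, List.mem_cons, Prod.mk.injEq, List.not_mem_nil, or_false] at this
    rcases this with ⟨-, h⟩ | ⟨-, h⟩ <;> exact absurd h (hc _)

theorem proposed_of_mem {b : PathExpr D} {z : List D} (h : (b, [], d, z) ∈ rules.sets)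
    (hf : rules.Fires G b u) : rules.Proposed t G u d (G.follow u z) :=
  .inl ⟨b, [], z, h, u, hf, rfl, rfl⟩

theorem proposed_ch {b : Bool} : rules.Proposed t G u (ch b) y ↔
    rules.Fires G (sprout b) u ∧ y = .fresh (t + 1) (line b) u := by
  constructor
  · rintro (⟨g, x, z, h, -⟩ | ⟨i, g, h, hf, rfl⟩)
    · cases b <;> simp [rules, ch] at h
    · rcases i with _ | _ | i
      · simp only [rules, List.getElem?_cons_zero, Option.some.injEq, Prod.mk.injEq, ch_inj] at h
        obtain ⟨rfl, rfl⟩ := h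
        exact ⟨hf, rfl⟩
      · simp only [rules, zero_add, List.getElem?_cons_succ, List.getElem?_cons_zero,
          Option.some.injEq, Prod.mk.injEq, ch_inj] at h
        obtain ⟨rfl, rfl⟩ := h
        exact ⟨hf, rfl⟩
      · simp [rules] at h
  · rintro ⟨hf, rfl⟩
    cases b
    · exact .inr ⟨0, _, rfl, hf, rfl⟩
    · exact .inr ⟨1, _, rfl, hf, rfl⟩

theorem born_iff : rules.Born t G u ↔
    ∃ b c, rules.Fires G (sprout b) c ∧ u = .fresh (t + 1) (line b) c := by
  constructor
  · rintro ⟨i, g, d, c, h, hf, rfl⟩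
    rcases i with _ | _ | i
    · simp only [rules, List.getElem?_cons_zero, Option.some.injEq, Prod.mk.injEq] at h
      obtain ⟨rfl, rfl⟩ := h
      exact ⟨false, c, hf, rfl⟩
    · simp only [rules, zero_add, List.getElem?_cons_succ, List.getElem?_cons_zero,
        Option.some.injEq, Prod.mk.injEq] at h
      obtain ⟨rfl, rfl⟩ := h
      exact ⟨true, c, hf, rfl⟩
    · simp [rules] at h
  · rintro ⟨b, c, hf, rfl⟩
    cases b
    · exact ⟨0, _, _, c, rfl, hf, rfl⟩
    · exact ⟨1, _, _, c, rfl, hf, rfl⟩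

theorem proposed_fst : rules.Proposed t G u fst y ↔
    ∃ c, rules.Fires G (.and (letter [.all, .ex]) (.eq [.w] [.o])) c ∧ G.edge c .o = u ∧
      y = c := by
  constructor
  · rintro (⟨b, x, z, h, c, hf, h1, h2⟩ | ⟨i, b, h, -⟩)
    · simp [rules] at h
      obtain ⟨rfl, rfl, rfl⟩ := h
      exact ⟨c, hf, h1, h2.symm⟩
    · have := List.mem_of_getElem? h
      simp [rules, ch] at this
  · rintro ⟨c, hf, h1, rfl⟩
    exact .inl ⟨_, [.o], [], by simp [rules], y, hf, h1, rfl⟩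

theorem proposed_lst (h : rules.Proposed t G u lst y) : u ∈ G.nodes ∧
    (((letter [.var, .tick]).Holds G u ∧ nextTick.Holds G u ∧ y = G.edge (G.edge u .e) lst) ∨
    ((letter [.var, .tick]).Holds G u ∧ ¬ nextTick.Holds G u ∧ y = u) ∨
    ((letter [.all, .ex, .not, .and, .or]).Holds G u ∧ y = G.edge (G.edge u rgt) lst)) := by
  obtain ⟨b, z, hm, hf, rfl⟩ := proposed_set h (by simp [ch]) (by simp)
  simp [rules] at hm
  refine ⟨hf.1, ?_⟩
  rcases hm with ⟨rfl, rfl⟩ | ⟨rfl, rfl⟩ | ⟨rfl, rfl⟩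
  · exact .inl ⟨hf.2.2.1, hf.2.2.2, rfl⟩
  · exact .inr (.inl ⟨hf.2.2.1, hf.2.2.2, rfl⟩)
  · exact .inr (.inr ⟨hf.2.2, rfl⟩)

theorem proposed_rgt (h : rules.Proposed t G u rgt y) : u ∈ G.nodes ∧
    (((letter [.all, .ex, .not]).Holds G u ∧ y = G.edge u .e) ∨
    ((letter [.and, .or]).Holds G u ∧ G.edge (G.edge u .e) lst ≠ G.edge u .o ∧
      y = G.edge (G.edge (G.edge u .e) lst) .e)) := by
  obtain ⟨b, z, hm, hf, rfl⟩ := proposed_set h (by simp [ch]) (by simp)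
  simp [rules] at hm
  refine ⟨hf.1, ?_⟩
  rcases hm with ⟨rfl, rfl⟩ | ⟨rfl, rfl⟩
  · exact .inl ⟨hf.2.2, rfl⟩
  · exact .inr ⟨hf.2.2.1, hf.2.2.2, rfl⟩

theorem proposed_qv (h : rules.Proposed t G u qv y) : u ∈ G.nodes ∧
    (((letter [.var]).Holds G u ∧ y = G.edge (G.edge u .o) fst) ∨
    ((letter [.tick]).Holds G u ∧ y = G.edge (G.edge (G.edge u .w) qv) .e)) := by
  obtain ⟨b, z, hm, hf, rfl⟩ := proposed_set h (by simp [ch]) (by simp)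
  simp [rules] at hm
  refine ⟨hf.1, ?_⟩
  rcases hm with ⟨rfl, rfl⟩ | ⟨rfl, rfl⟩
  · exact .inl ⟨hf.2.2, rfl⟩
  · exact .inr ⟨hf.2.2, rfl⟩

theorem proposed_cell (h : rules.Proposed t G u cell y) : u ∈ G.nodes ∧
    ((G.edge (G.edge u .o) ctr = u ∧ G.edge (G.edge u .o) fst ≠ G.edge u .o ∧
      y = G.edge (G.edge u .o) fst) ∨
    (G.edge u .o ≠ u ∧ G.edge (G.edge u up) (ch false) = u ∧
      y = G.edge (G.edge (G.edge u up) cell) .e) ∨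
    (G.edge u .o ≠ u ∧ G.edge (G.edge u up) (ch true) = u ∧
      y = G.edge (G.edge (G.edge u up) cell) rgt)) := by
  obtain ⟨b, z, hm, hf, rfl⟩ := proposed_set h (by simp [ch]) (by simp)
  simp [rules] at hm
  refine ⟨hf.1, ?_⟩
  rcases hm with ⟨rfl, rfl⟩ | ⟨rfl, rfl⟩ | ⟨rfl, rfl⟩
  · exact .inl ⟨hf.2.2.1, hf.2.2.2, rfl⟩
  · exact .inr (.inl ⟨hf.2.2.2, hf.2.2.1, rfl⟩)
  · exact .inr (.inr ⟨hf.2.2.2, hf.2.2.1, rfl⟩)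

theorem proposed_wk (h : rules.Proposed t G u wk y) : u ∈ G.nodes ∧
    varReady.Holds G u ∧ ¬ found0.Holds G u ∧ ¬ found.Holds G u ∧
      y = G.edge (G.edge u wk) up := by
  obtain ⟨b, z, hm, hf, rfl⟩ := proposed_set h (by simp [ch]) (by simp)
  simp [rules] at hm
  obtain ⟨rfl, rfl⟩ := hm
  exact ⟨hf.1, hf.2.2.1, hf.2.2.2.1, hf.2.2.2.2, rfl⟩

theorem proposed_v (h : rules.Proposed t G u .v y) : u ∈ G.nodes ∧
    ((valTrue.Holds G u ∧ y = G.edge u .o) ∨ (valFalse.Holds G u ∧ y = u)) := by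
  obtain ⟨b, z, hm, hf, rfl⟩ := proposed_set h (by simp [ch]) (by simp)
  simp [rules] at hm
  refine ⟨hf.1, ?_⟩
  rcases hm with ⟨rfl, rfl⟩ | ⟨rfl, rfl⟩
  · exact .inl ⟨hf.2.2, rfl⟩
  · exact .inr ⟨hf.2.2, rfl⟩

end

/-! ### Edges that are never changed -/

section Base

variable (x : List QSym)

/-- What is known about the edges that never change. -/
structure Base (G : PGraph D) : Prop where
  cases : ∀ u ∈ G.nodes, u = .origin ∨ (∃ i < x.length, u = .cell i) ∨ ∃ t l c, u = .fresh t l c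
  origin_mem : .origin ∈ G.nodes
  cell_mem : ∀ i < x.length, .cell i ∈ G.nodes
  root_mem : RuleSet.root x ∈ G.nodes
  o : ∀ u ∈ G.nodes, G.edge u .o = .origin
  cell_e : ∀ i < x.length, G.edge (.cell i) .e = if i + 1 < x.length then .cell (i + 1) else .origin
  cell_w : ∀ i < x.length, G.edge (.cell i) .w = if 0 < i then .cell (i - 1) else .origin
  cell_sym : ∀ i < x.length, ∀ s,
    G.edge (.cell i) (.sym s) = .cell i ↔ x[i]? = some s
  cell_up : ∀ i < x.length, G.edge (.cell i) up = .origin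
  origin_e : G.edge .origin .e = .origin
  origin_ctr : G.edge .origin ctr = RuleSet.root x
  fresh_sym : ∀ t l c, .fresh t l c ∈ G.nodes → ∀ s, G.edge (.fresh t l c) (.sym s) = c
  fresh_up : ∀ t l c, .fresh t l c ∈ G.nodes → G.edge (.fresh t l c) up = c
  /-- the origin absorbs all paths -/
  origin_edge : ∀ d, d ≠ ctr → d ≠ fst → G.edge .origin d = .origin
  cell_cell : ∀ i < x.length, G.edge (.cell i) cell = .origin

variable {x} {G : PGraph D}

theorem letter_holds (hB : Base x G) {l : List QSym} {u : Node} (hu : u ∈ G.nodes) :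
    (letter l).Holds G u ↔ u ≠ .origin ∧ ∃ s ∈ l, G.edge u (.sym s) = u := by
  simp only [letter, PathExpr.Holds, anyOf_holds, PGraph.follow, List.foldl, hB.o u hu,
    List.mem_map, exists_exists_and_eq_and]
  rw [and_comm, eq_comm]

theorem letter_cell (hB : Base x G) {l : List QSym} {i : ℕ} (hi : i < x.length) :
    (letter l).Holds G (.cell i) ↔ ∃ s ∈ l, x[i]? = some s := by
  rw [letter_holds hB (hB.cell_mem i hi)]
  simp [hB.cell_sym i hi]

/-- The letter directions of a created node lead to its creator, whose name is a proper part of its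
own; so the node never looks like a cell with a letter. -/
theorem not_letter_fresh (hB : Base x G) {l : List QSym} {t k : ℕ} {c : Node}
    (hu : .fresh t k c ∈ G.nodes) : ¬ (letter l).Holds G (.fresh t k c) := by
  rw [letter_holds hB hu]
  rintro ⟨-, s, -, h⟩
  rw [hB.fresh_sym _ _ _ hu] at h
  have := congrArg sizeOf h
  simp at this

theorem at_holds (hB : Base x G) {l : List QSym} {u : Node} (hu : u ∈ G.nodes) :
    (at' l).Holds G u ↔ G.edge u cell ≠ .origin ∧
      ∃ s ∈ l, G.edge (G.edge u cell) (.sym s) = G.edge u cell := by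
  simp only [at', PathExpr.Holds, anyOf_holds, PGraph.follow, List.foldl, hB.o u hu,
    List.mem_map, exists_exists_and_eq_and]
  rw [and_comm]

theorem at_cell (hB : Base x G) {l : List QSym} {u : Node} (hu : u ∈ G.nodes) {p : ℕ}
    (hp : p < x.length) (h : G.edge u cell = .cell p) :
    (at' l).Holds G u ↔ ∃ s ∈ l, x[p]? = some s := by
  rw [at_holds hB hu, h]
  simp [hB.cell_sym p hp]

theorem not_at_fresh (hB : Base x G) {l : List QSym} {u : Node} (hu : u ∈ G.nodes)
    {t k : ℕ} {c : Node} (hc : .fresh t k c ∈ G.nodes) (h : G.edge u cell = .fresh t k c) :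
    ¬ (at' l).Holds G u := by
  rw [at_holds hB hu, h]
  rintro ⟨-, s, -, h⟩
  rw [hB.fresh_sym _ _ _ hc] at h
  have := congrArg sizeOf h
  simp at this

theorem not_at_origin (hB : Base x G) {l : List QSym} {u : Node} (hu : u ∈ G.nodes)
    (h : G.edge u cell = .origin) : ¬ (at' l).Holds G u := by
  rw [at_holds hB hu]; exact fun h' => h'.1 h

theorem unwritten_e : rules.Unwritten .e := by
  constructor <;> simp [rules, ch]
theorem unwritten_w : rules.Unwritten .w := by
  constructor <;> simp [rules, ch]
theorem unwritten_sym (s) : rules.Unwritten (.sym s) := by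
  constructor <;> simp [rules, ch]
theorem unwritten_up : rules.Unwritten up := by
  constructor <;> simp [rules, ch]
theorem unwritten_ctr : rules.Unwritten ctr := by
  constructor <;> simp [rules, ch]

/-- No rule for the evaluation tree applies where `cell` points to the origin. -/
theorem not_proposed_tree (hB : Base x G) {t : ℕ} {u y : Node} (hu : u ∈ G.nodes)
    (h : G.edge u cell = .origin) {d : D} (hd : d = wk ∨ d = .v ∨ ∃ b, d = ch b) :
    ¬ rules.Proposed t G u d y := by
  have hat : ∀ l, ¬ (at' l).Holds G u := fun l => not_at_origin hB hu h
  rintro hp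
  rcases hd with rfl | rfl | ⟨b, rfl⟩
  · exact hat _ (proposed_wk hp).2.1.1
  · rcases (proposed_v hp).2 with ⟨h, -⟩ | ⟨h, -⟩
    all_goals
      simp only [valTrue, valFalse, anyOf_holds, List.mem_cons, List.not_mem_nil, or_false] at h
      obtain ⟨b, rfl | rfl | rfl | rfl, hb⟩ := h
      · exact hat _ hb.1
      · exact hat _ hb.1
      · exact hat _ hb.1
      · exact hat _ hb.1.1
  · exact hat _ (proposed_ch.1 hp).1.2.2.1

/-- The origin must remain a sink: a path through an undefined edge of a cell then ends at the
origin and is undefined as well. -/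
theorem not_proposed_origin (hB : Base x G) (ho : .origin ∈ G.nodes) {t : ℕ} {y : Node} {d : D}
    (hd : d ≠ fst) : ¬ rules.Proposed t G .origin d y := by
  have hl : ∀ l, ¬ (letter l).Holds G .origin := fun l h => ((letter_holds hB ho).1 h).1 rfl
  have hc : G.edge .origin cell = .origin := hB.origin_edge _ (by simp) (by simp)
  have hch : ∀ b, ¬ rules.Proposed t G .origin (ch b) y := fun b =>
    not_proposed_tree hB ho hc (.inr (.inr ⟨b, rfl⟩))
  intro h
  cases d with
  | o => exact rules.unwritten_o.not_proposed h
  | e => exact unwritten_e.not_proposed h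
  | w => exact unwritten_w.not_proposed h
  | sym s => exact (unwritten_sym s).not_proposed h
  | v => exact not_proposed_tree hB ho hc (.inr (.inl rfl)) h
  | aux i =>
    fin_cases i
    · exact unwritten_up.not_proposed h
    · rcases (proposed_cell h).2 with ⟨h1, -⟩ | ⟨h1, -⟩ | ⟨h1, -⟩
      · rw [hB.o _ ho, hB.origin_ctr] at h1; simp [RuleSet.root] at h1
      · exact h1 (hB.o _ ho)
      · exact h1 (hB.o _ ho)
    · exact hch false h
    · exact hch true h
    · rcases (proposed_rgt h).2 with h1 | h1
      · exact hl _ h1.1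
      · exact hl _ h1.1
    · rcases (proposed_lst h).2 with h1 | h1 | h1
      · exact hl _ h1.1
      · exact hl _ h1.1
      · exact hl _ h1.1
    · rcases (proposed_qv h).2 with h1 | h1
      · exact hl _ h1.1
      · exact hl _ h1.1
    · exact not_proposed_tree hB ho hc (.inl rfl) h
    · exact unwritten_ctr.not_proposed h
    · exact hd rfl

theorem not_proposed_cell_cell (hB : Base x G) {t : ℕ} {y : Node} {i : ℕ} (hi : i < x.length) :
    ¬ rules.Proposed t G (.cell i) cell y := by
  intro h
  have hch : ∀ b, G.edge .origin (ch b) = .origin := fun b =>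
    hB.origin_edge _ (by cases b <;> simp [ch]) (by cases b <;> simp [ch])
  rcases (proposed_cell h).2 with ⟨h1, -⟩ | ⟨-, h1, -⟩ | ⟨-, h1, -⟩
  · rw [hB.o _ (hB.cell_mem i hi), hB.origin_ctr] at h1; simp [RuleSet.root] at h1
  · rw [hB.cell_up i hi, hch] at h1; simp at h1
  · rw [hB.cell_up i hi, hch] at h1; simp at h1

variable (ρ : Resolution (Dir QSym 10))

theorem start_cell (i : ℕ) (d : D) :
    (rules.startGraph x).edge (.cell i) d = (MWSMM.inputGraph 10 x).edge (.cell i) d := by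
  simp [RuleSet.startGraph, RuleSet.root]

theorem start_origin {d : D} (hd : d ≠ ctr) :
    (rules.startGraph x).edge .origin d = .origin := by
  simp [RuleSet.startGraph, RuleSet.root, RuleSet.inputGraph_origin, rules, hd]

/-- The two hypotheses are the only clauses about directions that rules write somewhere. All others
concern unwritten directions or the set of nodes, so only these two need an induction over rounds.
-/
theorem base_of_edges (r : ℕ)
    (h1 : ∀ d, d ≠ ctr → d ≠ fst → (rules.graphAt ρ x r).edge .origin d = .origin)
    (h2 : ∀ i < x.length, (rules.graphAt ρ x r).edge (.cell i) cell = .origin) :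
    Base x (rules.graphAt ρ x r) := by
  have hcs : ∀ i < x.length, Node.cell i ∈ (rules.startGraph x).nodes :=
    fun i hi => .inl (.inr ⟨i, hi, rfl⟩)
  have hos : Node.origin ∈ (rules.startGraph x).nodes := .inl (.inl rfl)
  have hcell : ∀ d, rules.Unwritten d → ∀ i < x.length,
      (rules.graphAt ρ x r).edge (.cell i) d = (MWSMM.inputGraph 10 x).edge (.cell i) d := by
    intro d hd i hi
    rw [rules.unwritten_start ρ hd x r (hcs i hi), start_cell]
  have horg : ∀ d, rules.Unwritten d → d ≠ ctr →
      (rules.graphAt ρ x r).edge .origin d = .origin := by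
    intro d hd h
    rw [rules.unwritten_start ρ hd x r hos, start_origin h]
  have hmem : ∀ i < x.length, Node.cell i ∈ (rules.graphAt ρ x r).nodes :=
    fun i hi => rules.mem_start ρ x r (hcs i hi)
  refine
    { cases := fun u hu => ?_
      origin_mem := rules.mem_start ρ x r hos
      cell_mem := hmem
      root_mem := rules.mem_start ρ x r (.inr rfl)
      o := fun u hu => rules.edge_o ρ x r hu
      cell_e := fun i hi => by rw [hcell _ unwritten_e i hi]; rfl
      cell_w := fun i hi => by rw [hcell _ unwritten_w i hi]; rfl
      cell_sym := fun i hi s => by rw [hcell _ (unwritten_sym s) i hi]; simp [MWSMM.inputGraph]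
      cell_up := fun i hi => by rw [hcell _ unwritten_up i hi]; rfl
      origin_e := horg _ unwritten_e (by simp)
      origin_ctr := ?_
      fresh_sym := fun t l c h s =>
        rules.unwritten_fresh ρ (unwritten_sym s) (by simp) (by simp [rules]) x r h
      fresh_up := fun t l c h =>
        rules.unwritten_fresh ρ unwritten_up (by simp) (by simp [rules]) x r h
      origin_edge := h1
      cell_cell := h2 }
  · rcases rules.node_cases ρ x r hu with h | h | h | ⟨s, -, i, b, d, c, -, -, h⟩
    · exact .inl h
    · exact .inr (.inl h)
    · exact .inr (.inr ⟨_, _, _, h⟩)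
    · exact .inr (.inr ⟨_, _, _, h⟩)
  rw [rules.unwritten_start ρ unwritten_ctr x r hos]
  simp [RuleSet.startGraph, RuleSet.root, rules]

theorem base_graphAt (r : ℕ) : Base x (rules.graphAt ρ x r) := by
  induction r with
  | zero =>
    refine base_of_edges ρ 0 (fun d h1 _ => ?_) fun i hi => ?_
    · rw [rules.graphAt_zero, start_origin h1]
    · rw [rules.graphAt_zero, start_cell]; rfl
  | succ r ih =>
    have hR := rules.round_graphAt ρ x r
    have ho : Node.origin ∈ (rules.graphAt ρ x r).nodes := rules.mem_start ρ x r (.inl (.inl rfl))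
    refine base_of_edges ρ (r + 1) (fun d h1 h2 => ?_) fun i hi => ?_
    · rw [RuleSet.step_keep hR ho fun y => not_proposed_origin ih ho h2, ih.origin_edge d h1 h2]
    · rw [RuleSet.step_keep hR (ih.cell_mem i hi) fun y => not_proposed_cell_cell ih hi,
        ih.cell_cell i hi]

end Base


open QF

/-! ### Parsing: the pointers computed by cells -/

section Cells

variable {x : List QSym} {G G' : PGraph D} {t : ℕ} {p : ℕ}

/-- The result is not yet known. -/
def Live (x : List QSym) (G : PGraph D) : Prop :=
  G.edge (RuleSet.root x) .v = G.edge (RuleSet.root x) up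

theorem live_holds (hB : Base x G) {u : Node} (hu : u ∈ G.nodes) :
    rules.live.Holds G u ↔ Live x G := by
  simp [rules, PathExpr.Holds, PGraph.follow, hB.o u hu, hB.origin_ctr, Live]

/-- The only value proposed for an edge is `y`, and it is proposed while the machine runs. -/
def Settles (x : List QSym) (t : ℕ) (G : PGraph D) (u : Node) (d : D) (y : Node) : Prop :=
  (∀ y', rules.Proposed t G u d y' → y' = y) ∧ (Live x G → ∃ y', rules.Proposed t G u d y')

theorem Settles.or {u : Node} {d : D} {y : Node} (h : Settles x t G u d y)
    (hR : rules.Round t G G') (hu : u ∈ G.nodes) : G'.edge u d = G.edge u d ∨ G'.edge u d = y := by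
  rcases RuleSet.step_cases hR hu d with h' | h'
  · exact .inr (h.1 _ h')
  · exact .inl h'

theorem Settles.eq {u : Node} {d : D} {y : Node} (h : Settles x t G u d y)
    (hR : rules.Round t G G') (hu : u ∈ G.nodes) (hl : Live x G) : G'.edge u d = y :=
  RuleSet.step_eq hR hu (h.2 hl) h.1

theorem exists_proposed (hB : Base x G) {u : Node} (hu : u ∈ G.nodes) {b : PathExpr D} {d : D}
    {z : List D} (h : (b, [], d, z) ∈ rules.sets) (hb : b.Holds G u) (hl : Live x G) :
    ∃ y, rules.Proposed t G u d y :=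
  ⟨_, proposed_of_mem h ⟨hu, (live_holds hB hu).2 hl, hb⟩⟩

theorem nextTick_cell (hB : Base x G) {i : ℕ} (hi : i < x.length) :
    nextTick.Holds G (.cell i) ↔ x[i + 1]? = some .tick := by
  simp only [nextTick, PathExpr.Holds, PGraph.follow, List.foldl, hB.cell_e i hi,
    hB.o _ (hB.cell_mem i hi)]
  by_cases h : i + 1 < x.length
  · rw [if_pos h, hB.cell_sym _ h]; simp
  · rw [if_neg h, List.getElem?_eq_none (by omega)]; simp

theorem settles_lst_mid (hB : Base x G) {i j : ℕ} (hs : Seg x p (.var i)) (hj : j < i) :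
    Settles x t G (.cell (p + j)) lst (G.edge (.cell (p + (j + 1))) lst) := by
  have hle := hs.le
  simp only [encode, List.length_cons, List.length_replicate] at hle
  have hlt : p + j < x.length := by omega
  have hnt : nextTick.Holds G (.cell (p + j)) := by
    rw [nextTick_cell hB hlt]; exact hs.get_tick (j := j + 1) (by omega) (by omega)
  have hx : x[p + j]? = some .var ∨ x[p + j]? = some .tick := by
    rcases Nat.eq_zero_or_pos j with rfl | h
    · exact .inl hs.get_var
    · exact .inr (hs.get_tick h (by omega))
  have he : G.edge (.cell (p + j)) .e = .cell (p + (j + 1)) := by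
    rw [hB.cell_e _ hlt, if_pos (by omega)]; rfl
  constructor
  · intro y hy
    rcases (proposed_lst hy).2 with ⟨-, -, h⟩ | ⟨-, h, -⟩ | ⟨h, -⟩
    · rw [h, he]
    · exact absurd hnt h
    · rw [letter_cell hB hlt] at h
      rcases hx with hx | hx <;> simp [hx] at h
  · refine exists_proposed hB (hB.cell_mem _ hlt)
      (b := .and (letter [.var, .tick]) nextTick) (z := [.e, lst]) (by simp [rules]) ⟨?_, hnt⟩
    rw [letter_cell hB hlt]
    rcases hx with hx | hx <;> simp [hx]

theorem settles_lst_end (hB : Base x G) {i : ℕ} (hs : Seg x p (.var i)) :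
    Settles x t G (.cell (p + i)) lst (.cell (p + i)) := by
  have hle := hs.le
  simp only [encode, List.length_cons, List.length_replicate] at hle
  have hlt : p + i < x.length := by omega
  have hnt : ¬ nextTick.Holds G (.cell (p + i)) := by
    rw [nextTick_cell hB hlt]; exact hs.get_after
  have hx : x[p + i]? = some .var ∨ x[p + i]? = some .tick := by
    rcases Nat.eq_zero_or_pos i with rfl | h
    · exact .inl hs.get_var
    · exact .inr (hs.get_tick h (by omega))
  constructor
  · intro y hy
    rcases (proposed_lst hy).2 with ⟨-, h, -⟩ | ⟨-, -, h⟩ | ⟨h, -⟩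
    · exact absurd h hnt
    · exact h
    · rw [letter_cell hB hlt] at h
      rcases hx with hx | hx <;> simp [hx] at h
  · refine exists_proposed hB (hB.cell_mem _ hlt)
      (b := .and (letter [.var, .tick]) (.not nextTick)) (z := []) (by simp [rules]) ⟨?_, hnt⟩
    rw [letter_cell hB hlt]
    rcases hx with hx | hx <;> simp [hx]

theorem settles_lst_node (hB : Base x G) {s : QSym} (hx : x[p]? = some s)
    (hs : s.isUn = true ∨ s.isBin = true) :
    Settles x t G (.cell p) lst (G.edge (G.edge (.cell p) rgt) lst) := by
  have hlt : p < x.length := (List.getElem?_eq_some_iff.1 hx).1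
  constructor
  · intro y hy
    rcases (proposed_lst hy).2 with ⟨h, -⟩ | ⟨h, -⟩ | ⟨-, h⟩
    · rw [letter_cell hB hlt] at h
      cases s <;> simp_all [QSym.isUn, QSym.isBin]
    · rw [letter_cell hB hlt] at h
      cases s <;> simp_all [QSym.isUn, QSym.isBin]
    · exact h
  · refine exists_proposed hB (hB.cell_mem _ hlt)
      (b := letter [.all, .ex, .not, .and, .or]) (z := [rgt, lst]) (by simp [rules]) ?_
    rw [letter_cell hB hlt]
    cases s <;> simp_all [QSym.isUn, QSym.isBin]

theorem settles_rgt_un (hB : Base x G) {s : QSym} {hs} {f : QF} (hx : Seg x p (.un s hs f)) :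
    Settles x t G (.cell p) rgt (.cell (p + 1)) := by
  have hg := hx.get_un
  have h1 := hx.un.lt
  have hlt := hx.lt
  constructor
  · intro y hy
    rcases (proposed_rgt hy).2 with ⟨-, h⟩ | ⟨h, -⟩
    · rw [h, hB.cell_e _ hlt, if_pos h1]
    · rw [letter_cell hB hlt] at h
      rcases QSym.isUn_cases hs with rfl | rfl | rfl <;> simp [hg] at h
  · refine exists_proposed hB (hB.cell_mem _ hlt)
      (b := letter [.all, .ex, .not]) (z := [.e]) (by simp [rules]) ?_
    rw [letter_cell hB hlt]
    rcases QSym.isUn_cases hs with rfl | rfl | rfl <;> simp [hg]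

theorem settles_qv_var (hB : Base x G) {i : ℕ} (hs : Seg x p (.var i)) :
    Settles x t G (.cell p) qv (G.edge .origin fst) := by
  have hg := hs.get_var
  have hlt := hs.lt
  constructor
  · intro y hy
    rcases (proposed_qv hy).2 with ⟨-, h⟩ | ⟨h, -⟩
    · rw [h, hB.o _ (hB.cell_mem _ hlt)]
    · rw [letter_cell hB hlt] at h
      simp [hg] at h
  · refine exists_proposed hB (hB.cell_mem _ hlt)
      (b := letter [.var]) (z := [.o, fst]) (by simp [rules]) ?_
    rw [letter_cell hB hlt]
    simp [hg]

theorem settles_qv_tick (hB : Base x G) {i j : ℕ} (hs : Seg x p (.var i)) (hj : j < i) :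
    Settles x t G (.cell (p + (j + 1))) qv (G.edge (G.edge (.cell (p + j)) qv) .e) := by
  have hg := hs.get_tick (j := j + 1) (by omega) (by omega)
  have hle := hs.le
  simp only [encode, List.length_cons, List.length_replicate] at hle
  have hlt : p + (j + 1) < x.length := by omega
  constructor
  · intro y hy
    rcases (proposed_qv hy).2 with ⟨h, -⟩ | ⟨-, h⟩
    · rw [letter_cell hB hlt] at h
      simp [hg] at h
    · rw [h, hB.cell_w _ hlt, if_pos (by omega)]; rfl
  · refine exists_proposed hB (hB.cell_mem _ hlt)
      (b := letter [.tick]) (z := [.w, qv, .e]) (by simp [rules]) ?_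
    rw [letter_cell hB hlt]
    simp [hg]

/-- All quantifiers could write this edge of the origin, but only one cell has no western neighbour,
so there is no conflict. -/
theorem settles_fst (hB : Base x G) (h0 : x[0]? = some .all ∨ x[0]? = some .ex) :
    Settles x t G .origin fst (.cell 0) := by
  have hlt : 0 < x.length := by
    rcases h0 with h | h <;> exact (List.getElem?_eq_some_iff.1 h).1
  constructor
  · intro y hy
    obtain ⟨c, ⟨hc, -, h1, h2⟩, -, rfl⟩ := proposed_fst.1 hy
    rcases hB.cases _ hc with rfl | ⟨i, hi, rfl⟩ | ⟨t', l, c, rfl⟩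
    · exact absurd rfl ((letter_holds hB hc).1 h1).1
    · simp only [PathExpr.Holds, PGraph.follow, List.foldl, hB.cell_w i hi, hB.o _ hc] at h2
      by_cases h : 0 < i
      · simp [h] at h2
      · rw [show i = 0 by omega]
    · exact absurd h1 (not_letter_fresh hB hc)
  · intro hl
    have hc := hB.cell_mem 0 hlt
    refine ⟨_, proposed_fst.2 ⟨.cell 0, ⟨hc, (live_holds hB hc).2 hl, ?_, ?_⟩, hB.o _ hc, rfl⟩⟩
    · rw [letter_cell hB hlt]
      rcases h0 with h | h <;> simp [h]
    · simp [PathExpr.Holds, PGraph.follow, hB.cell_w 0 hlt, hB.o _ hc]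

/-- Computed edges of cells are correct once they do not point to the origin. -/
structure CellInv (x : List QSym) (G : PGraph D) : Prop where
  first : G.edge .origin fst = .origin ∨ G.edge .origin fst = .cell 0
  last : ∀ p f, Seg x p f → G.edge (.cell p) lst = .origin ∨
    G.edge (.cell p) lst = .cell (p + f.encode.length - 1)
  last_tick : ∀ p i, Seg x p (.var i) → ∀ j ≤ i, G.edge (.cell (p + j)) lst = .origin ∨
    G.edge (.cell (p + j)) lst = .cell (p + i)
  quant : ∀ p i, Seg x p (.var i) → ∀ j ≤ i, G.edge (.cell (p + j)) qv = .origin ∨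
    G.edge (.cell (p + j)) qv = .cell j
  rgt_un : ∀ p s hs f, Seg x p (.un s hs f) → G.edge (.cell p) rgt = .origin ∨
    G.edge (.cell p) rgt = .cell (p + 1)
  rgt_bin : ∀ p s hs f g, Seg x p (.bin s hs f g) → G.edge (.cell p) rgt = .origin ∨
    G.edge (.cell p) rgt = .cell (p + 1 + f.encode.length)

/-- The guard demands that `lst` of the next cell is defined. It is then the end of the first
argument, and the second argument starts one cell further east. -/
theorem CellInv.of_proposed_rgt (hB : Base x G) (h : CellInv x G) {s : QSym} {hs} {f g : QF}
    (hx : Seg x p (.bin s hs f g)) {y : Node} (hy : rules.Proposed t G (.cell p) rgt y) :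
    y = .cell (p + 1 + f.encode.length) := by
  have hg := hx.get_bin
  have h1 := hx.bin_left.lt
  have h2 := hx.bin_right.lt
  have h3 := f.encode_pos
  have hlt := hx.lt
  have he : G.edge (.cell p) .e = .cell (p + 1) := by rw [hB.cell_e _ hlt, if_pos h1]
  rcases (proposed_rgt hy).2 with ⟨h, -⟩ | ⟨-, h4, h5⟩
  · rw [letter_cell hB hlt] at h
    rcases QSym.isBin_cases hs with rfl | rfl <;> simp [hg] at h
  · rw [he] at h4 h5
    rw [hB.o _ (hB.cell_mem _ hlt)] at h4
    rcases h.last _ _ hx.bin_left with h6 | h6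
    · exact absurd h6 h4
    · rw [h5, h6, hB.cell_e _ (by omega), if_pos (by omega), Node.cell.injEq]; omega

theorem settles_rgt_bin (hB : Base x G) (h : CellInv x G) {s : QSym} {hs} {f g : QF}
    (hx : Seg x p (.bin s hs f g)) (hl : G.edge (.cell (p + 1)) lst ≠ .origin) :
    Settles x t G (.cell p) rgt (.cell (p + 1 + f.encode.length)) := by
  have hg := hx.get_bin
  have hlt := hx.lt
  refine ⟨fun y hy => h.of_proposed_rgt hB hx hy, ?_⟩
  refine exists_proposed hB (hB.cell_mem _ hlt)
    (b := .and (letter [.and, .or]) (.not (.eq [.e, lst] [.o]))) (z := [.e, lst, .e])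
    (by simp [rules]) ⟨?_, ?_⟩
  · rw [letter_cell hB hlt]
    rcases QSym.isBin_cases hs with rfl | rfl <;> simp [hg]
  · simp only [PathExpr.Holds, PGraph.follow, List.foldl, hB.o _ (hB.cell_mem _ hlt)]
    rwa [hB.cell_e _ hlt, if_pos hx.bin_left.lt]

/-- A redirection whose operands are still undefined runs into the origin and is absorbed there. So
a rule that is applied too early yields an undefined edge and never a wrong cell. -/
theorem CellInv.step (hB : Base x G) (h0 : x[0]? = some .all ∨ x[0]? = some .ex)
    (h : CellInv x G) (hR : rules.Round t G G') : CellInv x G' := by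
  have horg : ∀ d, d ≠ ctr → d ≠ fst → G.edge .origin d = .origin := hB.origin_edge
  have htick : ∀ p i, Seg x p (.var i) → ∀ j ≤ i,
      G'.edge (.cell (p + j)) lst = .origin ∨
        G'.edge (.cell (p + j)) lst = .cell (p + i) := by
    intro p i hs j hj
    have hle := hs.le
    simp only [encode, List.length_cons, List.length_replicate] at hle
    have hm := hB.cell_mem (p + j) (by omega)
    rcases hj.lt_or_eq with hj | rfl
    · rcases (settles_lst_mid hB hs hj).or hR hm with h' | h'
      · rw [h']; exact h.last_tick p i hs j (by omega)
      · rw [h']; exact h.last_tick p i hs (j + 1) (by omega)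
    · rcases (settles_lst_end hB hs).or hR hm with h' | h'
      · rw [h']; exact h.last_tick p _ hs _ le_rfl
      · exact .inr h'
  refine ⟨?_, ?_, htick, ?_, ?_, ?_⟩
  · rcases (settles_fst hB h0).or hR hB.origin_mem with h' | h'
    · rw [h']; exact h.first
    · exact .inr h'
  · intro p f hs
    have hm := hB.cell_mem p hs.lt
    cases f with
    | var i =>
      rcases htick p i hs 0 (by omega) with h' | h'
      · exact .inl h'
      · exact .inr (by simpa [encode] using h')
    | un s hu f =>
      rcases (settles_lst_node hB hs.get_un (.inl hu)).or hR hm with h' | h'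
      · rw [h']; exact h.last p _ hs
      · rw [h']
        rcases h.rgt_un p s hu f hs with h2 | h2
        · rw [h2]; exact .inl (horg _ (by simp) (by simp))
        · rw [h2]
          rcases h.last _ _ hs.un with h3 | h3
          · exact .inl h3
          · refine .inr (h3.trans ?_)
            simp only [encode, List.length_cons, Node.cell.injEq]; omega
    | bin s hb f g =>
      rcases (settles_lst_node hB hs.get_bin (.inr hb)).or hR hm with h' | h'
      · rw [h']; exact h.last p _ hs
      · rw [h']
        rcases h.rgt_bin p s hb f g hs with h2 | h2
        · rw [h2]; exact .inl (horg _ (by simp) (by simp))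
        · rw [h2]
          rcases h.last _ _ hs.bin_right with h3 | h3
          · exact .inl h3
          · refine .inr (h3.trans ?_)
            simp only [encode, List.length_cons, List.length_append, Node.cell.injEq]; omega
  · intro p i hs j hj
    have hle := hs.le
    simp only [encode, List.length_cons, List.length_replicate] at hle
    have hm := hB.cell_mem (p + j) (by omega)
    rcases j with _ | j
    · rcases (settles_qv_var hB hs).or hR hm with h' | h'
      · rw [add_zero, h']; exact h.quant p i hs 0 hj
      · rw [add_zero, h']; exact h.first
    · rcases (settles_qv_tick hB hs (j := j) (by omega)).or hR hm with h' | h'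
      · rw [h']; exact h.quant p i hs _ hj
      · rw [h']
        rcases h.quant p i hs j (by omega) with h2 | h2
        · rw [h2]; exact .inl hB.origin_e
        · rw [h2, hB.cell_e _ (by omega), if_pos (by omega)]; exact .inr rfl
  · intro p s hu f hs
    rcases (settles_rgt_un hB hs).or hR (hB.cell_mem p hs.lt) with h' | h'
    · rw [h']; exact h.rgt_un p s hu f hs
    · exact .inr h'
  · intro p s hb f g hs
    rcases RuleSet.step_cases hR (hB.cell_mem p hs.lt) rgt with h' | h'
    · exact .inr (h.of_proposed_rgt hB hs h')
    · rw [h']; exact h.rgt_bin p s hb f g hs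

variable (ρ : Resolution (Dir QSym 10))

theorem cellInv_graphAt (h0 : x[0]? = some .all ∨ x[0]? = some .ex) (r : ℕ) :
    CellInv x (rules.graphAt ρ x r) := by
  induction r with
  | zero =>
    rw [rules.graphAt_zero]
    have hc : ∀ i k, (rules.startGraph x).edge (.cell i) (.aux k) = .origin := by
      intro i k; rw [start_cell]; rfl
    exact ⟨.inl (start_origin (by simp)), fun p f _ => .inl (hc _ _), fun p i _ j _ => .inl (hc _ _),
      fun p i _ j _ => .inl (hc _ _), fun p s hs f _ => .inl (hc _ _),
      fun p s hs f g _ => .inl (hc _ _)⟩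
  | succ r ih => exact ih.step (base_graphAt ρ r) h0 (rules.round_graphAt ρ x r)

/-- While the machine runs, an edge has the value that was proposed in the last round. -/
theorem edge_of_settles {T : ℕ} (hT : ∀ r < T, Live x (rules.graphAt ρ x r)) {r : ℕ} (hr : r < T) {u : Node} (hu : u ∈ (rules.graphAt ρ x r).nodes)
    {d : D} {y : Node} (h : Settles x (5 + 5 * r) (rules.graphAt ρ x r) u d y) :
    (rules.graphAt ρ x (r + 1)).edge u d = y :=
  h.eq (rules.round_graphAt ρ x r) hu (hT r hr)

variable {ρ} {T : ℕ}

theorem fst_done (hT : ∀ r < T, Live x (rules.graphAt ρ x r))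
    (h0 : x[0]? = some .all ∨ x[0]? = some .ex) {r : ℕ} (hr : r + 1 ≤ T) :
    (rules.graphAt ρ x (r + 1)).edge .origin fst = .cell 0 :=
  edge_of_settles ρ hT hr (base_graphAt ρ r).origin_mem (settles_fst (base_graphAt ρ r) h0)

/-- One round for `fst`, one for the cell with `var`, and then one for each tick, moving east in the
variable and in the prefix simultaneously. -/
theorem qv_done (hT : ∀ r < T, Live x (rules.graphAt ρ x r))
    (h0 : x[0]? = some .all ∨ x[0]? = some .ex) {i : ℕ} (hs : Seg x p (.var i)) {j : ℕ}
    (hj : j ≤ i) {r : ℕ} (hjr : j + 2 ≤ r) (hr : r ≤ T) :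
    (rules.graphAt ρ x r).edge (.cell (p + j)) qv = .cell j := by
  have hle := hs.le
  simp only [encode, List.length_cons, List.length_replicate] at hle
  induction j generalizing r with
  | zero =>
    obtain ⟨r, rfl⟩ : ∃ k, r = k + 2 := ⟨r - 2, by omega⟩
    have hB := base_graphAt (x := x) ρ (r + 1)
    rw [add_zero, edge_of_settles ρ hT (by omega) (hB.cell_mem p hs.lt) (settles_qv_var hB hs),
      fst_done hT h0 (by omega)]
  | succ j ih =>
    obtain ⟨r, rfl⟩ : ∃ k, r = k + 1 := ⟨r - 1, by omega⟩
    have hB := base_graphAt (x := x) ρ r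
    rw [edge_of_settles ρ hT (by omega) (hB.cell_mem (p + (j + 1)) (by omega))
      (settles_qv_tick hB hs (by omega)), ih (by omega) (by omega) (by omega),
      hB.cell_e _ (by omega), if_pos (by omega)]

/-- The end of a variable is noticed at its last cell and is passed on to the west by one cell per
round. -/
theorem lst_tick_done (hT : ∀ r < T, Live x (rules.graphAt ρ x r)) {i : ℕ}
    (hs : Seg x p (.var i)) {j k : ℕ} (hj : j + k = i) {r : ℕ} (hjr : k + 1 ≤ r) (hr : r ≤ T) :
    (rules.graphAt ρ x r).edge (.cell (p + j)) lst = .cell (p + i) := by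
  have hle := hs.le
  simp only [encode, List.length_cons, List.length_replicate] at hle
  induction k generalizing r j with
  | zero =>
    obtain rfl : j = i := by omega
    obtain ⟨r, rfl⟩ : ∃ k, r = k + 1 := ⟨r - 1, by omega⟩
    have hB := base_graphAt (x := x) ρ r
    exact edge_of_settles ρ hT (by omega) (hB.cell_mem _ (by omega)) (settles_lst_end hB hs)
  | succ k ih =>
    obtain ⟨r, rfl⟩ : ∃ k, r = k + 1 := ⟨r - 1, by omega⟩
    have hB := base_graphAt (x := x) ρ r
    rw [edge_of_settles ρ hT (by omega) (hB.cell_mem _ (by omega))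
      (settles_lst_mid hB hs (j := j) (by omega))]
    exact ih (by omega) (by omega) (by omega)

theorem rgt_un_done (hT : ∀ r < T, Live x (rules.graphAt ρ x r)) {s hu} {f : QF}
    (hs : Seg x p (.un s hu f)) {r : ℕ} (hjr : 1 ≤ r) (hr : r ≤ T) :
    (rules.graphAt ρ x r).edge (.cell p) rgt = .cell (p + 1) := by
  obtain ⟨r, rfl⟩ : ∃ k, r = k + 1 := ⟨r - 1, by omega⟩
  have hB := base_graphAt (x := x) ρ r
  exact edge_of_settles ρ hT (by omega) (hB.cell_mem _ hs.lt) (settles_rgt_un hB hs)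

theorem rgt_bin_of_lst (hT : ∀ r < T, Live x (rules.graphAt ρ x r))
    (h0 : x[0]? = some .all ∨ x[0]? = some .ex) {s hb} {f g : QF}
    (hs : Seg x p (.bin s hb f g)) {r : ℕ} (hr : r + 1 ≤ T)
    (hl : (rules.graphAt ρ x r).edge (.cell (p + 1)) lst =
      .cell (p + 1 + f.encode.length - 1)) :
    (rules.graphAt ρ x (r + 1)).edge (.cell p) rgt = .cell (p + 1 + f.encode.length) := by
  have hB := base_graphAt (x := x) ρ r
  exact edge_of_settles ρ hT (by omega) (hB.cell_mem _ hs.lt)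
    (settles_rgt_bin hB (cellInv_graphAt ρ h0 r) hs (by rw [hl]; simp))

/-- A variable takes at most `n` rounds. Each level above adds two: one for `rgt`, which waits for
the first argument, and one for `lst`. Both arguments are parsed at the same time, so the depth
counts and not the length. -/
theorem lst_done (hT : ∀ r < T, Live x (rules.graphAt ρ x r))
    (h0 : x[0]? = some .all ∨ x[0]? = some .ex) {n : ℕ} {f : QF}
    (hs : Seg x p f) (hv : f.VarsLt n) {r : ℕ} (hjr : n + 2 * f.depth ≤ r) (hr : r ≤ T) :
    (rules.graphAt ρ x r).edge (.cell p) lst = .cell (p + f.encode.length - 1) := by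
  induction f generalizing p r with
  | var i =>
    have := lst_tick_done hT hs (j := 0) (k := i) (by omega) (r := r)
      (by simp only [VarsLt] at hv; omega) hr
    simpa [encode] using this
  | un s hu f ih =>
    simp only [depth] at hjr
    obtain ⟨r, rfl⟩ : ∃ k, r = k + 1 := ⟨r - 1, by omega⟩
    have hB := base_graphAt (x := x) ρ r
    rw [edge_of_settles ρ hT (by omega) (hB.cell_mem _ hs.lt)
      (settles_lst_node hB hs.get_un (.inl hu)), rgt_un_done hT hs (by omega) (by omega),
      ih hs.un hv (by omega) (by omega)]
    simp only [encode, List.length_cons, Node.cell.injEq]; omega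
  | bin s hb f g ihf ihg =>
    simp only [depth] at hjr
    -- Round `r + 1` sets `rgt`, using the end of the first argument; round `r + 2` sets `lst`,
    -- using the end of the second.
    obtain ⟨r, rfl⟩ : ∃ k, r = k + 2 := ⟨r - 2, by omega⟩
    have hB := base_graphAt (x := x) ρ (r + 1)
    rw [edge_of_settles ρ hT (by omega) (hB.cell_mem _ hs.lt)
      (settles_lst_node hB hs.get_bin (.inr hb)),
      rgt_bin_of_lst hT h0 hs (by omega) (ihf hs.bin_left hv.1 (by omega) (by omega)),
      ihg hs.bin_right hv.2 (by omega) (by omega)]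
    simp only [encode, List.length_cons, List.length_append, Node.cell.injEq]; omega

theorem rgt_bin_done (hT : ∀ r < T, Live x (rules.graphAt ρ x r))
    (h0 : x[0]? = some .all ∨ x[0]? = some .ex) {n : ℕ} {s hb} {f g : QF}
    (hs : Seg x p (.bin s hb f g)) (hv : f.VarsLt n) {r : ℕ} (hjr : n + 2 * f.depth + 1 ≤ r)
    (hr : r ≤ T) :
    (rules.graphAt ρ x r).edge (.cell p) rgt = .cell (p + 1 + f.encode.length) := by
  obtain ⟨r, rfl⟩ : ∃ k, r = k + 1 := ⟨r - 1, by omega⟩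
  exact rgt_bin_of_lst hT h0 hs hr (lst_done hT h0 hs.bin_left hv (by omega) (by omega))

end Cells


open QF

/-- The address of a node of the evaluation tree, the last branch first. -/
def path : Node → List Bool
  | .origin => []
  | .cell _ => []
  | .fresh _ l c => if l = 0 then [] else decide (l = 11) :: path c

theorem path_child (t : ℕ) (b : Bool) (c : Node) : path (.fresh t (line b) c) = b :: path c := by
  cases b <;> simp [path, line]

theorem path_root (x : List QSym) : path (RuleSet.root x) = [] := by
  simp [path, RuleSet.root]

theorem line_inj {b b' : Bool} : line b = line b' ↔ b = b' := by
  cases b <;> cases b' <;> simp [line]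

theorem fresh_ne_creator {t l : ℕ} {c : Node} : Node.fresh t l c ≠ c := by
  intro h; have := congrArg sizeOf h; simp at this

theorem fresh_fresh_ne {t l t' l' : ℕ} {c : Node} :
    Node.fresh t l (Node.fresh t' l' c) ≠ c := by
  intro h; have := congrArg sizeOf h; simp at this; omega

/-- The formula `F`, with `n` quantifiers in front and variables among the quantified ones, is
written as `x`. -/
structure Input (x : List QSym) (F : QF) (n : ℕ) : Prop where
  seg : Seg x 0 F
  varsLt : F.VarsLt n
  prefixed : F.Prefixed n
  n_pos : 0 < n
  head : x[0]? = some .all ∨ x[0]? = some .ex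

/-! ### Soundness: the invariant of the evaluation tree -/

section Tree

variable {x : List QSym} {F : QF} {n : ℕ} {G G' : PGraph D} {t : ℕ}

/-- Above depth `n` there are only quantifiers, so a variable occurs below all of them; in
particular its quantifier is on the way to the center. -/
theorem Input.length_of_var (hI : Input x F n) {β : List Bool} {p i : ℕ}
    (h : F.item β = some (p, .var i)) : i < n ∧ n ≤ β.length := by
  refine ⟨item_varsLt hI.varsLt h, ?_⟩
  by_contra hb
  have := ((item_prefixed hI.prefixed h).1 (by omega)).2
  rw [show n - β.length = (n - β.length - 1) + 1 by omega] at this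
  exact this

/-- A node of the tree stands at the `i`-th quantifier exactly if it has depth `i`. Comparing cells
thus measures depth, which makes the search for a quantifier correct. -/
theorem Input.length_eq (hI : Input x F n) {β : List Bool} {p : ℕ} {f : QF}
    (h : F.item β = some (p, f)) {i : ℕ} (hi : i < n) : p = i ↔ β.length = i := by
  have := item_prefixed hI.prefixed h
  constructor
  · intro hp
    by_cases hb : β.length < n
    · rw [← (this.1 hb).1, hp]
    · have := this.2 (by omega); omega
  · intro hb
    rw [← hb]; exact (this.1 (by omega)).1

/-- The evaluation tree is correct as far as it has been built. -/
structure TreeInv (x : List QSym) (F : QF) (G : PGraph D) : Prop where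
  cell_ch : ∀ i < x.length, ∀ b, G.edge (.cell i) (ch b) = .origin
  parent : ∀ t l c, .fresh t l c ∈ G.nodes → .fresh t l c = RuleSet.root x ∨
    ∃ b, l = line b ∧ (∃ t' l' c', c = .fresh t' l' c') ∧ c ∈ G.nodes ∧
      G.edge c (ch b) = .fresh t l c ∧
      ∃ p f q g, F.item (path c) = some (p, f) ∧ G.edge c cell = .cell p ∧
        G.edge (.cell p) rgt ≠ .origin ∧ F.item (b :: path c) = some (q, g)
  child : ∀ t l c, .fresh t l c ∈ G.nodes → ∀ b, G.edge (.fresh t l c) (ch b) = c ∨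
    ∃ t', G.edge (.fresh t l c) (ch b) = .fresh t' (line b) (.fresh t l c) ∧
      .fresh t' (line b) (.fresh t l c) ∈ G.nodes
  pos : ∀ t l c, .fresh t l c ∈ G.nodes → ∀ p f, F.item (path (.fresh t l c)) = some (p, f) →
    G.edge (.fresh t l c) cell = .cell p ∨
    (.fresh t l c = RuleSet.root x ∧ G.edge (.fresh t l c) cell = .origin) ∨
    (.fresh t l c ≠ RuleSet.root x ∧ G.edge (.fresh t l c) cell = c)
  val : ∀ t l c, .fresh t l c ∈ G.nodes → ∀ p f, F.item (path (.fresh t l c)) = some (p, f) →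
    G.edge (.fresh t l c) .v = c ∨ G.edge (.fresh t l c) .v =
      if f.eval (path (.fresh t l c)) then .origin else .fresh t l c
  walk : ∀ t l c, .fresh t l c ∈ G.nodes → ∀ p i,
    F.item (path (.fresh t l c)) = some (p, .var i) →
    (path (.fresh t l c)).length = i + 1 ∨ ∃ t' l' c', G.edge (.fresh t l c) wk = .fresh t' l' c' ∧
      .fresh t' l' c' ∈ G.nodes ∧ path (.fresh t' l' c') <:+ path (.fresh t l c) ∧
      i + 1 ≤ (path (.fresh t' l' c')).length

theorem TreeInv.exists_item (h : TreeInv x F G) {t l : ℕ} {c : Node}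
    (hu : .fresh t l c ∈ G.nodes) : ∃ p f, F.item (path (.fresh t l c)) = some (p, f) := by
  rcases h.parent t l c hu with h1 | ⟨b, rfl, -, -, -, -, -, q, g, -, -, -, hg⟩
  · rw [h1, path_root]; exact ⟨0, F, rfl⟩
  · rw [path_child]; exact ⟨q, g, hg⟩

/-- A node other than the root is the child of its creator on the side given by its name. -/
theorem TreeInv.side (h : TreeInv x F G) (hB : Base x G) {t l : ℕ} {c : Node} (hx : 0 < x.length)
    (hu : .fresh t l c ∈ G.nodes) {b : Bool} (hc : G.edge c (ch b) = .fresh t l c) :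
    .fresh t l c ≠ RuleSet.root x ∧ l = line b := by
  rcases h.parent t l c hu with h1 | ⟨b', rfl, ⟨t1, l1, c1, rfl⟩, hm, -⟩
  · exfalso
    -- The center is excluded because its creator is a cell of the input, and the child directions
    -- of cells lead to the origin.
    have : c = .cell (x.length - 1) := by
      simp only [RuleSet.root, RuleSet.base, Node.fresh.injEq] at h1
      rw [h1.2.2, if_neg (by rintro rfl; simp at hx)]
    subst this
    rw [h.cell_ch _ (by omega)] at hc
    simp at hc
  · refine ⟨?_, ?_⟩
    · simp only [RuleSet.root, ne_eq, Node.fresh.injEq, not_and]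
      rintro - h1; cases b' <;> simp [line] at h1
    · rcases h.child _ _ _ hm b with h2 | ⟨t', h2, -⟩
      · rw [h2] at hc; exact absurd hc.symm fresh_fresh_ne
      · rw [h2] at hc
        simp only [Node.fresh.injEq] at hc
        exact hc.2.1.symm

theorem TreeInv.at_iff (h : TreeInv x F G) (hI : Input x F n) (hB : Base x G) {t l : ℕ} {c : Node}
    (hu : .fresh t l c ∈ G.nodes) {p : ℕ} {f : QF}
    (hp : F.item (path (.fresh t l c)) = some (p, f)) {L : List QSym} :
    (at' L).Holds G (.fresh t l c) ↔
      G.edge (.fresh t l c) cell = .cell p ∧ ∃ s ∈ L, x[p]? = some s := by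
  have hlt := (item_seg hI.seg hp).lt
  rcases h.pos t l c hu p f hp with h1 | ⟨-, h1⟩ | ⟨h0, h1⟩
  · rw [at_cell hB hu hlt h1]; simp [h1]
  · have := not_at_origin hB (l := L) hu h1
    simp [this, h1]
  · rcases h.parent t l c hu with h2 | ⟨b', rfl, ⟨t1, l1, c1, rfl⟩, hm, -⟩
    · exact absurd h2 h0
    · have := not_at_fresh hB (l := L) hu hm h1
      simp [this, h1]

/-- Values proposed for `cell` are correct. -/
theorem TreeInv.of_proposed_cell (h : TreeInv x F G) (hI : Input x F n) (hB : Base x G)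
    (hC : CellInv x G) {t' t l : ℕ} {c : Node}
    (hu : .fresh t l c ∈ G.nodes) {p : ℕ} {f : QF}
    (hp : F.item (path (.fresh t l c)) = some (p, f)) {y : Node}
    (hy : rules.Proposed t' G (.fresh t l c) cell y) : y = .cell p := by
  have hx : 0 < x.length := hI.seg.lt
  have key : ∀ b, G.edge c (ch b) = .fresh t l c →
      y = (if b then G.edge (G.edge c cell) rgt else G.edge (G.edge c cell) .e) → y = .cell p := by
    intro b hb hyb
    obtain ⟨hr, rfl⟩ := h.side hB hx hu hb
    rcases h.parent t _ c hu with h1 | ⟨b', hl, -, hm, -, q, g, -, -, hq, hcell, hrgt, -⟩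
    · exact absurd h1 hr
    · rw [path_child] at hp
      have hseg := item_seg hI.seg hq
      rw [hcell] at hyb
      cases g with
      | var i => simp [item, hq] at hp
      | un s hs g =>
        rw [item_un hq] at hp
        simp only [Option.some.injEq, Prod.mk.injEq] at hp
        rw [hyb, ← hp.1]
        cases b
        · simp [hB.cell_e q hseg.lt, hseg.un.lt]
        · rcases hC.rgt_un _ _ _ _ hseg with h3 | h3
          · exact absurd h3 hrgt
          · simp [h3]
      | bin s hs g g' =>
        rw [item_bin hq] at hp
        cases b
        · simp only [Bool.false_eq_true, if_false, Option.some.injEq, Prod.mk.injEq] at hp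
          simp [hyb, ← hp.1, hB.cell_e q hseg.lt, hseg.bin_left.lt]
        · simp only [if_true, Option.some.injEq, Prod.mk.injEq] at hp
          rcases hC.rgt_bin _ _ _ _ _ hseg with h3 | h3
          · exact absurd h3 hrgt
          · simp [hyb, h3, ← hp.1]
  rcases (proposed_cell hy).2 with ⟨h1, h2, h3⟩ | ⟨-, h2, h3⟩ | ⟨-, h2, h3⟩
  · rw [hB.o _ hu] at h1 h2 h3
    rw [hB.origin_ctr] at h1
    rw [← h1, path_root] at hp
    simp only [item, Option.some.injEq, Prod.mk.injEq] at hp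
    rcases hC.first with h4 | h4
    · exact absurd h4 h2
    · rw [h3, h4, hp.1]
  · rw [hB.fresh_up _ _ _ hu] at h2 h3
    exact key false h2 (by simpa using h3)
  · rw [hB.fresh_up _ _ _ hu] at h2 h3
    exact key true h2 (by simpa using h3)

theorem TreeInv.cell_stable (h : TreeInv x F G) (hI : Input x F n) (hB : Base x G)
    (hC : CellInv x G) (hR : rules.Round t G G') {t l : ℕ} {c : Node}
    (hu : .fresh t l c ∈ G.nodes) {p : ℕ} {f : QF}
    (hp : F.item (path (.fresh t l c)) = some (p, f))
    (hc : G.edge (.fresh t l c) cell = .cell p) : G'.edge (.fresh t l c) cell = .cell p := by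
  rcases RuleSet.step_cases hR hu cell with h' | h'
  · exact h.of_proposed_cell hI hB hC hu hp h'
  · rw [h', hc]

/-- While a child has no value, its `.v` leads to the parent, which is neither the origin nor the
child, so neither guard can mistake it for a value. -/
theorem TreeInv.childVal (h : TreeInv x F G) (hB : Base x G) {t l : ℕ} {c : Node}
    (hu : .fresh t l c ∈ G.nodes) {b : Bool} {p : ℕ} {f : QF}
    (hp : F.item (b :: path (.fresh t l c)) = some (p, f)) :
    ((childTrue b).Holds G (.fresh t l c) → f.eval (b :: path (.fresh t l c)) = true) ∧
    ((childFalse b).Holds G (.fresh t l c) → f.eval (b :: path (.fresh t l c)) = false) := by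
  have key : G.edge (.fresh t l c) (ch b) ≠ c → ∃ t', G.edge (.fresh t l c) (ch b) =
      .fresh t' (line b) (.fresh t l c) ∧
      (G.edge (.fresh t' (line b) (.fresh t l c)) .v = .fresh t l c ∨
      G.edge (.fresh t' (line b) (.fresh t l c)) .v =
        if f.eval (b :: path (.fresh t l c)) then .origin
          else .fresh t' (line b) (.fresh t l c)) := by
    intro hne
    rcases h.child t l c hu b with h1 | ⟨t', h1, hm⟩
    · exact absurd h1 hne
    · refine ⟨t', h1, ?_⟩
      have := h.val _ _ _ hm p f (by rw [path_child]; exact hp)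
      rwa [path_child] at this
  constructor
  · rintro ⟨h1, h2⟩
    simp only [PathExpr.Holds, PGraph.follow, List.foldl, hB.fresh_up _ _ _ hu, hB.o _ hu] at h1 h2
    obtain ⟨t', h3, h4⟩ := key h2
    rw [h3] at h1
    rcases h4 with h4 | h4
    · rw [h4] at h1; simp at h1
    · rw [h4] at h1
      by_contra hf
      rw [if_neg hf] at h1; simp at h1
  · rintro ⟨h1, h2⟩
    simp only [PathExpr.Holds, PGraph.follow, List.foldl, hB.fresh_up _ _ _ hu] at h1 h2
    obtain ⟨t', h3, h4⟩ := key h2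
    rw [h3] at h1
    rcases h4 with h4 | h4
    · rw [h4] at h1; exact absurd h1.symm fresh_ne_creator
    · rw [h4] at h1
      by_contra hf
      rw [if_pos (by simpa using hf)] at h1; simp at h1

/-- At a variable whose quantifier is known, the quantifier has been found iff the distance to it is
right. -/
theorem TreeInv.parent_cell (h : TreeInv x F G) (hI : Input x F n) {t l : ℕ} {c : Node}
    (hu : .fresh t l c ∈ G.nodes) (hr : path (.fresh t l c) ≠ []) {i : ℕ} (hi : i < n) :
    (∃ b, l = line b ∧ (∃ t' l' c', c = .fresh t' l' c') ∧ c ∈ G.nodes) ∧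
      (G.edge c cell = .cell i ↔ (path (.fresh t l c)).length = i + 1) := by
  rcases h.parent t l c hu with h1 | ⟨b, rfl, hf, hm, -, q, g, -, -, hq, hcell, -, -⟩
  · rw [h1, path_root] at hr; exact absurd rfl hr
  · refine ⟨⟨b, rfl, hf, hm⟩, ?_⟩
    rw [hcell, path_child, Node.cell.injEq, hI.length_eq hq hi]
    simp

/-- If `lst` or `qv` were undefined, the path would end at the origin. -/
theorem var_ready (hC : CellInv x G) (horg : ∀ d, d ≠ ctr → d ≠ fst → G.edge .origin d = .origin)
    {p i : ℕ} (hs : Seg x p (.var i)) (h : G.edge (G.edge (.cell p) lst) qv ≠ .origin) :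
    G.edge (G.edge (.cell p) lst) qv = .cell i := by
  rcases hC.last_tick p i hs 0 (by omega) with h1 | h1
  · rw [add_zero] at h1
    rw [h1] at h
    exact absurd (horg _ (by simp) (by simp)) h
  · rw [add_zero] at h1
    rw [h1] at h ⊢
    rcases hC.quant p i hs i le_rfl with h2 | h2
    · exact absurd h2 h
    · exact h2

/-- Addresses list the last branch first, so a suffix `b :: β` says that `b` is the branch taken at
depth `β.length`. -/
theorem not_suffix_nil {β γ : List Bool} {b : Bool} {k : ℕ} (h : (b :: β) <:+ γ)
    (hk : β.length = k) : γ.reverse.getD k false = b := by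
  obtain ⟨δ, rfl⟩ := h
  simp [← hk]

/-- What the guards of the rules for variables mean. -/
theorem TreeInv.var_guards (h : TreeInv x F G) (hI : Input x F n) (hB : Base x G)
    (hC : CellInv x G) {t l : ℕ} {c : Node} (hu : .fresh t l c ∈ G.nodes) {p i : ℕ}
    (hp : F.item (path (.fresh t l c)) = some (p, .var i))
    (hr : varReady.Holds G (.fresh t l c)) :
    (found0.Holds G (.fresh t l c) ↔ (path (.fresh t l c)).length = i + 1) ∧
    (∀ t' l' c', G.edge (.fresh t l c) wk = .fresh t' l' c' → .fresh t' l' c' ∈ G.nodes →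
      path (.fresh t' l' c') ≠ [] →
      (found.Holds G (.fresh t l c) ↔ (path (.fresh t' l' c')).length = i + 1)) := by
  obtain ⟨hi, hn⟩ := hI.length_of_var hp
  obtain ⟨h1, h2⟩ := hr
  rw [h.at_iff hI hB hu hp] at h1
  simp only [PathExpr.Holds, PGraph.follow, List.foldl, h1.1, hB.o _ hu] at h2
  have h3 := var_ready hC hB.origin_edge (item_seg hI.seg hp) h2
  have hne : path (.fresh t l c) ≠ [] := by
    intro h0; rw [h0] at hn; simp at hn; omega
  constructor
  · simp only [found0, PathExpr.Holds, PGraph.follow, List.foldl, h1.1, h3, hB.fresh_up _ _ _ hu]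
    exact (h.parent_cell hI hu hne hi).2
  · intro t' l' c' hw hm hne'
    simp only [found, PathExpr.Holds, PGraph.follow, List.foldl, h1.1, h3, hw,
      hB.fresh_up _ _ _ hm]
    exact (h.parent_cell hI hm hne' hi).2

/-- The child of the quantifier through which the leaf is reached is the leaf itself or the node
under `wk`. Its side is the branch taken at depth `i`, which is the value of the variable. -/
theorem TreeInv.varVal_eq (h : TreeInv x F G) (hI : Input x F n) (hB : Base x G)
    (hC : CellInv x G) {t l : ℕ} {c : Node} (hu : .fresh t l c ∈ G.nodes) {p i : ℕ}
    (hp : F.item (path (.fresh t l c)) = some (p, .var i)) {b : Bool}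
    (hv : (varVal b).Holds G (.fresh t l c)) :
    (QF.var i).eval (path (.fresh t l c)) = b := by
  have hx : 0 < x.length := hI.seg.lt
  obtain ⟨hr, hv⟩ := hv
  obtain ⟨g0, g1⟩ := h.var_guards hI hB hC hu hp hr
  rcases hv with ⟨h1, h2⟩ | ⟨⟨h1, h2⟩, h3⟩
  · simp only [PathExpr.Holds, PGraph.follow, List.foldl, hB.fresh_up _ _ _ hu] at h2
    obtain ⟨-, rfl⟩ := h.side hB hx hu h2
    have hlen := g0.1 h1
    rw [path_child] at hlen ⊢
    exact not_suffix_nil List.suffix_rfl (by simpa using hlen)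
  · have h1' : (path (.fresh t l c)).length ≠ i + 1 := fun h' => h1 (g0.2 h')
    rcases h.walk t l c hu p i hp with h4 | ⟨t', l', c', hw, hm, hsuf, hle⟩
    · exact absurd h4 h1'
    · have hne : path (.fresh t' l' c') ≠ [] := by
        intro h0; rw [h0] at hle; simp at hle
      have hlen := (g1 t' l' c' hw hm hne).1 h2
      simp only [PathExpr.Holds, PGraph.follow, List.foldl, hw, hB.fresh_up _ _ _ hm] at h3
      obtain ⟨-, rfl⟩ := h.side hB hx hm h3
      rw [path_child] at hlen hsuf
      exact not_suffix_nil hsuf (by simpa using hlen)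

/-- The letter at the cell leaves only one alternative of each guard, and the values that it reads
from the children, or from the search for a quantifier, are right. -/
theorem TreeInv.val_eq (h : TreeInv x F G) (hI : Input x F n) (hB : Base x G)
    (hC : CellInv x G) {t l : ℕ} {c : Node} (hu : .fresh t l c ∈ G.nodes) {p : ℕ} {f : QF}
    (hp : F.item (path (.fresh t l c)) = some (p, f)) :
    (valTrue.Holds G (.fresh t l c) → f.eval (path (.fresh t l c)) = true) ∧
    (valFalse.Holds G (.fresh t l c) → f.eval (path (.fresh t l c)) = false) := by
  have hseg := item_seg hI.seg hp
  have hat : ∀ {L}, (at' L).Holds G (.fresh t l c) → ∃ s ∈ L, x[p]? = some s :=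
    fun h' => ((h.at_iff hI hB hu hp).1 h').2
  cases f with
  | var i =>
    have hg := hseg.get_var
    constructor
    all_goals
      intro hv
      simp only [valTrue, valFalse, anyOf_holds, List.mem_cons, List.not_mem_nil, or_false,
        exists_eq_or_imp, exists_eq_left] at hv
      rcases hv with hv | hv | hv | hv
      · have := hat hv.1; simp [hg] at this
      · have := hat hv.1; simp [hg] at this
      · have := hat hv.1; simp [hg] at this
      · exact h.varVal_eq hI hB hC hu hp hv
  | un s hs f =>
    have hg := hseg.get_un
    have c0 := h.childVal hB hu (item_un hp false)
    have c1 := h.childVal hB hu (item_un hp true)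
    constructor
    all_goals
      intro hv
      simp only [valTrue, valFalse, anyOf_holds, List.mem_cons, List.not_mem_nil, or_false,
        exists_eq_or_imp, exists_eq_left] at hv
      rcases hv with ⟨hv, hv'⟩ | ⟨hv, hv'⟩ | ⟨hv, hv'⟩ | hv
      · have := hat hv
        rcases QSym.isUn_cases hs with rfl | rfl | rfl <;> simp [hg] at this
        simp only [PathExpr.Holds] at hv'
        simp only [eval, QSym.comb]
        grind
      · have := hat hv
        rcases QSym.isUn_cases hs with rfl | rfl | rfl <;> simp [hg] at this
        simp only [PathExpr.Holds] at hv'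
        simp only [eval, QSym.comb]
        grind
      · have := hat hv
        rcases QSym.isUn_cases hs with rfl | rfl | rfl <;> simp [hg] at this
        simp only [eval, QSym.comb]
        grind
      · have := hat hv.1.1
        rcases QSym.isUn_cases hs with rfl | rfl | rfl <;> simp [hg] at this
  | bin s hs f g =>
    have hg := hseg.get_bin
    have c0 := h.childVal hB hu (item_bin hp false)
    have c1 := h.childVal hB hu (item_bin hp true)
    constructor
    all_goals
      intro hv
      simp only [valTrue, valFalse, anyOf_holds, List.mem_cons, List.not_mem_nil, or_false,
        exists_eq_or_imp, exists_eq_left] at hv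
      rcases hv with ⟨hv, hv'⟩ | ⟨hv, hv'⟩ | ⟨hv, hv'⟩ | hv
      · have := hat hv
        rcases QSym.isBin_cases hs with rfl | rfl <;> simp [hg] at this
        simp only [PathExpr.Holds] at hv'
        simp only [eval, QSym.comb]
        grind
      · have := hat hv
        rcases QSym.isBin_cases hs with rfl | rfl <;> simp [hg] at this
        simp only [PathExpr.Holds] at hv'
        simp only [eval, QSym.comb]
        grind
      · have := hat hv
        rcases QSym.isBin_cases hs with rfl | rfl <;> simp [hg] at this
      · have := hat hv.1.1
        rcases QSym.isBin_cases hs with rfl | rfl <;> simp [hg] at this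

theorem exists_child_item (hI : Input x F n) {β : List Bool} {p : ℕ} {f : QF}
    (hp : F.item β = some (p, f)) {s : QSym} (hs : s ∈ [QSym.all, .ex, .not, .and, .or])
    (hx : x[p]? = some s) (b : Bool) : ∃ q g, F.item (b :: β) = some (q, g) := by
  have hseg := item_seg hI.seg hp
  cases f with
  | var i =>
    have := hseg.get_var
    simp [hx] at this
    subst this
    simp at hs
  | un s hs f => exact ⟨_, _, item_un hp b⟩
  | bin s hs f g =>
    rw [item_bin hp]
    cases b <;> simp

theorem TreeInv.sprout_iff (h : TreeInv x F G) (hI : Input x F n) (hB : Base x G) {t l : ℕ}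
    {c : Node} (hu : .fresh t l c ∈ G.nodes) {p : ℕ} {f : QF}
    (hp : F.item (path (.fresh t l c)) = some (p, f)) {b : Bool} :
    (sprout b).Holds G (.fresh t l c) ↔ (G.edge (.fresh t l c) cell = .cell p ∧
      ∃ s ∈ [QSym.all, .ex, .not, .and, .or], x[p]? = some s) ∧
      G.edge (.cell p) rgt ≠ .origin ∧ G.edge (.fresh t l c) (ch b) = c := by
  simp only [sprout, PathExpr.Holds, h.at_iff hI hB hu hp]
  refine and_congr_right fun h1 => ?_
  simp only [PGraph.follow, List.foldl, h1.1, hB.o _ hu, hB.fresh_up _ _ _ hu]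

theorem sprout_fresh (hB : Base x G) {c : Node} (hc : c ∈ G.nodes) {b : Bool}
    (hs : (sprout b).Holds G c) : ∃ t l c', c = .fresh t l c' := by
  rcases hB.cases c hc with rfl | ⟨i, hi, rfl⟩ | h
  · exact absurd hs.1 (not_at_origin hB hc (hB.origin_edge _ (by simp) (by simp)))
  · exact absurd hs.1 (not_at_origin hB hc (hB.cell_cell i hi))
  · exact h

theorem ch_stable (hB : Base x G) (hR : rules.Round t G G') {t' l : ℕ} {c : Node}
    (hu : .fresh t' l c ∈ G.nodes) {b : Bool} (hc : G.edge (.fresh t' l c) (ch b) ≠ c) :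
    G'.edge (.fresh t' l c) (ch b) = G.edge (.fresh t' l c) (ch b) := by
  refine RuleSet.step_keep hR hu fun y hy => hc ?_
  have := (proposed_ch.1 hy).1.2.2.2.2
  simpa only [PathExpr.Holds, PGraph.follow, List.foldl, hB.fresh_up _ _ _ hu] using this

theorem rgt_stable (hI : Input x F n) (hB : Base x G) (hC : CellInv x G)
    (hR : rules.Round t G G') {β : List Bool} {p : ℕ} {f : QF} (hp : F.item β = some (p, f))
    (hf : ∀ i, f ≠ .var i) (hr : G.edge (.cell p) rgt ≠ .origin) :
    G'.edge (.cell p) rgt ≠ .origin := by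
  have hseg := item_seg hI.seg hp
  have hm := hB.cell_mem p hseg.lt
  cases f with
  | var i => exact absurd rfl (hf i)
  | un s hs f =>
    rcases (settles_rgt_un hB hseg).or hR hm with h | h
    · rwa [h]
    · rw [h]; simp
  | bin s hs f g =>
    rcases RuleSet.step_cases hR hm rgt with h | h
    · rw [hC.of_proposed_rgt hB hseg h]; simp
    · rwa [h]

/-- As the search has not ended, the node under `wk` is deeper than `i + 1`; its parent has depth at
least `i + 1`, so the search cannot pass the quantifier. -/
theorem TreeInv.wk_step (h : TreeInv x F G) (hI : Input x F n) (hB : Base x G)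
    (hC : CellInv x G) {t l : ℕ} {c : Node} (hu : .fresh t l c ∈ G.nodes) {p i : ℕ}
    (hp : F.item (path (.fresh t l c)) = some (p, .var i))
    (hr : varReady.Holds G (.fresh t l c)) (h0 : ¬ found0.Holds G (.fresh t l c))
    (h1 : ¬ found.Holds G (.fresh t l c)) :
    ∃ t' l' c', G.edge (.fresh t l c) wk = .fresh t' l' c' ∧ .fresh t' l' c' ∈ G.nodes ∧
      ∃ t2 l2 c2, c' = .fresh t2 l2 c2 ∧ c' ∈ G.nodes ∧
        G.edge (G.edge (.fresh t l c) wk) up = c' ∧ path c' <:+ path (.fresh t l c) ∧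
        i + 1 ≤ (path c').length ∧
        (path (.fresh t' l' c')).length = (path c').length + 1 := by
  obtain ⟨g0, g1⟩ := h.var_guards hI hB hC hu hp hr
  obtain ⟨hi, hn⟩ := hI.length_of_var hp
  rcases h.walk t l c hu p i hp with h4 | ⟨t', l', c', hw, hm, hsuf, hle⟩
  · exact absurd (g0.2 h4) h0
  · have hne : path (.fresh t' l' c') ≠ [] := by
      intro h0; rw [h0] at hle; simp at hle
    have hlen : (path (.fresh t' l' c')).length ≠ i + 1 := fun h' =>
      h1 ((g1 t' l' c' hw hm hne).2 h')
    obtain ⟨⟨b, rfl, ⟨t2, l2, c2, rfl⟩, hm2⟩, -⟩ := h.parent_cell hI hm hne hi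
    refine ⟨t', _, _, hw, hm, t2, l2, c2, rfl, hm2, by rw [hw, hB.fresh_up _ _ _ hm], ?_, ?_, ?_⟩
    · rw [path_child] at hsuf
      exact (List.suffix_cons _ _).trans hsuf
    · rw [path_child] at hle hlen
      simp only [List.length_cons] at hle hlen
      omega
    · rw [path_child]; rfl

/-- For a node born in this round every clause holds because its edges lead to its creator, which is
the undefined value for `ch`, `cell` and `.v`, and for `wk` the start of the search. For an older
node an edge keeps its value or takes a proposal, and proposals are right. -/
theorem TreeInv.step (h : TreeInv x F G) (hI : Input x F n) (hB : Base x G) (hC : CellInv x G)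
    (hR : rules.Round t G G') : TreeInv x F G' := by
  have hx : 0 < x.length := hI.seg.lt
  have hmono : ∀ u, u ∈ G.nodes → u ∈ G'.nodes := fun u hu => (hR.nodes u).2 (.inl hu)
  have hborn : ∀ u, rules.Born t G u → ∃ b t' l' c', u = .fresh (t + 1) (line b) (.fresh t' l' c') ∧
      .fresh t' l' c' ∈ G.nodes ∧ (sprout b).Holds G (.fresh t' l' c') ∧
      rules.Fires G (sprout b) (.fresh t' l' c') ∧ ∀ d, d ≠ .o → G'.edge u d = .fresh t' l' c' := by
    intro u hu
    obtain ⟨b, c, hf, rfl⟩ := born_iff.1 hu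
    obtain ⟨t', l', c', rfl⟩ := sprout_fresh hB hf.1 hf.2.2
    exact ⟨b, t', l', c', rfl, hf.1, hf.2.2, hf, fun d hd => hR.born _ hu d hd⟩
  have hroot : ∀ b c, Node.fresh (t + 1) (line b) c ≠ RuleSet.root x := by
    intro b c; simp [RuleSet.root]
  refine ⟨?_, ?_, ?_, ?_, ?_, ?_⟩
  · intro i hi b
    rw [RuleSet.step_keep hR (hB.cell_mem i hi) fun y =>
      not_proposed_tree hB (hB.cell_mem i hi) (hB.cell_cell i hi) (.inr (.inr ⟨b, rfl⟩)),
      h.cell_ch i hi b]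
  · intro t' l c hu
    rcases (hR.nodes _).1 hu with hu | hu
    · rcases h.parent t' l c hu with h1 | ⟨b, rfl, ⟨t1, l1, c1, rfl⟩, hm, hc, p, f, q, g, hp, h2,
        h3, h4⟩
      · exact .inl h1
      · refine .inr ⟨b, rfl, ⟨t1, l1, c1, rfl⟩, hmono _ hm, ?_, p, f, q, g, hp,
          h.cell_stable hI hB hC hR hm hp h2, rgt_stable hI hB hC hR hp ?_ h3, h4⟩
        · rw [ch_stable hB hR hm (by rw [hc]; exact fresh_fresh_ne), hc]
        · rintro i rfl
          simp [item, hp] at h4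
    · obtain ⟨b, t1, l1, c1, h1, hm, hs, hf, -⟩ := hborn _ hu
      simp only [Node.fresh.injEq] at h1
      obtain ⟨rfl, rfl, rfl⟩ := h1
      obtain ⟨p, f, hp⟩ := h.exists_item hm
      obtain ⟨⟨h2, s, hs1, hs2⟩, h3, h4⟩ := (h.sprout_iff hI hB hm hp).1 hs
      obtain ⟨q, g, hq⟩ := exists_child_item hI hp hs1 hs2 b
      refine .inr ⟨b, rfl, ⟨t1, l1, c1, rfl⟩, hmono _ hm, ?_, p, f, q, g, hp,
        h.cell_stable hI hB hC hR hm hp h2, rgt_stable hI hB hC hR hp ?_ h3, hq⟩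
      · exact RuleSet.step_eq hR hm ⟨_, proposed_ch.2 ⟨hf, rfl⟩⟩
          fun y hy => (proposed_ch.1 hy).2
      · rintro i rfl
        simp [item, hp] at hq
  · intro t' l c hu b
    rcases (hR.nodes _).1 hu with hu | hu
    · rcases RuleSet.step_cases hR hu (ch b) with h1 | h1
      · obtain ⟨hf, h2⟩ := proposed_ch.1 h1
        refine .inr ⟨t + 1, h2, (hR.nodes _).2 (.inr (born_iff.2 ⟨b, _, hf, rfl⟩))⟩
      · rw [h1]
        rcases h.child t' l c hu b with h2 | ⟨t1, h2, h3⟩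
        · exact .inl h2
        · exact .inr ⟨t1, h2, hmono _ h3⟩
    · obtain ⟨b', t1, l1, c1, h1, -, -, -, he⟩ := hborn _ hu
      simp only [Node.fresh.injEq] at h1
      obtain ⟨rfl, rfl, rfl⟩ := h1
      exact .inl (he _ (by cases b <;> simp [ch]))
  · intro t' l c hu p f hp
    rcases (hR.nodes _).1 hu with hu | hu
    · rcases RuleSet.step_cases hR hu cell with h1 | h1
      · exact .inl (h.of_proposed_cell hI hB hC hu hp h1)
      · rw [h1]; exact h.pos t' l c hu p f hp
    · obtain ⟨b', t1, l1, c1, h1, -, -, -, he⟩ := hborn _ hu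
      simp only [Node.fresh.injEq] at h1
      obtain ⟨rfl, rfl, rfl⟩ := h1
      exact .inr (.inr ⟨hroot _ _, he _ (by simp)⟩)
  · intro t' l c hu p f hp
    rcases (hR.nodes _).1 hu with hu | hu
    · rcases RuleSet.step_cases hR hu .v with h1 | h1
      · right
        obtain ⟨h2, h3⟩ := h.val_eq hI hB hC hu hp
        rcases (proposed_v h1).2 with ⟨h4, h5⟩ | ⟨h4, h5⟩
        · rw [h5, hB.o _ hu, h2 h4]; rfl
        · rw [h5, h3 h4]; rfl
      · rw [h1]; exact h.val t' l c hu p f hp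
    · obtain ⟨b', t1, l1, c1, h1, -, -, -, he⟩ := hborn _ hu
      simp only [Node.fresh.injEq] at h1
      obtain ⟨rfl, rfl, rfl⟩ := h1
      exact .inl (he _ (by simp))
  · intro t' l c hu p i hp
    rcases (hR.nodes _).1 hu with hu | hu
    · rcases RuleSet.step_cases hR hu wk with h1 | h1
      · obtain ⟨-, hr, h0, h2, h3⟩ := proposed_wk h1
        obtain ⟨t1, l1, c1, -, -, t2, l2, c2, rfl, hm, h4, h5, h6, -⟩ :=
          h.wk_step hI hB hC hu hp hr h0 h2
        exact .inr ⟨t2, l2, c2, h3.trans h4, hmono _ hm, h5, h6⟩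
      · rw [h1]
        rcases h.walk t' l c hu p i hp with h2 | ⟨t1, l1, c1, h2, h3, h4⟩
        · exact .inl h2
        · exact .inr ⟨t1, l1, c1, h2, hmono _ h3, h4⟩
    · obtain ⟨b', t1, l1, c1, h1, hm, -, -, he⟩ := hborn _ hu
      simp only [Node.fresh.injEq] at h1
      obtain ⟨rfl, rfl, rfl⟩ := h1
      obtain ⟨hi, hn⟩ := hI.length_of_var hp
      -- If the creator already stands for the quantifier, `found0` will hold and `wk` is not
      -- needed. Otherwise the creator is still deep enough to start from.
      by_cases hl : (path (.fresh (t + 1) (line b') (.fresh t1 l1 c1))).length = i + 1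
      · exact .inl hl
      · refine .inr ⟨t1, l1, c1, he _ (by simp), hmono _ hm, ?_, ?_⟩
        · rw [path_child]; exact List.suffix_cons _ _
        · rw [path_child] at hl hn
          simp only [List.length_cons] at hl hn
          omega

variable (ρ : Resolution (Dir QSym 10))

theorem Input.root_eq (hI : Input x F n) : RuleSet.root x = .fresh 0 0 (.cell (x.length - 1)) := by
  have hx : 0 < x.length := hI.seg.lt
  rw [RuleSet.root, RuleSet.base, if_neg (by rintro rfl; simp at hx)]

theorem start_root (hI : Input x F n) {d : D} (h1 : d ≠ .o) (h2 : d ≠ cell) :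
    (rules.startGraph x).edge (RuleSet.root x) d = .cell (x.length - 1) := by
  have hx : 0 < x.length := hI.seg.lt
  have : x ≠ [] := by rintro rfl; simp at hx
  simp [RuleSet.startGraph, h1, h2, rules, RuleSet.base, this]

theorem treeInv_graphAt (hI : Input x F n) (r : ℕ) : TreeInv x F (rules.graphAt ρ x r) := by
  induction r with
  | zero =>
    rw [rules.graphAt_zero]
    have hr : ∀ t l c, Node.fresh t l c ∈ (rules.startGraph x).nodes →
        Node.fresh t l c = RuleSet.root x ∧ c = .cell (x.length - 1) := by
      intro t l c h
      have h1 := rules.fresh_startGraph x h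
      refine ⟨h1, ?_⟩
      rw [hI.root_eq, Node.fresh.injEq] at h1
      exact h1.2.2
    refine ⟨fun i hi b => ?_, fun t l c h => .inl (hr t l c h).1, fun t l c h b => .inl ?_,
      fun t l c h p f _ => .inr (.inl ⟨(hr t l c h).1, ?_⟩), fun t l c h p f _ => .inl ?_,
      fun t l c h p i hp => ?_⟩
    · rw [start_cell]; cases b <;> rfl
    · obtain ⟨h1, h2⟩ := hr t l c h
      rw [h1, h2, start_root hI (by cases b <;> simp [ch]) (by cases b <;> simp [ch])]
    · rw [(hr t l c h).1]
      simp [RuleSet.startGraph, rules]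
    · obtain ⟨h1, h2⟩ := hr t l c h
      rw [h1, h2, start_root hI (by simp) (by simp)]
    · rw [(hr t l c h).1, path_root] at hp
      have h1 := hI.length_of_var hp
      have h2 := hI.n_pos
      simp only [List.length_nil] at h1; omega
  | succ r ih =>
    exact ih.step hI (base_graphAt ρ r) (cellInv_graphAt ρ hI.head r) (rules.round_graphAt ρ x r)

end Tree


open QF

/-! ### Progress: every value is known after linearly many rounds -/

section Progress

variable {x : List QSym} {F : QF} {n : ℕ} {ρ : Resolution (Dir QSym 10)} {T : ℕ}

theorem cell_persists (hI : Input x F n) {r s : ℕ} (hrs : r ≤ s) {t l : ℕ} {c : Node}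
    (hu : .fresh t l c ∈ (rules.graphAt ρ x r).nodes) {p : ℕ} {f : QF}
    (hp : F.item (path (.fresh t l c)) = some (p, f))
    (hc : (rules.graphAt ρ x r).edge (.fresh t l c) cell = .cell p) :
    (rules.graphAt ρ x s).edge (.fresh t l c) cell = .cell p := by
  induction s, hrs using Nat.le_induction with
  | base => exact hc
  | succ s hrs ih =>
    exact (treeInv_graphAt ρ hI s).cell_stable hI (base_graphAt ρ s) (cellInv_graphAt ρ hI.head s)
      (rules.round_graphAt ρ x s) (rules.mem_of_le ρ x hrs hu) hp ih

/-- The value of the subtree at `u` has been computed. -/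
def Known (G : PGraph D) (u : Node) (f : QF) : Prop :=
  G.edge u .v = if f.eval (path u) then .origin else u

/-- Every proposal for `.v` is the true value. So a known value is never lost, and for an unknown
one it suffices that anything is proposed. -/
theorem known_of_proposed (hI : Input x F n) {r : ℕ} {t l : ℕ} {c : Node}
    (hu : .fresh t l c ∈ (rules.graphAt ρ x r).nodes) {p : ℕ} {f : QF}
    (hp : F.item (path (.fresh t l c)) = some (p, f))
    (h : Known (rules.graphAt ρ x r) (.fresh t l c) f ∨
      ∃ y, rules.Proposed (5 + 5 * r) (rules.graphAt ρ x r) (.fresh t l c) .v y) :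
    Known (rules.graphAt ρ x (r + 1)) (.fresh t l c) f := by
  have hB := base_graphAt (x := x) ρ r
  obtain ⟨h2, h3⟩ :=
    (treeInv_graphAt ρ hI r).val_eq hI hB (cellInv_graphAt ρ hI.head r) hu hp
  have hp' : ∀ y, rules.Proposed (5 + 5 * r) (rules.graphAt ρ x r) (.fresh t l c) .v y →
      y = if f.eval (path (.fresh t l c)) then .origin else .fresh t l c := by
    intro y hy
    rcases (proposed_v hy).2 with ⟨h4, h5⟩ | ⟨h4, h5⟩
    · rw [h5, hB.o _ hu, h2 h4]; rfl
    · rw [h5, h3 h4]; rfl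
  rcases RuleSet.step_cases (rules.round_graphAt ρ x r) hu .v with h1 | h1
  · exact hp' _ h1
  · rcases h with h | h
    · exact h1.trans h
    · exact RuleSet.step_eq (rules.round_graphAt ρ x r) hu h hp'

theorem known_mono (hI : Input x F n) {r s : ℕ} (hrs : r ≤ s) {t l : ℕ} {c : Node}
    (hu : .fresh t l c ∈ (rules.graphAt ρ x r).nodes) {p : ℕ} {f : QF}
    (hp : F.item (path (.fresh t l c)) = some (p, f))
    (h : Known (rules.graphAt ρ x r) (.fresh t l c) f) :
    Known (rules.graphAt ρ x s) (.fresh t l c) f := by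
  induction s, hrs using Nat.le_induction with
  | base => exact h
  | succ s hrs ih => exact known_of_proposed hI (rules.mem_of_le ρ x hrs hu) hp (.inl ih)

theorem root_cell (hT : ∀ r < T, Live x (rules.graphAt ρ x r)) (hI : Input x F n) {r : ℕ}
    (hr : r + 2 ≤ T) : (rules.graphAt ρ x (r + 2)).edge (RuleSet.root x) cell = .cell 0 := by
  have hB := base_graphAt (x := x) ρ (r + 1)
  have hm := hB.root_mem
  have hf := fst_done hT hI.head (r := r) (by omega)
  refine RuleSet.step_eq (rules.round_graphAt ρ x (r + 1)) hm ?_ ?_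
  · refine exists_proposed hB hm (b := .and (.eq [.o, ctr] []) (.not (.eq [.o, fst] [.o])))
      (z := [.o, fst]) (by simp [rules]) ⟨?_, ?_⟩ (hT _ (by omega))
    · simp [PathExpr.Holds, PGraph.follow, hB.o _ hm, hB.origin_ctr]
    · simp [PathExpr.Holds, PGraph.follow, hB.o _ hm, hf]
  · intro y hy
    rw [hI.root_eq] at hm hy
    exact (treeInv_graphAt ρ hI (r + 1)).of_proposed_cell hI hB (cellInv_graphAt ρ hI.head _) hm
      (p := 0) (f := F) (by rw [← hI.root_eq, path_root]; rfl) hy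

/-- A node at a cell whose arguments are known has children. -/
theorem exists_child (hT : ∀ r < T, Live x (rules.graphAt ρ x r)) (hI : Input x F n) {r : ℕ}
    (hr : r + 2 ≤ T) (hr0 : n + 2 * F.depth ≤ r) {t l : ℕ} {c : Node}
    (hu : .fresh t l c ∈ (rules.graphAt ρ x r).nodes) {p : ℕ} {f : QF}
    (hp : F.item (path (.fresh t l c)) = some (p, f))
    (hc : (rules.graphAt ρ x r).edge (.fresh t l c) cell = .cell p) {b : Bool} {q : ℕ} {g : QF}
    (hq : F.item (b :: path (.fresh t l c)) = some (q, g)) :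
    ∃ t', .fresh t' (line b) (.fresh t l c) ∈ (rules.graphAt ρ x (r + 2)).nodes ∧
      (rules.graphAt ρ x (r + 2)).edge (.fresh t' (line b) (.fresh t l c)) cell = .cell q := by
  have hB := base_graphAt (x := x) ρ r
  have hI' := treeInv_graphAt ρ hI r
  have hseg := item_seg hI.seg hp
  have hdep := item_depth hp
  have hvars := item_varsLt hI.varsLt hp
  have hrgt : (rules.graphAt ρ x r).edge (.cell p) rgt ≠ .origin := by
    cases f with
    | var i => simp [item, hp] at hq
    | un s hs f =>
      simp only [depth] at hdep
      rw [rgt_un_done hT hseg (by omega) (by omega)]; simp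
    | bin s hs f g' =>
      simp only [depth] at hdep
      rw [rgt_bin_done hT hI.head hseg hvars.1 (by omega) (by omega)]; simp
  have hint : ∃ s ∈ [QSym.all, .ex, .not, .and, .or], x[p]? = some s := by
    cases f with
    | var i => simp [item, hp] at hq
    | un s hs f =>
      refine ⟨s, ?_, hseg.get_un⟩
      rcases QSym.isUn_cases hs with rfl | rfl | rfl <;> simp
    | bin s hs f g' =>
      refine ⟨s, ?_, hseg.get_bin⟩
      rcases QSym.isBin_cases hs with rfl | rfl <;> simp
  obtain ⟨t', h1, h2⟩ : ∃ t', (rules.graphAt ρ x (r + 1)).edge (.fresh t l c) (ch b) =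
      .fresh t' (line b) (.fresh t l c) ∧
      .fresh t' (line b) (.fresh t l c) ∈ (rules.graphAt ρ x (r + 1)).nodes := by
    rcases hI'.child t l c hu b with h1 | ⟨t', h1, h2⟩
    · have hf : rules.Fires (rules.graphAt ρ x r) (sprout b) (.fresh t l c) :=
        ⟨hu, (live_holds hB hu).2 (hT r (by omega)),
          (hI'.sprout_iff hI hB hu hp).2 ⟨⟨hc, hint⟩, hrgt, h1⟩⟩
      exact ⟨5 + 5 * r + 1, RuleSet.step_eq (rules.round_graphAt ρ x r) hu
        ⟨_, proposed_ch.2 ⟨hf, rfl⟩⟩ fun y hy => (proposed_ch.1 hy).2,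
        ((rules.round_graphAt ρ x r).nodes _).2 (.inr (born_iff.2 ⟨b, _, hf, rfl⟩))⟩
    · refine ⟨t', ?_, rules.mem_of_le ρ x (Nat.le_succ r) h2⟩
      rw [ch_stable hB (rules.round_graphAt ρ x r) hu (by rw [h1]; exact fresh_fresh_ne), h1]
  have hB1 := base_graphAt (x := x) ρ (r + 1)
  refine ⟨t', rules.mem_of_le ρ x (Nat.le_succ (r + 1)) h2,
    RuleSet.step_eq (rules.round_graphAt ρ x (r + 1)) h2 ?_ fun y hy =>
      (treeInv_graphAt ρ hI (r + 1)).of_proposed_cell hI hB1 (cellInv_graphAt ρ hI.head _) h2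
        (by rw [path_child]; exact hq) hy⟩
  have hch : (isChild b).Holds (rules.graphAt ρ x (r + 1)) (.fresh t' (line b) (.fresh t l c)) := by
    simp [isChild, PathExpr.Holds, PGraph.follow, hB1.fresh_up _ _ _ h2, h1, hB1.o _ h2]
  cases b
  · exact exists_proposed hB1 h2 (b := isChild false) (z := [up, cell, .e]) (by simp [rules]) hch
      (hT _ (by omega))
  · exact exists_proposed hB1 h2 (b := isChild true) (z := [up, cell, rgt]) (by simp [rules]) hch
      (hT _ (by omega))

theorem exists_proposed_v {r : ℕ} (hl : Live x (rules.graphAt ρ x r)) {u : Node}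
    (hu : u ∈ (rules.graphAt ρ x r).nodes)
    (h : valTrue.Holds (rules.graphAt ρ x r) u ∨ valFalse.Holds (rules.graphAt ρ x r) u) :
    ∃ y, rules.Proposed (5 + 5 * r) (rules.graphAt ρ x r) u .v y := by
  rcases h with h | h
  · exact exists_proposed (base_graphAt ρ r) hu (b := valTrue) (z := [.o]) (by simp [rules]) h hl
  · exact exists_proposed (base_graphAt ρ r) hu (b := valFalse) (z := []) (by simp [rules]) h hl

/-- A node computes its value from the values of its children. -/
theorem known_of_children (hI : Input x F n) {r : ℕ}
    (hl : Live x (rules.graphAt ρ x r)) {t l : ℕ} {c : Node}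
    (hu : .fresh t l c ∈ (rules.graphAt ρ x r).nodes) {p : ℕ} {f : QF}
    (hp : F.item (path (.fresh t l c)) = some (p, f))
    (hc : (rules.graphAt ρ x r).edge (.fresh t l c) cell = .cell p)
    {g : Bool → QF} {q : Bool → ℕ}
    (hq : ∀ b, F.item (b :: path (.fresh t l c)) = some (q b, g b))
    (hch : ∀ b, ∃ t', .fresh t' (line b) (.fresh t l c) ∈ (rules.graphAt ρ x r).nodes ∧
      Known (rules.graphAt ρ x r) (.fresh t' (line b) (.fresh t l c)) (g b)) :
    Known (rules.graphAt ρ x (r + 1)) (.fresh t l c) f := by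
  have hB := base_graphAt (x := x) ρ r
  have hI' := treeInv_graphAt ρ hI r
  have hseg := item_seg hI.seg hp
  have key : ∀ b, (childTrue b).Holds (rules.graphAt ρ x r) (.fresh t l c) ∨
      (childFalse b).Holds (rules.graphAt ρ x r) (.fresh t l c) := by
    intro b
    obtain ⟨t', hm, hk⟩ := hch b
    have he : (rules.graphAt ρ x r).edge (.fresh t l c) (ch b) =
        .fresh t' (line b) (.fresh t l c) := by
      rcases hI'.parent _ _ _ hm with h1 | ⟨b', h1, -, -, h2, -⟩
      · cases b <;> simp [RuleSet.root, line] at h1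
      · rw [line_inj.1 h1]; rw [← h1]; rw [line_inj.1 h1] at h2 ⊢; exact h2
    simp only [childTrue, childFalse, PathExpr.Holds, PGraph.follow, List.foldl, he,
      hB.fresh_up _ _ _ hu, hB.o _ hu]
    unfold Known at hk
    split_ifs at hk with h1
    · exact .inl ⟨hk, fresh_fresh_ne⟩
    · exact .inr ⟨hk, fresh_fresh_ne⟩
  refine known_of_proposed hI hu hp (.inr (exists_proposed_v hl hu ?_))
  have hat : ∀ {L}, (∃ s ∈ L, x[p]? = some s) →
      (at' L).Holds (rules.graphAt ρ x r) (.fresh t l c) :=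
    fun h => (hI'.at_iff hI hB hu hp).2 ⟨hc, h⟩
  simp only [valTrue, valFalse, anyOf_holds, List.mem_cons, List.not_mem_nil, or_false,
    exists_eq_or_imp, exists_eq_left]
  have k0 := key false
  have k1 := key true
  have case_and : (at' [.all, .and]).Holds (rules.graphAt ρ x r) (.fresh t l c) →
      (PathExpr.and (at' [.all, .and]) (.and (childTrue false) (childTrue true))).Holds
        (rules.graphAt ρ x r) (.fresh t l c) ∨
      (PathExpr.and (at' [.all, .and]) (.or (childFalse false) (childFalse true))).Holds
        (rules.graphAt ρ x r) (.fresh t l c) := by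
    intro h; simp only [PathExpr.Holds]; tauto
  have case_or : (at' [.ex, .or]).Holds (rules.graphAt ρ x r) (.fresh t l c) →
      (PathExpr.and (at' [.ex, .or]) (.or (childTrue false) (childTrue true))).Holds
        (rules.graphAt ρ x r) (.fresh t l c) ∨
      (PathExpr.and (at' [.ex, .or]) (.and (childFalse false) (childFalse true))).Holds
        (rules.graphAt ρ x r) (.fresh t l c) := by
    intro h; simp only [PathExpr.Holds]; tauto
  have case_not : (at' [.not]).Holds (rules.graphAt ρ x r) (.fresh t l c) →
      (PathExpr.and (at' [.not]) (childFalse false)).Holds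
        (rules.graphAt ρ x r) (.fresh t l c) ∨
      (PathExpr.and (at' [.not]) (childTrue false)).Holds
        (rules.graphAt ρ x r) (.fresh t l c) := by
    intro h; simp only [PathExpr.Holds]; tauto
  have hL : (∃ s ∈ [QSym.all, .and], x[p]? = some s) ∨ (∃ s ∈ [QSym.ex, .or], x[p]? = some s) ∨
      (∃ s ∈ [QSym.not], x[p]? = some s) := by
    cases f with
    | var i => have := hq true; simp [item, hp] at this
    | un s hs f =>
      have := hseg.get_un
      rcases QSym.isUn_cases hs with rfl | rfl | rfl <;> simp [this]
    | bin s hs f g' =>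
      have := hseg.get_bin
      rcases QSym.isBin_cases hs with rfl | rfl <;> simp [this]
  rcases hL with h | h | h
  · exact (case_and (hat h)).imp .inl .inl
  · exact (case_or (hat h)).imp (fun h => .inr (.inl h)) (fun h => .inr (.inl h))
  · exact (case_not (hat h)).imp (fun h => .inr (.inr (.inl h))) (fun h => .inr (.inr (.inl h)))

/-- The walk from a variable to its quantifier succeeds. -/
theorem known_of_walk (hT : ∀ r < T, Live x (rules.graphAt ρ x r)) (hI : Input x F n) {t l : ℕ}
    {c : Node} {p i : ℕ} (hp : F.item (path (.fresh t l c)) = some (p, .var i)) {k r : ℕ}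
    (hr : r + k + 1 ≤ T) (hr0 : n + 2 * F.depth ≤ r) (hr1 : n + 1 ≤ r)
    (hu : .fresh t l c ∈ (rules.graphAt ρ x r).nodes)
    (hc : (rules.graphAt ρ x r).edge (.fresh t l c) cell = .cell p)
    (hk : ∀ t' l' c', (rules.graphAt ρ x r).edge (.fresh t l c) wk = .fresh t' l' c' →
      (path (.fresh t l c)).length = i + 1 ∨ (path (.fresh t' l' c')).length ≤ i + 1 + k) :
    Known (rules.graphAt ρ x (r + k + 1)) (.fresh t l c) (.var i) := by
  -- `k` bounds the number of moves left: every unsuccessful comparison takes `wk` one level up.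
  induction k using Nat.strong_induction_on generalizing r with | _ k ih
  have hB := base_graphAt (x := x) ρ r
  have hI' := treeInv_graphAt ρ hI r
  have hC := cellInv_graphAt ρ hI.head r
  have hseg := item_seg hI.seg hp
  obtain ⟨hi, hn⟩ := hI.length_of_var hp
  have hready : varReady.Holds (rules.graphAt ρ x r) (.fresh t l c) := by
    refine ⟨(hI'.at_iff hI hB hu hp).2 ⟨hc, .var, by simp, hseg.get_var⟩, ?_⟩
    have h1 := lst_tick_done hT hseg (j := 0) (k := i) (by omega) (r := r) (by omega) (by omega)
    have h2 := qv_done hT hI.head hseg le_rfl (r := r) (by omega) (by omega)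
    rw [add_zero] at h1
    simp [PathExpr.Holds, PGraph.follow, hc, h1, h2, hB.o _ hu]
  obtain ⟨g0, g1⟩ := hI'.var_guards hI hB hC hu hp hready
  have hne : path (.fresh t l c) ≠ [] := by
    intro h0; rw [h0] at hn; simp at hn; omega
  have hval : ∀ b, (varVal b).Holds (rules.graphAt ρ x r) (.fresh t l c) →
      Known (rules.graphAt ρ x (r + k + 1)) (.fresh t l c) (.var i) := by
    intro b hb
    refine known_mono hI (r := r + 1) (by omega) (rules.mem_of_le ρ x (Nat.le_succ r) hu) hp
      (known_of_proposed hI hu hp (.inr (exists_proposed_v (hT r (by omega)) hu ?_)))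
    simp only [valTrue, valFalse, anyOf_holds, List.mem_cons, List.not_mem_nil, or_false,
      exists_eq_or_imp, exists_eq_left]
    cases b
    · exact .inr (.inr (.inr (.inr hb)))
    · exact .inl (.inr (.inr (.inr hb)))
  by_cases hlen : (path (.fresh t l c)).length = i + 1
  · rcases hI'.parent t l c hu with h1 | ⟨b, -, -, -, h2, -⟩
    · rw [h1, path_root] at hne; exact absurd rfl hne
    · exact hval b ⟨hready, .inl ⟨g0.2 hlen, by
        simpa [PathExpr.Holds, PGraph.follow, hB.fresh_up _ _ _ hu] using h2⟩⟩
  obtain ⟨t1, l1, c1, hw, hm, hsuf, hle⟩ := (hI'.walk t l c hu p i hp).resolve_left hlen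
  have hne1 : path (.fresh t1 l1 c1) ≠ [] := by
    intro h0; rw [h0] at hle; simp at hle
  have h0 : ¬ found0.Holds (rules.graphAt ρ x r) (.fresh t l c) := fun h => hlen (g0.1 h)
  by_cases hlen1 : (path (.fresh t1 l1 c1)).length = i + 1
  · rcases hI'.parent t1 l1 c1 hm with h1 | ⟨b, -, -, -, h2, -⟩
    · rw [h1, path_root] at hne1; exact absurd rfl hne1
    · exact hval b ⟨hready, .inr ⟨⟨h0, (g1 _ _ _ hw hm hne1).2 hlen1⟩, by
        simpa [PathExpr.Holds, PGraph.follow, hw, hB.fresh_up _ _ _ hm] using h2⟩⟩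
  have h1 : ¬ found.Holds (rules.graphAt ρ x r) (.fresh t l c) := fun h =>
    hlen1 ((g1 _ _ _ hw hm hne1).1 h)
  obtain ⟨t1', l1', c1', hw', -, t2, l2, c2, rfl, hm2, h4, -, -, h7⟩ :=
    hI'.wk_step hI hB hC hu hp hready h0 h1
  rw [hw'] at hw
  simp only [Node.fresh.injEq] at hw
  obtain ⟨rfl, rfl, rfl⟩ := hw
  have hk' := (hk _ _ _ hw').resolve_left hlen
  rcases k with _ | k
  · omega
  · have := ih k (by omega) (r := r + 1) (by omega) (by omega) (by omega)
      (rules.mem_of_le ρ x (Nat.le_succ r) hu)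
      (cell_persists hI (Nat.le_succ r) hu hp hc) ?_
    · rwa [show r + (k + 1) + 1 = r + 1 + k + 1 by omega]
    · intro t3 l3 c3 h3
      right
      have : (rules.graphAt ρ x (r + 1)).edge (.fresh t l c) wk = .fresh t2 l2 c2 := by
        refine RuleSet.step_eq (rules.round_graphAt ρ x r) hu ?_ fun y hy => ?_
        · exact exists_proposed hB hu
            (b := .and varReady (.and (.not found0) (.not found))) (z := [wk, up])
            (by simp [rules]) ⟨hready, h0, h1⟩ (hT r (by omega))
        · rw [(proposed_wk hy).2.2.2.2, h4]
      rw [this] at h3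
      rw [← h3]
      omega

/-- Every node of the evaluation tree gets its value. -/
theorem known_of_cell (hT : ∀ r < T, Live x (rules.graphAt ρ x r)) (hI : Input x F n) {f : QF}
    {t l : ℕ} {c : Node} {p : ℕ} (hp : F.item (path (.fresh t l c)) = some (p, f)) {r : ℕ}
    (hr : r + 3 * f.depth + F.depth + 1 ≤ T) (hr0 : n + 2 * F.depth ≤ r) (hr1 : n + 1 ≤ r)
    (hu : .fresh t l c ∈ (rules.graphAt ρ x r).nodes)
    (hc : (rules.graphAt ρ x r).edge (.fresh t l c) cell = .cell p) :
    Known (rules.graphAt ρ x (r + 3 * f.depth + F.depth + 1)) (.fresh t l c) f := by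
  induction f generalizing t l c p r with
  | var i =>
    have hd := item_depth hp
    simp only [depth, mul_zero, add_zero] at hd hr ⊢
    -- The address of a leaf is no longer than the depth of the tree, so `F.depth` moves are enough.
    refine known_of_walk hT hI hp (k := F.depth) (by omega) hr0 hr1 hu hc fun t' l' c' hw => ?_
    rcases (treeInv_graphAt ρ hI r).walk t l c hu p i hp with h | ⟨t1, l1, c1, h1, -, h2, -⟩
    · exact .inl h
    · rw [h1] at hw
      rw [← hw]
      right
      have := h2.length_le
      omega
  | un s hs f ih =>
    simp only [depth] at hr ⊢
    have hq := item_un hp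
    -- Three rounds per level: one creates the child, one gives it its cell, and one combines the
    -- values on the way back.
    rw [show r + 3 * (f.depth + 1) + F.depth + 1 = (r + 2 + 3 * f.depth + F.depth + 1) + 1 by omega]
    refine known_of_children hI (hT _ (by omega)) (rules.mem_of_le ρ x (by omega) hu) hp
      (cell_persists hI (by omega) hu hp hc) (g := fun _ => f) (q := fun _ => p + 1) hq fun b => ?_
    obtain ⟨t', h1, h2⟩ := exists_child hT hI (r := r) (by omega) hr0 hu hp hc (hq b)
    exact ⟨t', rules.mem_of_le ρ x (by omega) h1,
      ih (by rw [path_child]; exact hq b) (by omega) (by omega) (by omega) h1 h2⟩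
  | bin s hs f g ihf ihg =>
    simp only [depth] at hr ⊢
    have hq : ∀ b : Bool, F.item (b :: path (.fresh t l c)) =
        some (if b then p + 1 + f.encode.length else p + 1, if b then g else f) := by
      intro b; rw [item_bin hp]; cases b <;> rfl
    rw [show r + 3 * (max f.depth g.depth + 1) + F.depth + 1 =
      (r + 2 + 3 * max f.depth g.depth + F.depth + 1) + 1 by omega]
    refine known_of_children hI (hT _ (by omega)) (rules.mem_of_le ρ x (by omega) hu) hp
      (cell_persists hI (by omega) hu hp hc) (g := fun b => if b then g else f)
      (q := fun b => if b then p + 1 + f.encode.length else p + 1) hq fun b => ?_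
    obtain ⟨t', h1, h2⟩ := exists_child hT hI (r := r) (by omega) hr0 hu hp hc (hq b)
    have hpc : F.item (path (.fresh t' (line b) (.fresh t l c))) = some _ :=
      (by rw [path_child]; exact hq b)
    refine ⟨t', rules.mem_of_le ρ x (by omega) h1, ?_⟩
    cases b
    · exact known_mono hI (r := r + 2 + 3 * f.depth + F.depth + 1) (by omega)
        (rules.mem_of_le ρ x (by omega) h1) hpc
        (ihf hpc (by omega) (by omega) (by omega) h1 h2)
    · exact known_mono hI (r := r + 2 + 3 * g.depth + F.depth + 1) (by omega)
        (rules.mem_of_le ρ x (by omega) h1) hpc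
        (ihg hpc (by omega) (by omega) (by omega) h1 h2)

theorem le_depth (hI : Input x F n) : n ≤ F.depth := by
  have h : ∀ n (f : QF), f.Prefixed n → n ≤ f.depth := by
    intro n
    induction n with
    | zero => simp
    | succ n ih =>
      intro f hf
      cases f with
      | un s hs f => have := ih f hf; simp only [depth]; omega
      | _ => exact hf.elim
  exact h n F hI.prefixed

/-- The machine cannot stay alive longer than progress allows. Once `live` fails, `.v` of the center
has left its default, and by soundness it then shows the value. -/
theorem decidesWithin_eval (hI : Input x F n) (ρ : Resolution (Dir QSym 10)) :
    rules.machine.DecidesWithin ρ x (60 * F.depth) (F.eval [] = true) := by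
  have hle := le_depth hI
  have hpos := hI.n_pos
  have hr := hI.root_eq
  have hprt : F.item (path (.fresh 0 0 (.cell (x.length - 1)))) = some (0, F) := by
    rw [← hr, path_root]; rfl
  have hpath : path (.fresh 0 0 (.cell (x.length - 1))) = [] := by rw [← hr, path_root]
  have hup : ∀ r, (rules.graphAt ρ x r).edge (RuleSet.root x) up = .cell (x.length - 1) := by
    intro r
    have hm := (base_graphAt (x := x) ρ r).root_mem
    rw [hr] at hm ⊢
    exact (base_graphAt (x := x) ρ r).fresh_up _ _ _ hm
  -- Since `n ≤ F.depth`, all pointers of cells are ready after `4 * F.depth` rounds. The tree needs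
  -- at most `3 * F.depth` more for its levels and `F.depth + 1` for the leaves.
  obtain ⟨R, hR, hnl⟩ : ∃ R ≤ 8 * F.depth + 2, ¬ Live x (rules.graphAt ρ x R) := by
    by_contra hcon
    push Not at hcon
    have hT : ∀ r < 8 * F.depth + 2, Live x (rules.graphAt ρ x r) := fun r hr => hcon r hr.le
    have hm := (base_graphAt (x := x) ρ (4 * F.depth)).root_mem
    have hc := root_cell hT hI (r := 4 * F.depth - 2) (by omega)
    rw [show 4 * F.depth - 2 + 2 = 4 * F.depth by omega] at hc
    rw [hr] at hm hc
    have hk := known_of_cell hT hI hprt (r := 4 * F.depth) (by omega) (by omega) (by omega) hm hc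
    have hl := hcon (4 * F.depth + 3 * F.depth + F.depth + 1) (by omega)
    rw [Live, hup, hr, hk] at hl
    -- A known value is the origin or the center, never the cell to which `up` leads.
    split_ifs at hl
  have hB := base_graphAt (x := x) ρ R
  have hm := hB.root_mem
  rw [hr] at hm
  have hk : Known (rules.graphAt ρ x R) (.fresh 0 0 (.cell (x.length - 1))) F := by
    rcases (treeInv_graphAt ρ hI R).val _ _ _ hm _ _ hprt with h | h
    · exact absurd (by rw [Live, hup, hr, h]) hnl
    · exact h
  unfold Known at hk
  rw [hpath] at hk
  -- Five steps for the prologue and five for each of at most `8 * F.depth + 2` rounds; `60 *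
  -- F.depth` suffices because the depth is positive.
  refine rules.decidesWithin ρ x R _ _ (by omega)
    (fun u hu hl => hnl ((live_holds hB hu).1 hl)) (fun h => ?_) fun h => ?_
  · rw [hr, hk, if_pos h]
  · rw [hr, hk, if_neg h]

end Progress

theorem input_encode (φ : QBF) : Input φ.encode φ.toQF φ.n where
  seg := ⟨[], [], by simp [φ.encode_toQF], rfl, by simp⟩
  varsLt := φ.varsLt_toQF
  prefixed := φ.prefixed_toQF
  n_pos := φ.n_pos
  head := by
    have h := φ.n_pos
    obtain ⟨n, q, f⟩ := φ
    obtain ⟨n, rfl⟩ := Nat.exists_eq_succ_of_ne_zero h.ne'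
    simp only [QBF.encode, Nat.succ_eq_add_one, List.ofFn_succ, List.cons_append,
      List.getElem?_cons_zero]
    cases q 0 <;> simp [Quantifier.toQSym]

theorem decidesWithin_isTrue (φ : QBF) (ρ : Resolution (Dir QSym 10)) :
    rules.machine.DecidesWithin ρ φ.encode (60 * (φ.n + φ.matrix.depth)) φ.IsTrue := by
  have h := decidesWithin_eval (input_encode φ) ρ
  rwa [φ.depth_toQF, show (φ.toQF.eval [] = true) = φ.IsTrue from propext φ.eval_toQF] at h

end QBFMachine

/-! ## Window systems -/

universe u

/-- A rewriting system on words: a word is rewritten with a guess `σ` that is compatible with all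
of its letters, each letter being replaced by a function of itself and its two neighbours. -/
structure WindowSystem (α : Type u) where
  Letter : Type u
  Guess : Type u
  finite_letter : Finite Letter
  finite_guess : Finite Guess
  /-- The letter at position `0` of the initial word. -/
  first : Letter
  /-- The letters at the positions of the input. -/
  input : α → Letter
  /-- The letter at the positions after the input. -/
  rest : Letter
  Compat : Guess → Letter → Prop
  out : Guess → Option Letter → Letter → Option Letter → Letter
  Acc : Guess → Prop

namespace WindowSystem

variable {α : Type u} (Y : WindowSystem α)

/-- The word `f (m - 1), …, f 0`. -/
def revWord {β : Type*} (f : ℕ → β) : ℕ → List β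
  | 0 => []
  | m + 1 => f m :: revWord f m

theorem length_revWord {β : Type*} (f : ℕ → β) (m : ℕ) : (revWord f m).length = m := by
  induction m with
  | zero => rfl
  | succ m ih => simp [revWord, ih]

theorem mem_revWord {β : Type*} {f : ℕ → β} {m : ℕ} {b : β} :
    b ∈ revWord f m ↔ ∃ j < m, f j = b := by
  induction m with
  | zero => simp [revWord]
  | succ m ih =>
    simp only [revWord, List.mem_cons, ih]
    constructor
    · rintro (rfl | ⟨j, hj, rfl⟩)
      · exact ⟨m, by omega, rfl⟩
      · exact ⟨j, by omega, rfl⟩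
    · rintro ⟨j, hj, rfl⟩
      rcases Nat.lt_succ_iff_lt_or_eq.1 hj with h | rfl
      · exact .inr ⟨j, h, rfl⟩
      · exact .inl rfl

theorem revWord_congr {β : Type*} {f g : ℕ → β} {m : ℕ} (h : ∀ j < m, f j = g j) :
    revWord f m = revWord g m := by
  induction m with
  | zero => rfl
  | succ m ih => rw [revWord, revWord, h m (by omega), ih fun j hj => h j (by omega)]

/-- The guess is compatible with all letters. -/
def Ok (σ : Y.Guess) (w : List Y.Letter) : Prop := ∀ b ∈ w, Y.Compat σ b

theorem ok_revWord {σ : Y.Guess} {f : ℕ → Y.Letter} {m : ℕ} :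
    Y.Ok σ (revWord f m) ↔ ∀ j < m, Y.Compat σ (f j) := by
  constructor
  · exact fun h j hj => h _ (mem_revWord.2 ⟨j, hj, rfl⟩)
  · rintro h _ hb
    obtain ⟨j, hj, rfl⟩ := mem_revWord.1 hb
    exact h j hj

/-- All but the last letter of the word that a word is rewritten to (words are reversed). -/
def shift (σ : Y.Guess) : List Y.Letter → List Y.Letter
  | [] => []
  | [_] => []
  -- A letter can be rewritten only when its right neighbour is known, so the result lags one letter
  -- behind. In this form the image of a word is the image of its prefix with one more letter.
  | b :: a :: w => Y.out σ w.head? a (some b) :: shift σ (a :: w)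

/-- The word that a word is rewritten to (words are reversed). -/
def next (σ : Y.Guess) : List Y.Letter → List Y.Letter
  | [] => []
  | a :: w => Y.out σ w.head? a none :: Y.shift σ (a :: w)

theorem length_shift (σ : Y.Guess) (w : List Y.Letter) : (Y.shift σ w).length = w.length - 1 := by
  induction w with
  | nil => rfl
  | cons b w ih =>
    cases w with
    | nil => rfl
    | cons a w => simp [shift, ih]

/-- The left neighbour of position `j`. -/
def leftOf {β : Type*} (f : ℕ → β) (j : ℕ) : Option β := if j = 0 then none else some (f (j - 1))

theorem head?_revWord {β : Type*} (f : ℕ → β) (m : ℕ) : (revWord f m).head? = leftOf f m := by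
  cases m <;> simp [revWord, leftOf]

theorem shift_revWord (σ : Y.Guess) (f : ℕ → Y.Letter) (m : ℕ) :
    Y.shift σ (revWord f (m + 1)) =
      revWord (fun j => Y.out σ (leftOf f j) (f j) (some (f (j + 1)))) m := by
  induction m with
  | zero => rfl
  | succ m ih =>
    rw [revWord, revWord, shift, head?_revWord, ← revWord, ih]
    rfl

theorem next_revWord (σ : Y.Guess) (f : ℕ → Y.Letter) (m : ℕ) :
    Y.next σ (revWord f m) = revWord (fun j => Y.out σ (leftOf f j) (f j)
      (if j + 1 < m then some (f (j + 1)) else none)) m := by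
  cases m with
  | zero => rfl
  | succ m =>
    rw [revWord, next, head?_revWord, ← revWord, shift_revWord, revWord]
    simp only [lt_irrefl, if_false, List.cons.injEq, true_and]
    exact revWord_congr fun j hj => by rw [if_pos (by omega)]

/-- The letter at position `j` of the initial word for the input `x`. -/
def initLetter (x : List α) : ℕ → Y.Letter
  | 0 => Y.first
  | j + 1 => match x[j]? with
    | some a => Y.input a
    | none => Y.rest

/-- The words `w i` of length `s` are those obtained from the initial word for `x` by rewriting, and
`σ i` is the only guess compatible with `w i`. -/
structure IsRun (x : List α) (s : ℕ) (w : ℕ → List Y.Letter) (σ : ℕ → Y.Guess) : Prop where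
  length : ∀ i, (w i).length = s
  zero : w 0 = revWord (Y.initLetter x) s
  ok : ∀ i τ, Y.Ok τ (w i) ↔ τ = σ i
  succ : ∀ i, w (i + 1) = Y.next (σ i) (w i)

variable {Y} in
/-- What a run reaches, it reaches within `|Γ| ^ s` steps. -/
theorem IsRun.exists_le {x : List α} {s : ℕ} {w : ℕ → List Y.Letter} {σ : ℕ → Y.Guess}
    (h : Y.IsRun x s w σ) (P : Y.Guess → Prop) (hP : ∃ t, P (σ t)) :
    ∃ t ≤ Nat.card Y.Letter ^ s, P (σ t) := by
  classical
  have := Y.finite_letter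
  let t := Nat.find hP
  have ht : P (σ t) := Nat.find_spec hP
  refine ⟨t, ?_, ht⟩
  by_contra hlt
  push Not at hlt
  have := Fintype.ofFinite Y.Letter
  -- If the first success came later than `|Γ| ^ s`, there would be more moments up to it than words
  -- of length `s`.
  have hcard : Fintype.card (List.Vector Y.Letter s) < Fintype.card (Fin (t + 1)) := by
    rw [card_vector, Fintype.card_fin, ← Nat.card_eq_fintype_card]; omega
  let g : Fin (t + 1) → List.Vector Y.Letter s := fun i => ⟨w i, h.length i⟩
  obtain ⟨i, j, hij, heq⟩ := Fintype.exists_ne_map_eq_of_card_lt g hcard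
  -- A word determines its only compatible guess and hence its successor. After a repetition the run
  -- from `i` copies the run from `j`, and the first success would have occurred `j - i` steps
  -- earlier.
  have key : ∀ i j : ℕ, i < j → j ≤ t → w i = w j → False := by
    intro i j hij hj heq
    have hs : ∀ d, w (i + d) = w (j + d) := by
      intro d
      induction d with
      | zero => exact heq
      | succ d ih =>
        have : σ (i + d) = σ (j + d) := (h.ok _ _).1 (ih ▸ (h.ok _ _).2 rfl)
        rw [← add_assoc, ← add_assoc, h.succ, h.succ, ih, this]
    have h1 := hs (t - j)
    rw [show j + (t - j) = t by omega] at h1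
    have h2 : σ (i + (t - j)) = σ t := (h.ok _ _).1 (h1 ▸ (h.ok _ _).2 rfl)
    exact Nat.find_min hP (m := i + (t - j)) (show _ < t by omega) (by rw [h2]; exact ht)
  have heq' : w i = w j := congrArg Subtype.val heq
  rcases lt_or_gt_of_ne (fun hh => hij (Fin.ext hh) : (i : ℕ) ≠ j) with hlt' | hlt'
  · exact key i j hlt' (by omega) heq'
  · exact key j i hlt' (by omega) heq'.symm

end WindowSystem

/-! ### The window system of a Turing machine -/

instance {α : Type*} [Finite α] : Finite (InSym α) :=
  Finite.of_surjective
    (fun o : Option (Option α) => match o with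
      | none => InSym.leftEnd
      | some none => .rightEnd
      | some (some a) => .letter a)
    (by
      rintro (_ | a | _)
      · exact ⟨none, rfl⟩
      · exact ⟨some (some a), rfl⟩
      · exact ⟨some none, rfl⟩)

namespace OfflineTM

variable {α : Type u} (T : OfflineTM α)

/-- One position of all tapes, with the state and marks for the positions of the heads. -/
structure Col where
  state : T.State
  inSym : InSym α
  inMark : Prop
  sym : Fin T.k → T.Sym
  mark : Fin T.k → Prop

/-- The arguments of the transition function. -/
abbrev View := T.State × InSym α × (Fin T.k → T.Sym)

/-- Is there a head of an ordinary tape here after a move, given the presence of the head here and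
at the two neighbouring positions before the move? -/
def markAfter (l : Option Prop) (c : Prop) (r : Option Prop) : Move → Prop
  | .left => r.getD False ∨ (l = none ∧ c)
  | .stay => c
  | .right => l.getD False

variable {T} in
/-- The effect of an action on one position. -/
noncomputable def Col.out (σ : T.View) (l : Option T.Col) (c : T.Col) (r : Option T.Col) : T.Col :=
  open Classical in
  match T.δ σ.1 σ.2.1 σ.2.2 with
  | none => c
  | some (q, m, f) =>
    { state := q
      inSym := c.inSym
      inMark := match m with
        -- Unlike the work heads, the input head stays put on the right end marker. All later
        -- positions of the word carry the same marker, but the head never gets there.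
        | .right => (∃ l' ∈ l, l'.inMark ∧ l'.inSym ≠ .rightEnd) ∨ (c.inMark ∧ c.inSym = .rightEnd)
        | m => markAfter (l.map Col.inMark) c.inMark (r.map Col.inMark) m
      sym := fun i => if c.mark i then (f i).1 else c.sym i
      mark := fun i => markAfter (l.map (Col.mark · i)) (c.mark i) (r.map (Col.mark · i)) (f i).2 }

/-- The position `j` of all tapes of a configuration. -/
def col (w : List α) (c : T.Cfg) (j : ℕ) : T.Col where
  state := c.state
  inSym := inputCell w j
  inMark := c.inPos = j
  sym := fun i => c.tape i j
  mark := fun i => c.head i = j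

/-- What the transition function sees in a configuration. -/
def view (w : List α) (c : T.Cfg) : T.View :=
  (c.state, inputCell w c.inPos, fun i => c.tape i (c.head i))

instance [Finite α] : Finite T.Col := by
  have := T.finite_state
  have := T.finite_sym
  refine Finite.of_injective (β := T.State × InSym α × Prop × (Fin T.k → T.Sym) × (Fin T.k → Prop))
    (fun c => (c.state, c.inSym, c.inMark, c.sym, c.mark)) ?_
  rintro ⟨⟩ ⟨⟩ h
  simpa using h

instance [Finite α] : Finite T.View := by
  have := T.finite_state
  have := T.finite_sym
  exact inferInstance

/-- The window system that simulates a Turing machine. -/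
noncomputable def window [Finite α] : WindowSystem α where
  Letter := T.Col
  Guess := T.View
  finite_letter := inferInstance
  finite_guess := inferInstance
  first := ⟨T.start, .leftEnd, True, fun _ => T.blank, fun _ => True⟩
  input a := ⟨T.start, .letter a, False, fun _ => T.blank, fun _ => False⟩
  rest := ⟨T.start, .rightEnd, False, fun _ => T.blank, fun _ => False⟩
  Compat σ c := c.state = σ.1 ∧ (c.inMark → c.inSym = σ.2.1) ∧ ∀ i, c.mark i → c.sym i = σ.2.2 i
  out := Col.out
  Acc σ := T.δ σ.1 σ.2.1 σ.2.2 = none ∧ σ.1 ∈ T.accepting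

variable {T} in
theorem markAfter_iff {s h j : ℕ} (hh : h < s) (hj : j < s) (m : Move) {f : ℕ → Prop}
    (hf : ∀ j, f j ↔ h = j) :
    markAfter (WindowSystem.leftOf f j) (f j) (if j + 1 < s then some (f (j + 1)) else none) m ↔
      moveHead m h = j := by
  cases m with
  | left =>
    simp only [markAfter, moveHead, WindowSystem.leftOf, hf]
    split_ifs with h1 h2 h2 <;> simp [h2] <;> omega
  | stay => simp [markAfter, moveHead, hf]
  | right =>
    simp only [markAfter, moveHead, WindowSystem.leftOf]
    split_ifs with h2 <;> simp [hf] <;> omega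

theorem inputCell_eq_rightEnd {w : List α} {j : ℕ} :
    inputCell w j = .rightEnd ↔ w.length < j := by
  cases j with
  | zero => simp [inputCell]
  | succ j =>
    simp only [inputCell]
    rcases h : w[j]? with _ | a
    · rw [List.getElem?_eq_none_iff] at h
      simp; omega
    · obtain ⟨h, -⟩ := List.getElem?_eq_some_iff.1 h
      simp; omega

/-- The view `σ` contains everything that the transition function reads. Given `σ`, a column after
the step depends only on the column and its two neighbours. -/
theorem col_step {w : List α} {c : T.Cfg} {s j : ℕ} (hw : w.length + 1 < s)
    (hin : c.inPos ≤ w.length + 1) (hh : ∀ i, c.head i < s) (hj : j < s) :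
    Col.out (T.view w c) (WindowSystem.leftOf (T.col w c) j) (T.col w c j)
      (if j + 1 < s then some (T.col w c (j + 1)) else none) = T.col w (T.step w c) j := by
  have hmap : ∀ (g : T.Col → Prop), (WindowSystem.leftOf (T.col w c) j).map g =
      WindowSystem.leftOf (fun j => g (T.col w c j)) j := by
    intro g; unfold WindowSystem.leftOf; split_ifs <;> rfl
  have hmap' : ∀ (g : T.Col → Prop), (if j + 1 < s then some (T.col w c (j + 1)) else none).map g =
      if j + 1 < s then some (g (T.col w c (j + 1))) else none := by
    intro g; split_ifs <;> rfl
  have hact : T.action w c = T.δ (T.view w c).1 (T.view w c).2.1 (T.view w c).2.2 := rfl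
  unfold Col.out step
  rw [hact]
  rcases T.δ (T.view w c).1 (T.view w c).2.1 (T.view w c).2.2 with _ | ⟨q, m, f⟩
  · rfl
  simp only [hmap, hmap']
  simp only [col, Col.mk.injEq, true_and]
  refine ⟨propext ?_, ?_, ?_⟩
  · cases m with
    | left =>
      have := markAfter_iff (s := s) (h := c.inPos) (j := j) (by omega) hj .left
        (f := fun j => c.inPos = j) (fun _ => Iff.rfl)
      simp only [moveHead] at this ⊢
      rw [this]; omega
    | stay => simp [markAfter, moveHead]; omega
    | right =>
      simp only [WindowSystem.leftOf, moveHead]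
      split_ifs with h0
      · simp only [Option.mem_def, reduceCtorEq, false_and, exists_false, false_or,
          inputCell_eq_rightEnd]
        omega
      · simp only [col, Option.mem_def, Option.some.injEq, exists_eq_left', ne_eq,
          inputCell_eq_rightEnd]
        omega
  · funext i
    by_cases h : c.head i = j
    · subst h; simp
    · rw [Function.update_of_ne (Ne.symm h)]
      exact if_neg h
  · funext i
    exact propext (markAfter_iff (hh i) hj (f i).2 fun _ => Iff.rfl)

theorem inPos_run (w : List α) (t : ℕ) : (T.run w t).inPos ≤ w.length + 1 := by
  induction t with
  | zero => simp [run, init]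
  | succ t ih =>
    rw [run, Function.iterate_succ_apply', ← run, step]
    rcases T.action w (T.run w t) with _ | ⟨q, m, f⟩
    · exact ih
    · exact min_le_right _ _

/-- The compatible guess is unique: every column shows the state, and as every head stands on one of
the `s` positions, its mark forces the corresponding symbol of the guess. -/
theorem isRun_window [Finite α] {w : List α} {s : ℕ} (hw : w.length + 1 < s)
    (hs : T.UsesSpace w s) :
    T.window.IsRun w s (fun t => WindowSystem.revWord (T.col w (T.run w t)) s)
      (fun t => T.view w (T.run w t)) where
  length t := WindowSystem.length_revWord _ _
  zero := by
    refine WindowSystem.revWord_congr fun j _ => ?_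
    cases j with
    | zero => simp [col, WindowSystem.initLetter, window, run, init, inputCell]
    | succ j =>
      simp only [col, WindowSystem.initLetter, window, run, init, inputCell,
        Function.iterate_zero, id]
      rcases w[j]? with _ | a <;> simp
  ok t τ := by
    refine (T.window.ok_revWord (f := T.col w (T.run w t))).trans ?_
    constructor
    · intro h
      refine Prod.ext (h 0 (by omega)).1.symm (Prod.ext ?_ (funext fun i => ?_))
      · exact ((h (T.run w t).inPos (by have := T.inPos_run w t; omega)).2.1 rfl).symm
      · exact ((h ((T.run w t).head i) (hs t i)).2.2 i rfl).symm
    · rintro rfl j -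
      refine ⟨rfl, fun h => ?_, fun i h => ?_⟩
      · simp only [col] at h ⊢; rw [← h]; rfl
      · simp only [col] at h ⊢; rw [← h]; rfl
  succ t := by
    refine Eq.trans ?_ (T.window.next_revWord (T.view w (T.run w t)) (T.col w (T.run w t)) s).symm
    refine WindowSystem.revWord_congr fun j hj => ?_
    rw [run, Function.iterate_succ_apply', ← run]
    exact (T.col_step hw (T.inPos_run w t) (hs t) hj).symm

/-- Halted configurations do not change, and acceptance happens within `|Γ| ^ s` steps or never. So
it can be tested at a single late moment `N`, whether or not the computation halts. -/
theorem accepts_iff [Finite α] {w : List α} {s N : ℕ} (hw : w.length + 1 < s)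
    (hs : T.UsesSpace w s) (hN : Nat.card T.Col ^ s ≤ N) :
    T.Accepts w ↔ T.window.Acc (T.view w (T.run w N)) := by
  refine ⟨fun h => ?_, fun h => ⟨N, h⟩⟩
  obtain ⟨t, ht, h1⟩ := (T.isRun_window hw hs).exists_le T.window.Acc h
  have hstay : ∀ d, T.run w (t + d) = T.run w t := by
    intro d
    induction d with
    | zero => rfl
    | succ d ih =>
      have h2 : T.action w (T.run w t) = none := h1.1
      rw [← add_assoc, run, Function.iterate_succ_apply', ← run, ih, step, h2]
  replace ht : t ≤ Nat.card T.Col ^ s := ht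
  have := hstay (N - t)
  rw [show t + (N - t) = N by omega] at this
  rw [this]
  exact h1

end OfflineTM

/-- The base is at least 2, so a constant `a` is below the `a`-th power, and one more factor pays
for an addition. -/
theorem Polynomial.exists_eval_le_pow (p : Polynomial ℕ) : ∃ e, ∀ n, p.eval n ≤ (n + 2) ^ e := by
  induction p using Polynomial.induction_on with
  | C a =>
    refine ⟨a, fun n => ?_⟩
    rw [Polynomial.eval_C]
    exact (Nat.lt_two_pow_self).le.trans (Nat.pow_le_pow_left (by omega) _)
  | add p q hp hq =>
    obtain ⟨a, ha⟩ := hp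
    obtain ⟨b, hb⟩ := hq
    refine ⟨max a b + 1, fun n => ?_⟩
    have h1 := (ha n).trans (Nat.pow_le_pow_right (by omega) (le_max_left a b))
    have h2 := (hb n).trans (Nat.pow_le_pow_right (by omega) (le_max_right a b))
    rw [Polynomial.eval_add, pow_succ]
    nlinarith
  | monomial k a h =>
    obtain ⟨e, he⟩ := h
    refine ⟨e + 1, fun n => ?_⟩
    have := he n
    simp only [Polynomial.eval_mul, Polynomial.eval_C, Polynomial.eval_pow, Polynomial.eval_X]
      at this ⊢
    rw [pow_succ, ← mul_assoc, pow_succ]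
    exact Nat.mul_le_mul this (by omega)

/-! ## Simulation of window systems -/

namespace WindowMachine

variable {α : Type u} (Y : WindowSystem α) (e : ℕ)

/-- The auxiliary directions. The nodes of a trie that is rooted at the center stand for words:
`up` leads to the parent and `ch a` to the child for the letter `a`. Of a node that stands for a
word compatible with `σ`, `img σ` is the node of the rewritten word without its last letter. At
leaves, `jmp` leads to the result of rewriting a number of times. The center has an odometer with
digits `dig`, marks `flag` for its overflows, a pointer `ini` to a trie node, and a pointer `ip`
into the input. -/
inductive Aux (Y : WindowSystem α) (e : ℕ) : Type u
  | up
  | ctr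
  | ini
  | ip
  | jmp
  | ch (a : Y.Letter)
  | img (σ : Y.Guess)
  | dig (i : Fin e)
  | flag (i : Fin 4)

instance : Finite Y.Letter := Y.finite_letter

instance : Finite Y.Guess := Y.finite_guess

instance : Finite (Aux Y e) := by
  refine Finite.of_surjective (α := Fin 5 ⊕ Y.Letter ⊕ Y.Guess ⊕ Fin e ⊕ Fin 4) (fun s =>
    match s with
    | .inl 0 => .up
    | .inl 1 => .ctr
    | .inl 2 => .ini
    | .inl 3 => .ip
    | .inl 4 => .jmp
    | .inr (.inl a) => .ch a
    | .inr (.inr (.inl σ)) => .img σ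
    | .inr (.inr (.inr (.inl i))) => .dig i
    | .inr (.inr (.inr (.inr i))) => .flag i) ?_
  rintro (_ | _ | _ | _ | _ | a | σ | i | i)
  · exact ⟨.inl 0, rfl⟩
  · exact ⟨.inl 1, rfl⟩
  · exact ⟨.inl 2, rfl⟩
  · exact ⟨.inl 3, rfl⟩
  · exact ⟨.inl 4, rfl⟩
  · exact ⟨.inr (.inl a), rfl⟩
  · exact ⟨.inr (.inr (.inl σ)), rfl⟩
  · exact ⟨.inr (.inr (.inr (.inl i))), rfl⟩
  · exact ⟨.inr (.inr (.inr (.inr i))), rfl⟩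

/-- The directions. -/
abbrev D := Dir α (Nat.card (Aux Y e))

variable {Y e}

/-- An auxiliary direction. -/
noncomputable def dir (a : Aux Y e) : D Y e := .aux (Finite.equivFin _ a)

@[simp]
theorem dir_inj {a b : Aux Y e} : dir a = dir b ↔ a = b := by simp [dir]

@[simp] theorem dir_ne_o (a : Aux Y e) : dir a ≠ .o := by simp [dir]
@[simp] theorem dir_ne_e (a : Aux Y e) : dir a ≠ .e := by simp [dir]
@[simp] theorem dir_ne_w (a : Aux Y e) : dir a ≠ .w := by simp [dir]
@[simp] theorem dir_ne_v (a : Aux Y e) : dir a ≠ .v := by simp [dir]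
@[simp] theorem dir_ne_sym (a : Aux Y e) (s : α) : dir a ≠ .sym s := by simp [dir]

/-- The line on which the child for a letter is created. -/
noncomputable def line (a : Y.Letter) : ℕ := 5 * (Finite.equivFin _ a + 1) + 1

theorem line_inj {a b : Y.Letter} : line a = line b ↔ a = b := by
  simp only [line, Nat.add_right_cancel_iff, Nat.mul_left_cancel_iff (by omega : 0 < 5)]
  rw [Fin.val_inj]; simp

/-- Conjunction of a list. -/
def allOf {δ : Type*} : List (PathExpr δ) → PathExpr δ
  | [] => .eq [] []
  | b :: l => .and b (allOf l)

theorem allOf_holds {δ : Type*} (G : PGraph δ) (u : Node) (l : List (PathExpr δ)) :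
    (allOf l).Holds G u ↔ ∀ b ∈ l, b.Holds G u := by
  induction l with
  | nil => simp [allOf, PathExpr.Holds]
  | cons b l ih => simp [allOf, PathExpr.Holds, ih]

/-- All elements of a finite type. -/
noncomputable def elems (β : Type*) [Finite β] : List β := List.ofFn (Finite.equivFin β).symm

@[simp]
theorem mem_elems {β : Type*} [Finite β] (b : β) : b ∈ elems β :=
  (List.mem_ofFn' _ _).2 ⟨Finite.equivFin β b, by simp⟩

/-! ### The rules of the simulating machine -/

variable (Y e)

/-- The node is the center. -/
noncomputable def isCenter : PathExpr (D Y e) := .eq [.o, dir .ctr] []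

/-- The odometer has overflown `k` times. -/
noncomputable def passed (k : ℕ) : PathExpr (D Y e) :=
  if h : 0 < k ∧ k ≤ 4 then .eq [.o, dir .ctr, dir (.flag ⟨k - 1, by omega⟩)] [.o, dir .ctr]
  else .eq [] []

/-- The first `i` digits of the odometer are zero. -/
noncomputable def low (i : ℕ) : PathExpr (D Y e) :=
  allOf ((elems (Fin e)).map fun j => if j.val < i then .eq [dir (.dig j)] [.o] else .eq [] [])

/-- The node at the end of the path `p` is a trie node for a word with the last letter `a`, if
`l = some a`, and the center, if `l = none`. -/
noncomputable def lookAt (p : List (D Y e)) : Option Y.Letter → PathExpr (D Y e)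
  | none => .eq p [.o, dir .ctr]
  | some a => .and (.eq (p ++ [dir .up, dir (.ch a)]) p) (.not (.eq p [.o]))

/-- Cells and the origin are excluded because their `up` is the origin. The center is listed
separately, since on empty input its `up` is the origin too. A missing child is recognized by `ch a`
still leading to the parent. -/
noncomputable def grow (a : Y.Letter) : PathExpr (D Y e) :=
  .and (.and (passed Y e 1) (.not (passed Y e 2)))
    (.and (.or (isCenter Y e) (.not (.eq [dir .up] [.o]))) (.eq [dir (.ch a)] [dir .up]))

/-- A guard, a direction to redirect, and the path to its new target. -/
abbrev RuleMove := PathExpr (D Y e) × D Y e × List (D Y e)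

/-- The digit 0 is the origin, the digits 1 to `n` are the cells, and the digit `n + 1` is the
center, whose `.w` leads to the last cell. Decrementing is one move along `.w`, and 0 turns into the
center. A digit changes when all lower digits are 0. -/
noncomputable def digMove : Fin e × Bool → RuleMove Y e
  | (i, true) => (.and (isCenter Y e) (.and (low Y e i) (.eq [dir (.dig i)] [.o])), dir (.dig i), [])
  | (i, false) => (.and (isCenter Y e) (.and (low Y e i) (.not (.eq [dir (.dig i)] [.o]))),
      dir (.dig i), [dir (.dig i), .w])

/-- A flag is raised when the odometer is about to wrap around. Each flag waits for the previous
one, so the flags count the wraps. -/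
noncomputable def flagMove (i : Fin 4) : RuleMove Y e :=
  (.and (isCenter Y e) (.and (low Y e e) (passed Y e i)), dir (.flag i), [])

/-- The node is the center, and the initial word is being looked up. -/
noncomputable def walking : PathExpr (D Y e) :=
  .and (isCenter Y e) (.and (passed Y e 2) (.not (passed Y e 3)))

/-- Until the walk begins, `ini` rests at the center and `ip` moves to the first cell. During the
walk `ini` descends along the initial word: by `first` while it is still at the center, later by the
letters under `ip`, and by `rest` when `ip` has run off the input. -/
noncomputable def pointerMoves : List (RuleMove Y e) :=
  [(.and (isCenter Y e) (.not (passed Y e 2)), dir .ini, []),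
    (.and (walking Y e) (.eq [dir .ini] []), dir .ini, [dir .ini, dir (.ch Y.first)]),
    (.and (walking Y e) (.and (.not (.eq [dir .ini] [])) (.eq [dir .ip] [.o])), dir .ini,
      [dir .ini, dir (.ch Y.rest)]),
    (.and (.and (isCenter Y e) (.not (passed Y e 2))) (.not (.eq [dir .ip, .w] [.o])), dir .ip,
      [dir .ip, .w]),
    (.and (walking Y e) (.not (.eq [dir .ini] [])), dir .ip, [dir .ip, .e])]

noncomputable def inputMove (a : α) : RuleMove Y e :=
  (.and (walking Y e) (.and (.not (.eq [dir .ini] []))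
    (.and (.eq [dir .ip, .sym a] [dir .ip]) (.not (.eq [dir .ip] [.o])))), dir .ini,
      [dir .ini, dir (.ch (Y.input a))])

-- The letter `b` supplies the missing right neighbour of `a`, so the image of the parent can be
-- extended by the letter that replaces `a`. Incompatible guesses lead to the origin, which absorbs
-- all extensions.
open Classical in
noncomputable def imgMove :
    Y.Guess × Y.Letter × Option (Y.Letter × Option Y.Letter) → RuleMove Y e
  | (σ, b, none) => (.and (lookAt Y e [] (some b)) (lookAt Y e [dir .up] none), dir (.img σ),
      if Y.Compat σ b then [dir .up] else [.o])
  | (σ, b, some (a, l)) => (.and (lookAt Y e [] (some b)) (.and (lookAt Y e [dir .up] (some a))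
      (lookAt Y e [dir .up, dir .up] l)), dir (.img σ),
      if Y.Compat σ b then [dir .up, dir (.img σ), dir (.ch (Y.out σ l a (some b)))] else [.o])

/-- All guesses whose image is defined are tried. A word with several compatible guesses may cause
conflicts, but no word of a run is of this kind. Only the effect on leaves is used. -/
noncomputable def stepMove : Y.Guess × Y.Letter × Option Y.Letter → RuleMove Y e
  | (σ, a, l) => (.and (.and (.not (passed Y e 3)) (.not (.eq [dir (.img σ)] [.o])))
      (.and (lookAt Y e [] (some a)) (lookAt Y e [dir .up] l)), dir .jmp,
      [dir (.img σ), dir (.ch (Y.out σ l a none))])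

/-- The exponent is squared because only `W - 1` rounds of composition precede the evaluation, where
`W` is the width: `(c ^ 2) ^ (W - 1)` is at least `c ^ W` if `W ≥ 2` and `c > 0`. -/
noncomputable def powMove (a : Y.Letter) : RuleMove Y e :=
  (.and (passed Y e 3) (lookAt Y e [] (some a)), dir .jmp,
    List.replicate (Nat.card Y.Letter ^ 2) (dir .jmp))

-- This is carried out throughout the last phase; the last time, with the longest jumps, is the one
-- that counts.
open Classical in
noncomputable def valMove (σ : Y.Guess) : RuleMove Y e :=
  (.and (.and (isCenter Y e) (passed Y e 3))
    (.not (.eq [dir .ini, dir .jmp, dir (.img σ)] [.o])), .v, if Y.Acc σ then [.o] else [])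

variable [Finite α]

noncomputable def moves : List (RuleMove Y e) :=
  (elems _).map (digMove Y e) ++ (elems _).map (flagMove Y e) ++ pointerMoves Y e ++
    (elems _).map (inputMove Y e) ++ (elems _).map (imgMove Y e) ++
    (elems _).map (stepMove Y e) ++ (elems _).map (powMove Y e) ++ (elems _).map (valMove Y e)

theorem mem_moves {p : RuleMove Y e} : p ∈ moves Y e ↔
    (∃ i, digMove Y e i = p) ∨ (∃ i, flagMove Y e i = p) ∨ p ∈ pointerMoves Y e ∨
    (∃ a, inputMove Y e a = p) ∨ (∃ i, imgMove Y e i = p) ∨ (∃ i, stepMove Y e i = p) ∨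
    (∃ a, powMove Y e a = p) ∨ ∃ σ, valMove Y e σ = p := by
  simp only [moves, List.mem_append, List.mem_map, mem_elems, true_and, or_assoc]

/-- The rules for each direction. -/
theorem moves_cases {p : RuleMove Y e} (h : p ∈ moves Y e) :
    (∃ i b, p.2.1 = dir (.dig i) ∧ p = digMove Y e (i, b)) ∨
    (∃ i, p.2.1 = dir (.flag i) ∧ p = flagMove Y e i) ∨
    (p.2.1 = dir .ini ∧ (p ∈ pointerMoves Y e ∨ ∃ a, p = inputMove Y e a)) ∨
    (p.2.1 = dir .ip ∧ p ∈ pointerMoves Y e) ∨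
    (∃ i, p.2.1 = dir (.img i.1) ∧ p = imgMove Y e i) ∨
    (p.2.1 = dir .jmp ∧ ((∃ i, p = stepMove Y e i) ∨ ∃ a, p = powMove Y e a)) ∨
    (p.2.1 = .v ∧ ∃ σ, p = valMove Y e σ) := by
  rcases (mem_moves Y e).1 h with ⟨⟨i, b⟩, rfl⟩ | ⟨i, rfl⟩ | h | ⟨a, rfl⟩ | ⟨i, rfl⟩ | ⟨i, rfl⟩ |
    ⟨a, rfl⟩ | ⟨σ, rfl⟩
  · exact .inl ⟨i, b, by cases b <;> rfl, rfl⟩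
  · exact .inr (.inl ⟨i, rfl, rfl⟩)
  · have h' := h
    simp only [pointerMoves, List.mem_cons, List.not_mem_nil, or_false] at h'
    rcases h' with rfl | rfl | rfl | rfl | rfl
    · exact .inr (.inr (.inl ⟨rfl, .inl h⟩))
    · exact .inr (.inr (.inl ⟨rfl, .inl h⟩))
    · exact .inr (.inr (.inl ⟨rfl, .inl h⟩))
    · exact .inr (.inr (.inr (.inl ⟨rfl, h⟩)))
    · exact .inr (.inr (.inr (.inl ⟨rfl, h⟩)))
  · exact .inr (.inr (.inl ⟨rfl, .inr ⟨a, rfl⟩⟩))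
  · refine .inr (.inr (.inr (.inr (.inl ⟨i, ?_, rfl⟩))))
    obtain ⟨σ, b, _ | ⟨a, l⟩⟩ := i <;> rfl
  · exact .inr (.inr (.inr (.inr (.inr (.inl ⟨rfl, .inl ⟨i, rfl⟩⟩)))))
  · exact .inr (.inr (.inr (.inr (.inr (.inl ⟨rfl, .inr ⟨a, rfl⟩⟩)))))
  · exact .inr (.inr (.inr (.inr (.inr (.inr ⟨rfl, σ, rfl⟩)))))

/-- Redirections are confined to the center and the nodes of the trie, so the input list and the
origin remain as they are. -/
theorem guard_of_mem_moves {p : RuleMove Y e} (h : p ∈ moves Y e) {G : PGraph (D Y e)} {u : Node}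
    (hp : p.1.Holds G u) :
    (isCenter Y e).Holds G u ∨ ∃ b, (lookAt Y e [] (some b)).Holds G u := by
  rcases (mem_moves Y e).1 h with ⟨⟨i, _ | _⟩, rfl⟩ | ⟨i, rfl⟩ | h | ⟨a, rfl⟩ |
    ⟨⟨σ, b, _ | ⟨a, l⟩⟩, rfl⟩ | ⟨⟨σ, a, l⟩, rfl⟩ | ⟨a, rfl⟩ | ⟨σ, rfl⟩
  · exact .inl hp.1
  · exact .inl hp.1
  · exact .inl hp.1
  · simp only [pointerMoves, List.mem_cons, List.not_mem_nil, or_false] at h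
    rcases h with rfl | rfl | rfl | rfl | rfl
    · exact .inl hp.1
    · exact .inl hp.1.1
    · exact .inl hp.1.1
    · exact .inl hp.1.1
    · exact .inl hp.1.1
  · exact .inl hp.1.1
  · exact .inr ⟨b, hp.1⟩
  · exact .inr ⟨b, hp.1⟩
  · exact .inr ⟨a, hp.2.1⟩
  · exact .inr ⟨a, hp.2⟩
  · exact .inl hp.1.1

/-- The direction that a rule changes. -/
theorem dir_of_mem_moves {p : RuleMove Y e} (h : p ∈ moves Y e) :
    p.2.1 = .v ∨ ∃ a, p.2.1 = dir a ∧ a ≠ .up ∧ a ≠ .ctr ∧ ∀ b, a ≠ .ch b := by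
  rcases moves_cases Y e h with ⟨i, b, h, -⟩ | ⟨i, h, -⟩ | ⟨h, -⟩ | ⟨h, -⟩ | ⟨i, h, -⟩ | ⟨h, -⟩ |
    ⟨h, -⟩
  · exact .inr ⟨_, h, by simp⟩
  · exact .inr ⟨_, h, by simp⟩
  · exact .inr ⟨_, h, by simp⟩
  · exact .inr ⟨_, h, by simp⟩
  · exact .inr ⟨_, h, by simp⟩
  · exact .inr ⟨_, h, by simp⟩
  · exact .inl h

/-- The rules. -/
noncomputable def rules : RuleSet α (Nat.card (Aux Y e)) where
  live := .not (passed Y e 4)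
  news := (elems Y.Letter).map fun a => (grow Y e a, dir (.ch a))
  sets := (moves Y e).map fun p => (p.1, [], p.2.1, p.2.2)
  nil := .e
  ctr := dir .ctr
  nil_ne := by simp
  ctr_ne := by simp
  news_ne := by simp
  sets_ne := by
    simp only [List.mem_map, forall_exists_index, and_imp, forall_apply_eq_imp_iff₂]
    intro p hp
    rcases dir_of_mem_moves Y e hp with h | ⟨a, h, -⟩ <;> simp [h]

variable {Y e}

theorem news_getElem? {i : ℕ} {b : PathExpr (D Y e)} {d : D Y e} :
    (rules Y e).news[i]? = some (b, d) ↔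
      ∃ a, b = grow Y e a ∧ d = dir (.ch a) ∧ 5 * (i + 1) + 1 = line a := by
  simp only [rules, elems, List.getElem?_map, Option.map_eq_some_iff, List.getElem?_ofFn]
  constructor
  · rintro ⟨a, h, h2⟩
    split_ifs at h with hi
    simp only [Option.some.injEq] at h
    subst h
    simp only [Prod.mk.injEq] at h2
    exact ⟨_, h2.1.symm, h2.2.symm, by simp [line]⟩
  · rintro ⟨a, rfl, rfl, h⟩
    have hi : i = (Finite.equivFin _ a : ℕ) := by unfold line at h; omega
    subst hi
    exact ⟨a, by simp, rfl⟩

/-! ### What the simulating machine proposes for each direction -/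

section

variable {t : ℕ} {G : PGraph (D Y e)} {u y : Node}

theorem proposed_ch {a : Y.Letter} : (rules Y e).Proposed t G u (dir (.ch a)) y ↔
    (rules Y e).Fires G (grow Y e a) u ∧ y = .fresh (t + 1) (line a) u := by
  constructor
  · rintro (⟨b, x, z, h, -⟩ | ⟨i, b, h, hf, rfl⟩)
    · simp only [rules, List.mem_map, Prod.mk.injEq] at h
      obtain ⟨p, hp, -, -, h, -⟩ := h
      rcases dir_of_mem_moves Y e hp with h' | ⟨b, h', -, -, h2⟩
      · exact (dir_ne_v _ (h.symm.trans h')).elim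
      · exact (h2 a (dir_inj.1 (h'.symm.trans h))).elim
    · obtain ⟨a', rfl, h2, h3⟩ := news_getElem?.1 h
      simp only [dir_inj, Aux.ch.injEq] at h2
      subst h2
      exact ⟨hf, by rw [h3]⟩
  · rintro ⟨hf, rfl⟩
    refine .inr ⟨Finite.equivFin _ a, grow Y e a, news_getElem?.2 ⟨a, rfl, rfl, rfl⟩, hf, rfl⟩

theorem born_iff : (rules Y e).Born t G u ↔
    ∃ a c, (rules Y e).Fires G (grow Y e a) c ∧ u = .fresh (t + 1) (line a) c := by
  constructor
  · rintro ⟨i, b, d, c, h, hf, rfl⟩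
    obtain ⟨a, rfl, -, h3⟩ := news_getElem?.1 h
    exact ⟨a, c, hf, by rw [h3]⟩
  · rintro ⟨a, c, hf, rfl⟩
    exact ⟨Finite.equivFin _ a, _, _, c, news_getElem?.2 ⟨a, rfl, rfl, rfl⟩, hf, rfl⟩

theorem proposed_iff {d : D Y e} (hd : ∀ a, d ≠ dir (.ch a)) :
    (rules Y e).Proposed t G u d y ↔
      ∃ g z, (g, d, z) ∈ moves Y e ∧ (rules Y e).Fires G g u ∧ y = G.follow u z := by
  constructor
  · rintro (⟨b, x, z, h, c, hf, h1, h2⟩ | ⟨i, b, h, -⟩)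
    · simp only [rules, List.mem_map, Prod.mk.injEq] at h
      obtain ⟨p, hp, rfl, rfl, rfl, rfl⟩ := h
      simp only [PGraph.follow, List.foldl] at h1 h2
      subst h1 h2
      exact ⟨_, _, hp, hf, rfl⟩
    · obtain ⟨a, -, h, -⟩ := news_getElem?.1 h
      exact absurd h (hd a)
  · rintro ⟨g, z, h, hf, rfl⟩
    refine .inl ⟨g, [], z, ?_, u, hf, rfl, rfl⟩
    simp only [rules, List.mem_map, Prod.mk.injEq]
    exact ⟨_, h, rfl, trivial, rfl, rfl⟩

theorem unwritten {d : D Y e} (h : d ≠ .v) (h' : ∀ a, d = dir a → a = .up ∨ a = .ctr) :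
    (rules Y e).Unwritten d := by
  constructor
  · rintro b x z hm
    simp only [rules, List.mem_map, Prod.mk.injEq] at hm
    obtain ⟨p, hp, -, -, rfl, -⟩ := hm
    rcases dir_of_mem_moves Y e hp with h1 | ⟨a, h1, h2, h3, -⟩
    · exact h h1
    · exact (h' _ h1).elim h2 h3
  · rintro b hm
    simp only [rules, List.mem_map, Prod.mk.injEq] at hm
    obtain ⟨a, -, -, rfl⟩ := hm
    have := h' _ rfl; simp at this

theorem proposed_dig {i : Fin e} : (rules Y e).Proposed t G u (dir (.dig i)) y ↔
    ∃ b, (rules Y e).Fires G (digMove Y e (i, b)).1 u ∧ y = G.follow u (digMove Y e (i, b)).2.2 := by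
  rw [proposed_iff (by simp)]
  constructor
  · rintro ⟨g, z, hm, hf, rfl⟩
    rcases moves_cases Y e hm with ⟨j, b, hd, hp⟩ | ⟨j, hd, hp⟩ | ⟨hd, hp⟩ | ⟨hd, hp⟩ | ⟨j, hd, hp⟩ |
      ⟨hd, hp⟩ | ⟨hd, hp⟩ <;> simp at hd
    subst hd
    exact ⟨b, by rw [← hp]; exact hf, by rw [← hp]⟩
  · rintro ⟨b, hf, rfl⟩
    refine ⟨_, _, (mem_moves Y e).2 (.inl ⟨(i, b), ?_⟩), hf, rfl⟩
    cases b <;> rfl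

theorem proposed_flag {i : Fin 4} : (rules Y e).Proposed t G u (dir (.flag i)) y ↔
    (rules Y e).Fires G (flagMove Y e i).1 u ∧ y = u := by
  rw [proposed_iff (by simp)]
  constructor
  · rintro ⟨g, z, hm, hf, rfl⟩
    rcases moves_cases Y e hm with ⟨j, b, hd, hp⟩ | ⟨j, hd, hp⟩ | ⟨hd, hp⟩ | ⟨hd, hp⟩ | ⟨j, hd, hp⟩ |
      ⟨hd, hp⟩ | ⟨hd, hp⟩ <;> simp at hd
    subst hd
    simp only [flagMove, Prod.mk.injEq, true_and] at hp
    obtain ⟨rfl, rfl⟩ := hp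
    exact ⟨hf, rfl⟩
  · rintro ⟨hf, rfl⟩
    exact ⟨_, _, (mem_moves Y e).2 (.inr (.inl ⟨i, rfl⟩)), hf, rfl⟩

theorem proposed_ini : (rules Y e).Proposed t G u (dir .ini) y ↔
    ((rules Y e).Fires G (.and (isCenter Y e) (.not (passed Y e 2))) u ∧ y = u) ∨
    ((rules Y e).Fires G (walking Y e) u ∧
      ((G.edge u (dir .ini) = u ∧ y = G.edge (G.edge u (dir .ini)) (dir (.ch Y.first))) ∨
      (G.edge u (dir .ini) ≠ u ∧
        ((G.edge u (dir .ip) = G.edge u .o ∧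
          y = G.edge (G.edge u (dir .ini)) (dir (.ch Y.rest))) ∨
        (∃ a, G.edge (G.edge u (dir .ip)) (.sym a) = G.edge u (dir .ip) ∧
          G.edge u (dir .ip) ≠ G.edge u .o ∧
          y = G.edge (G.edge u (dir .ini)) (dir (.ch (Y.input a)))))))) := by
  rw [proposed_iff (by simp)]
  constructor
  · rintro ⟨g, z, hm, hf, rfl⟩
    rcases moves_cases Y e hm with ⟨j, b, hd, hp⟩ | ⟨j, hd, hp⟩ | ⟨hd, hp⟩ | ⟨hd, hp⟩ | ⟨j, hd, hp⟩ |
      ⟨hd, hp⟩ | ⟨hd, hp⟩ <;> simp at hd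
    rcases hp with hp | ⟨a, hp⟩
    · simp only [pointerMoves, List.mem_cons, List.not_mem_nil, or_false, Prod.mk.injEq, dir_inj,
        reduceCtorEq, false_and, and_false, true_and] at hp
      rcases hp with ⟨rfl, rfl⟩ | ⟨rfl, rfl⟩ | ⟨rfl, rfl⟩
      · exact .inl ⟨hf, rfl⟩
      · exact .inr ⟨⟨hf.1, hf.2.1, hf.2.2.1⟩, .inl ⟨hf.2.2.2, rfl⟩⟩
      · exact .inr ⟨⟨hf.1, hf.2.1, hf.2.2.1⟩, .inr ⟨hf.2.2.2.1, .inl ⟨hf.2.2.2.2, rfl⟩⟩⟩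
    · simp only [inputMove, Prod.mk.injEq, true_and] at hp
      obtain ⟨rfl, rfl⟩ := hp
      exact .inr ⟨⟨hf.1, hf.2.1, hf.2.2.1⟩, .inr ⟨hf.2.2.2.1, .inr ⟨a, hf.2.2.2.2.1,
        hf.2.2.2.2.2, rfl⟩⟩⟩
  · rintro (⟨hf, rfl⟩ | ⟨hf, ⟨h1, rfl⟩ | ⟨h1, ⟨h2, rfl⟩ | ⟨a, h2, h3, rfl⟩⟩⟩)
    · exact ⟨_, [], (mem_moves Y e).2 (.inr (.inr (.inl (by simp [pointerMoves])))), hf, rfl⟩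
    · exact ⟨.and (walking Y e) (.eq [dir .ini] []), [dir .ini, dir (.ch Y.first)],
        (mem_moves Y e).2 (.inr (.inr (.inl (by simp [pointerMoves])))), ⟨hf.1, hf.2.1, hf.2.2, h1⟩,
        rfl⟩
    · exact ⟨.and (walking Y e) (.and (.not (.eq [dir .ini] [])) (.eq [dir .ip] [.o])),
        [dir .ini, dir (.ch Y.rest)],
        (mem_moves Y e).2 (.inr (.inr (.inl (by simp [pointerMoves])))),
        ⟨hf.1, hf.2.1, hf.2.2, h1, h2⟩, rfl⟩
    · exact ⟨_, _, (mem_moves Y e).2 (.inr (.inr (.inr (.inl ⟨a, rfl⟩)))),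
        ⟨hf.1, hf.2.1, hf.2.2, h1, h2, h3⟩, rfl⟩

theorem proposed_ip : (rules Y e).Proposed t G u (dir .ip) y ↔
    ((rules Y e).Fires G (.and (isCenter Y e) (.not (passed Y e 2))) u ∧
      G.edge (G.edge u (dir .ip)) .w ≠ G.edge u .o ∧ y = G.edge (G.edge u (dir .ip)) .w) ∨
    ((rules Y e).Fires G (walking Y e) u ∧ G.edge u (dir .ini) ≠ u ∧
      y = G.edge (G.edge u (dir .ip)) .e) := by
  rw [proposed_iff (by simp)]
  constructor
  · rintro ⟨g, z, hm, hf, rfl⟩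
    rcases moves_cases Y e hm with ⟨j, b, hd, hp⟩ | ⟨j, hd, hp⟩ | ⟨hd, hp⟩ | ⟨hd, hp⟩ | ⟨j, hd, hp⟩ |
      ⟨hd, hp⟩ | ⟨hd, hp⟩ <;> simp at hd
    simp only [pointerMoves, List.mem_cons, List.not_mem_nil, or_false, Prod.mk.injEq, dir_inj,
      reduceCtorEq, false_and, and_false, true_and, false_or] at hp
    rcases hp with ⟨rfl, rfl⟩ | ⟨rfl, rfl⟩
    · exact .inl ⟨⟨hf.1, hf.2.1, hf.2.2.1⟩, hf.2.2.2, rfl⟩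
    · exact .inr ⟨⟨hf.1, hf.2.1, hf.2.2.1⟩, hf.2.2.2, rfl⟩
  · rintro (⟨hf, h1, rfl⟩ | ⟨hf, h1, rfl⟩)
    · exact ⟨.and (.and (isCenter Y e) (.not (passed Y e 2))) (.not (.eq [dir .ip, .w] [.o])),
        [dir .ip, .w], (mem_moves Y e).2 (.inr (.inr (.inl (by simp [pointerMoves])))),
        ⟨hf.1, hf.2.1, hf.2.2, h1⟩, rfl⟩
    · exact ⟨.and (walking Y e) (.not (.eq [dir .ini] [])), [dir .ip, .e],
        (mem_moves Y e).2 (.inr (.inr (.inl (by simp [pointerMoves])))),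
        ⟨hf.1, hf.2.1, hf.2.2, h1⟩, rfl⟩

theorem proposed_img {σ : Y.Guess} : (rules Y e).Proposed t G u (dir (.img σ)) y ↔
    ∃ i, (rules Y e).Fires G (imgMove Y e (σ, i)).1 u ∧
      y = G.follow u (imgMove Y e (σ, i)).2.2 := by
  rw [proposed_iff (by simp)]
  constructor
  · rintro ⟨g, z, hm, hf, rfl⟩
    rcases moves_cases Y e hm with ⟨j, b, hd, hp⟩ | ⟨j, hd, hp⟩ | ⟨hd, hp⟩ | ⟨hd, hp⟩ |
      ⟨⟨τ, j⟩, hd, hp⟩ | ⟨hd, hp⟩ | ⟨hd, hp⟩ <;> simp at hd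
    subst hd
    exact ⟨j, by rw [← hp]; exact hf, by rw [← hp]⟩
  · rintro ⟨i, hf, rfl⟩
    refine ⟨_, _, (mem_moves Y e).2 (.inr (.inr (.inr (.inr (.inl ⟨(σ, i), ?_⟩))))), hf, rfl⟩
    obtain ⟨b, _ | ⟨a, l⟩⟩ := i <;> rfl

theorem proposed_jmp : (rules Y e).Proposed t G u (dir .jmp) y ↔
    (∃ i, (rules Y e).Fires G (stepMove Y e i).1 u ∧ y = G.follow u (stepMove Y e i).2.2) ∨
    ∃ a, (rules Y e).Fires G (powMove Y e a).1 u ∧ y = G.follow u (powMove Y e a).2.2 := by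
  rw [proposed_iff (by simp)]
  constructor
  · rintro ⟨g, z, hm, hf, rfl⟩
    rcases moves_cases Y e hm with ⟨j, b, hd, hp⟩ | ⟨j, hd, hp⟩ | ⟨hd, hp⟩ | ⟨hd, hp⟩ | ⟨j, hd, hp⟩ |
      ⟨hd, hp⟩ | ⟨hd, hp⟩ <;> simp at hd
    rcases hp with ⟨i, hp⟩ | ⟨a, hp⟩
    · exact .inl ⟨i, by rw [← hp]; exact hf, by rw [← hp]⟩
    · exact .inr ⟨a, by rw [← hp]; exact hf, by rw [← hp]⟩
  · rintro (⟨i, hf, rfl⟩ | ⟨a, hf, rfl⟩)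
    · exact ⟨_, _, (mem_moves Y e).2 (.inr (.inr (.inr (.inr (.inr (.inl ⟨i, rfl⟩)))))), hf, rfl⟩
    · exact ⟨_, _, (mem_moves Y e).2 (.inr (.inr (.inr (.inr (.inr (.inr (.inl ⟨a, rfl⟩))))))), hf,
        rfl⟩

theorem proposed_v : (rules Y e).Proposed t G u .v y ↔
    ∃ σ, (rules Y e).Fires G (valMove Y e σ).1 u ∧ y = G.follow u (valMove Y e σ).2.2 := by
  rw [proposed_iff fun a h => dir_ne_v _ h.symm]
  constructor
  · rintro ⟨g, z, hm, hf, rfl⟩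
    rcases moves_cases Y e hm with ⟨j, b, hd, hp⟩ | ⟨j, hd, hp⟩ | ⟨hd, hp⟩ | ⟨hd, hp⟩ | ⟨j, hd, hp⟩ |
      ⟨hd, hp⟩ | ⟨-, σ, hp⟩
    any_goals exact absurd hd.symm (dir_ne_v _)
    exact ⟨σ, by rw [← hp]; exact hf, by rw [← hp]⟩
  · rintro ⟨σ, hf, rfl⟩
    exact ⟨_, _, (mem_moves Y e).2 (.inr (.inr (.inr (.inr (.inr (.inr (.inr ⟨σ, rfl⟩))))))), hf,
      rfl⟩

end

end WindowMachine

namespace WindowMachine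

variable {α : Type u} {Y : WindowSystem α} {e : ℕ}

/-! ### The odometer -/

/-- The number with `e` digits `n` in base `n + 2`. -/
def offset (n : ℕ) : ℕ → ℕ
  | 0 => 0
  | e + 1 => n + (n + 2) * offset n e

theorem offset_lt (n e : ℕ) : offset n e < (n + 2) ^ e := by
  induction e with
  | zero => simp [offset]
  | succ e ih => rw [offset, pow_succ]; nlinarith

/-- All edges of the new center lead to the last cell, which is the digit `n`. So the odometer needs
no initialization; its first pass is merely shorter than the following ones. -/
theorem digit_offset (n c : ℕ) {e i : ℕ} (hi : i < e) :
    (offset n e + c * (n + 2) ^ e) / (n + 2) ^ i % (n + 2) = n := by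
  induction e generalizing i with
  | zero => omega
  | succ e ih =>
    have h : offset n (e + 1) + c * (n + 2) ^ (e + 1) =
        n + (n + 2) * (offset n e + c * (n + 2) ^ e) := by rw [offset, pow_succ]; ring
    rw [h]
    cases i with
    | zero => rw [pow_zero, Nat.div_one, Nat.add_mul_mod_self_left, Nat.mod_eq_of_lt (by omega)]
    | succ i =>
      rw [pow_succ', ← Nat.div_div_eq_div_mul, Nat.add_mul_div_left _ _ (by omega),
        Nat.div_eq_of_lt (by omega : n < n + 2), zero_add, ih (by omega)]

/-- Borrowing reaches the digit `i` exactly if all lower digits are 0, that is, if `b ^ i` divides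
`v`. -/
theorem digit_pred {b v : ℕ} (hb : 0 < b) (hv : 0 < v) (i : ℕ) :
    (v - 1) / b ^ i % b = if b ^ i ∣ v then
      (if v / b ^ i % b = 0 then b - 1 else v / b ^ i % b - 1) else v / b ^ i % b := by
  obtain ⟨v, rfl⟩ : ∃ v', v = v' + 1 := ⟨v - 1, by omega⟩
  rw [Nat.add_sub_cancel, Nat.succ_div]
  split_ifs with h1 h2
  · have h3 := Nat.mod_lt (v / b ^ i) hb
    rw [← Nat.mod_add_mod] at h2
    by_contra h4
    rw [Nat.mod_eq_of_lt (by omega)] at h2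
    omega
  · have h3 := Nat.mod_lt (v / b ^ i) hb
    rw [← Nat.mod_add_mod] at h2 ⊢
    rcases Nat.lt_or_ge (v / b ^ i % b + 1) b with h4 | h4
    · rw [Nat.mod_eq_of_lt h4]; omega
    · rw [show v / b ^ i % b + 1 = b by omega] at h2
      simp at h2
  · rfl

theorem low_digits {b : ℕ} (hb : 0 < b) (v i : ℕ) :
    (∀ j < i, v / b ^ j % b = 0) ↔ b ^ i ∣ v := by
  induction i with
  | zero => simp
  | succ i ih =>
    rw [Nat.forall_lt_succ_right, ih]
    constructor
    · rintro ⟨⟨q, rfl⟩, h⟩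
      rw [Nat.mul_div_cancel_left _ (by positivity)] at h
      rw [pow_succ]
      exact Nat.mul_dvd_mul_left _ (Nat.dvd_of_mod_eq_zero h)
    · intro h
      refine ⟨(pow_dvd_pow b (Nat.le_succ i)).trans h, ?_⟩
      obtain ⟨q, rfl⟩ := h
      rw [pow_succ, mul_assoc, Nat.mul_div_cancel_left _ (by positivity), Nat.mul_mod_right]

/-! ### Names of nodes -/

variable (e) in
/-- The length of the words. -/
def width (x : List α) : ℕ := (x.length + 2) ^ e

variable (e) in
/-- The round in which the growth of the trie begins. -/
def growthStart (x : List α) : ℕ := offset x.length e + 1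

variable (e) in
/-- The round after which the machine halts. -/
def last (x : List α) : ℕ := offset x.length e + 3 * width e x

theorem width_pos (x : List α) : 0 < width e x := by unfold width; positivity

theorem growthStart_le_width (x : List α) : growthStart e x ≤ width e x := offset_lt _ _

/-- The node for a number below the base of the odometer. -/
def posNode (x : List α) : ℕ → Node
  | 0 => .origin
  | k + 1 => if k < x.length then .cell k else RuleSet.root x

theorem posNode_eq_origin {x : List α} {k : ℕ} : posNode x k = .origin ↔ k = 0 := by
  cases k with
  | zero => simp [posNode]
  | succ k => simp only [posNode]; split_ifs <;> simp [RuleSet.root]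

theorem posNode_length (x : List α) : posNode x x.length = RuleSet.base x := by
  rcases x with _ | ⟨a, x⟩ <;> simp [posNode, RuleSet.base]

/-- The node for a (reversed) word. -/
noncomputable def nd (x : List α) (e : ℕ) : List Y.Letter → Node
  | [] => RuleSet.root x
  | a :: w => .fresh (5 + 5 * (growthStart e x + w.length) + 1) (line a) (nd x e w)

/-- The parent of the node for a word. -/
noncomputable def parent (x : List α) (e : ℕ) : List Y.Letter → Node
  | [] => RuleSet.base x
  | _ :: w => nd x e w

/-- The node for the word exists after `r` rounds. -/
def Present (x : List α) (e r : ℕ) (w : List Y.Letter) : Prop :=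
  w = [] ∨ (growthStart e x + w.length ≤ r ∧ w.length ≤ width e x)

theorem Present.tail {x : List α} {r : ℕ} {a : Y.Letter} {w : List Y.Letter}
    (h : Present x e r (a :: w)) : Present x e r w := by
  rcases h with h | h
  · simp at h
  · right; simp at h; omega

theorem Present.mono {x : List α} {r s : ℕ} (hrs : r ≤ s) {w : List Y.Letter}
    (h : Present x e r w) : Present x e s w :=
  h.imp id fun h => ⟨by omega, h.2⟩

theorem nd_inj {x : List α} {w w' : List Y.Letter} : nd x e w = nd x e w' ↔ w = w' := by
  refine ⟨fun h => ?_, fun h => by rw [h]⟩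
  induction w generalizing w' with
  | nil =>
    cases w' with
    | nil => rfl
    | cons b w' => simp [nd, RuleSet.root] at h
  | cons a w ih =>
    cases w' with
    | nil => simp [nd, RuleSet.root] at h
    | cons b w' =>
      simp only [nd, Node.fresh.injEq, line_inj] at h
      rw [h.2.1, ih h.2.2]

theorem nd_fresh (x : List α) (w : List Y.Letter) :
    ∃ t l, nd x e w = .fresh t l (parent x e w) := by
  cases w with
  | nil => exact ⟨_, _, rfl⟩
  | cons a w => exact ⟨_, _, rfl⟩

theorem nd_ne_origin (x : List α) (w : List Y.Letter) : nd x e w ≠ .origin := by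
  obtain ⟨t, l, h⟩ := nd_fresh (e := e) x w
  simp [h]

theorem nd_ne_cell (x : List α) (w : List Y.Letter) (i : ℕ) : nd x e w ≠ .cell i := by
  obtain ⟨t, l, h⟩ := nd_fresh (e := e) x w
  simp [h]

theorem base_cases (x : List α) :
    RuleSet.base x = .origin ∨ ∃ i < x.length, RuleSet.base x = .cell i := by
  unfold RuleSet.base
  split_ifs with h
  · exact .inl rfl
  · exact .inr ⟨_, by have := List.length_pos_iff.2 h; omega, rfl⟩

theorem nd_ne_base (x : List α) (w : List Y.Letter) : nd x e w ≠ RuleSet.base x := by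
  rcases base_cases x with h | ⟨i, -, h⟩
  · rw [h]; exact nd_ne_origin x w
  · rw [h]; exact nd_ne_cell x w i

/-- This separates an existing child from the default value of the child directions. -/
theorem nd_ne_parent (x : List α) (a : Y.Letter) (w : List Y.Letter) :
    nd x e (a :: w) ≠ parent x e w := by
  cases w with
  | nil => exact nd_ne_base x _
  | cons b w =>
    intro h
    have := congrArg List.length (nd_inj.1 h)
    simp at this
    omega

/-! ### Parts of the graph that do not change -/

/-- Edges that no rule changes. -/
structure Base (x : List α) (G : PGraph (D Y e)) : Prop where
  root_mem : RuleSet.root x ∈ G.nodes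
  origin_mem : .origin ∈ G.nodes
  cell_mem : ∀ i < x.length, .cell i ∈ G.nodes
  o : ∀ u ∈ G.nodes, G.edge u .o = .origin
  ctr : G.edge .origin (dir .ctr) = RuleSet.root x
  origin_up : G.edge .origin (dir .up) = .origin
  cell_up : ∀ i < x.length, G.edge (.cell i) (dir .up) = .origin
  fresh_up : ∀ t l c, .fresh t l c ∈ G.nodes → G.edge (.fresh t l c) (dir .up) = c
  root_w : G.edge (RuleSet.root x) .w = RuleSet.base x
  cell_w : ∀ i < x.length, G.edge (.cell i) .w = posNode x i
  cell_e : ∀ i < x.length, G.edge (.cell i) .e = if i + 1 < x.length then .cell (i + 1) else .origin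
  cell_sym : ∀ i < x.length, ∀ a, G.edge (.cell i) (.sym a) = .cell i ↔ x[i]? = some a

theorem Base.up {x : List α} {G : PGraph (D Y e)} (hB : Base x G) {w : List Y.Letter}
    (hw : nd x e w ∈ G.nodes) : G.edge (nd x e w) (dir .up) = parent x e w := by
  obtain ⟨t, l, h⟩ := nd_fresh (e := e) x w
  rw [h] at hw ⊢
  exact hB.fresh_up _ _ _ hw

theorem Base.isCenter {x : List α} {G : PGraph (D Y e)} (hB : Base x G) {u : Node}
    (hu : u ∈ G.nodes) : (isCenter Y e).Holds G u ↔ u = RuleSet.root x := by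
  simp [WindowMachine.isCenter, PathExpr.Holds, PGraph.follow, hB.o u hu, hB.ctr, eq_comm]

variable [Finite α]

theorem base_graphAt (ρ : Resolution (D Y e)) (x : List α) (r : ℕ) :
    Base x ((rules Y e).graphAt ρ x r) := by
  have h0 : ∀ u ∈ ((rules Y e).startGraph x).nodes, u ∈ ((rules Y e).graphAt ρ x r).nodes :=
    fun u hu => (rules Y e).mem_start ρ x r hu
  have hU : (rules Y e).Unwritten (dir .up) := unwritten (by simp) (by simp)
  have hC : (rules Y e).Unwritten (dir .ctr) := unwritten (by simp) (by simp)
  have hne : ∀ {d : D Y e}, (d = .e ∨ d = .w ∨ ∃ a, d = .sym a) → (rules Y e).Unwritten d := by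
    rintro d (rfl | rfl | ⟨a, rfl⟩)
    · exact unwritten (by simp) fun a h => (dir_ne_e a h.symm).elim
    · exact unwritten (by simp) fun a h => (dir_ne_w a h.symm).elim
    · exact unwritten (by simp) fun b h => (dir_ne_sym b a h.symm).elim
  have ho : .origin ∈ ((rules Y e).startGraph x).nodes := .inl (.inl rfl)
  have hc : ∀ i < x.length, .cell i ∈ ((rules Y e).startGraph x).nodes :=
    fun i hi => .inl (.inr ⟨i, hi, rfl⟩)
  have hroot : RuleSet.root x ∈ ((rules Y e).startGraph x).nodes := .inr rfl
  have hctr : (rules Y e).ctr = dir .ctr := rfl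
  have hnil : (rules Y e).nil = .e := rfl
  refine ⟨h0 _ hroot, h0 _ ho, fun i hi => h0 _ (hc i hi),
    fun u hu => (rules Y e).edge_o ρ x r hu, ?_, ?_, fun i hi => ?_,
    fun t l c h => (rules Y e).unwritten_fresh ρ hU (by simp) (by simp [hnil]) x r h, ?_,
    fun i hi => ?_, fun i hi => ?_, fun i hi a => ?_⟩
  · rw [(rules Y e).unwritten_start ρ hC x r ho]
    simp [RuleSet.startGraph, hctr, RuleSet.root]
  · rw [(rules Y e).unwritten_start ρ hU x r ho]
    simp [RuleSet.startGraph, hctr, RuleSet.root, MWSMM.inputGraph]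
  · rw [(rules Y e).unwritten_start ρ hU x r (hc i hi)]
    simp [RuleSet.startGraph, RuleSet.root, dir, MWSMM.inputGraph]
  · rw [(rules Y e).unwritten_start ρ (hne (by simp)) x r hroot]
    simp [RuleSet.startGraph, hnil]
  · rw [(rules Y e).unwritten_start ρ (hne (by simp)) x r (hc i hi)]
    cases i with
    | zero => simp [RuleSet.startGraph, RuleSet.root, MWSMM.inputGraph, posNode]
    | succ i =>
      simp [RuleSet.startGraph, RuleSet.root, MWSMM.inputGraph, posNode, show i < x.length by omega]
  · rw [(rules Y e).unwritten_start ρ (hne (by simp)) x r (hc i hi)]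
    simp [RuleSet.startGraph, RuleSet.root, MWSMM.inputGraph]
  · rw [(rules Y e).unwritten_start ρ (hne (by simp)) x r (hc i hi)]
    simp [RuleSet.startGraph, RuleSet.root, MWSMM.inputGraph]

end WindowMachine

namespace WindowMachine

variable {α : Type u} {Y : WindowSystem α} {e : ℕ}

/-! ### Odometer and trie -/

/-- The odometer, which shows `v`, and the trie after `r` rounds. -/
structure Inv (x : List α) (r v : ℕ) (G : PGraph (D Y e)) : Prop where
  base : Base x G
  nodes : ∀ u ∈ G.nodes, u = .origin ∨ (∃ i < x.length, u = .cell i) ∨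
    ∃ w : List Y.Letter, u = nd x e w ∧ Present x e r w
  mem : ∀ w : List Y.Letter, Present x e r w → nd x e w ∈ G.nodes
  origin : ∀ d, d ≠ dir .ctr → G.edge .origin d = .origin
  cell_ch : ∀ i < x.length, ∀ a, G.edge (.cell i) (dir (.ch a)) = .origin
  ch : ∀ w : List Y.Letter, Present x e r w → ∀ a, (Present x e r (a :: w) →
    G.edge (nd x e w) (dir (.ch a)) = nd x e (a :: w)) ∧ (¬ Present x e r (a :: w) →
    G.edge (nd x e w) (dir (.ch a)) = parent x e w)
  dig : ∀ i : Fin e, G.edge (RuleSet.root x) (dir (.dig i)) =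
    posNode x (v / (x.length + 2) ^ i.val % (x.length + 2))
  -- Counting down from `last`, the flags delimit phases of `width` rounds: growth of the trie after
  -- the first flag, lookup of the initial word after the second, composition of jumps after the
  -- third. The fourth ends the run.
  flag : ∀ i : Fin 4, G.edge (RuleSet.root x) (dir (.flag i)) = RuleSet.root x ↔
    v < (3 - i.val) * width e x

section

variable {x : List α} {r v : ℕ} {G : PGraph (D Y e)}

theorem Inv.present_of_mem (h : Inv x r v G) {w : List Y.Letter} (hw : nd x e w ∈ G.nodes) :
    Present x e r w := by
  rcases h.nodes _ hw with h1 | ⟨i, -, h1⟩ | ⟨w', h1, h2⟩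
  · exact absurd h1 (nd_ne_origin x w)
  · exact absurd h1 (nd_ne_cell x w i)
  · rwa [nd_inj.1 h1]

theorem Inv.passed (h : Inv x r v G) {u : Node} (hu : u ∈ G.nodes) {k : ℕ} (h0 : 0 < k)
    (hk : k ≤ 4) : (passed Y e k).Holds G u ↔ v < (4 - k) * width e x := by
  rw [WindowMachine.passed, dif_pos ⟨h0, hk⟩]
  simp only [PathExpr.Holds, PGraph.follow, List.foldl, h.base.o u hu, h.base.ctr, h.flag]
  rw [show 3 - (k - 1) = 4 - k by omega]

theorem Inv.live [Finite α] (h : Inv x r v G) {u : Node} (hu : u ∈ G.nodes) : (rules Y e).live.Holds G u := by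
  simp [rules, PathExpr.Holds, h.passed hu]

theorem Inv.low (h : Inv x r v G) {i : ℕ} (hi : i ≤ e) :
    (low Y e i).Holds G (RuleSet.root x) ↔ (x.length + 2) ^ i ∣ v := by
  rw [← low_digits (by omega), WindowMachine.low, allOf_holds]
  simp only [List.mem_map, mem_elems, true_and, forall_exists_index, forall_apply_eq_imp_iff]
  have key : ∀ j : Fin e, (PathExpr.eq [dir (Aux.dig j)] [Dir.o]).Holds G (RuleSet.root x) ↔
      v / (x.length + 2) ^ j.val % (x.length + 2) = 0 := by
    intro j
    simp only [PathExpr.Holds, PGraph.follow, List.foldl, h.dig,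
      h.base.o _ h.base.root_mem, posNode_eq_origin]
  constructor
  · intro hl j hj
    have := hl ⟨j, by omega⟩
    rw [if_pos hj] at this
    exact (key _).1 this
  · intro hl j
    split_ifs with hj
    · exact (key j).2 (hl j hj)
    · simp [PathExpr.Holds]

/-- The letters of trie nodes can be recognized. -/
theorem Inv.lookAt_some (h : Inv x r v G) {u : Node} (hu : u ∈ G.nodes) {p : List (D Y e)}
    (hp : G.follow u p ∈ G.nodes) {a : Y.Letter} :
    (lookAt Y e p (some a)).Holds G u ↔ ∃ w, G.follow u p = nd x e (a :: w) := by
  simp only [lookAt, PathExpr.Holds, PGraph.follow, List.foldl_append, List.foldl_cons,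
    List.foldl_nil, h.base.o u hu]
  simp only [PGraph.follow] at hp
  constructor
  · rintro ⟨h1, h2⟩
    rcases h.nodes _ hp with h3 | ⟨i, hi, h3⟩ | ⟨w, h3, h4⟩
    · exact absurd h3 h2
    · rw [h3, h.base.cell_up i hi, h.origin _ (by simp)] at h1
      simp at h1
    · rw [h3] at h1 hp
      rw [h.base.up hp] at h1
      cases w with
      | nil =>
        simp only [parent] at h1
        have : G.edge (RuleSet.base x) (dir (.ch a)) = .origin := by
          rcases base_cases x with h5 | ⟨i, hi, h5⟩ <;> rw [h5]
          · exact h.origin _ (by simp)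
          · exact h.cell_ch i hi a
        rw [this] at h1
        exact absurd h1.symm (nd_ne_origin x _)
      | cons b w =>
        simp only [parent] at h1
        by_cases h5 : Present x e r (a :: w)
        · rw [(h.ch w h4.tail a).1 h5, nd_inj] at h1
          exact ⟨w, by rw [h3, h1]⟩
        · rw [(h.ch w h4.tail a).2 h5] at h1
          exact absurd h1.symm (nd_ne_parent x b w)
  · rintro ⟨w, h1⟩
    rw [h1] at hp ⊢
    have h2 := h.present_of_mem hp
    refine ⟨?_, nd_ne_origin x _⟩
    rw [h.base.up hp]
    exact (h.ch w h2.tail a).1 h2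

theorem Inv.lookAt (h : Inv x r v G) {u : Node} (hu : u ∈ G.nodes) {p : List (D Y e)}
    {w : List Y.Letter} (hw : Present x e r w) (hp : G.follow u p = nd x e w)
    {l : Option Y.Letter} : (lookAt Y e p l).Holds G u ↔ w.head? = l := by
  cases l with
  | some a =>
    rw [h.lookAt_some hu (hp ▸ h.mem w hw), hp]
    simp only [nd_inj]
    cases w <;> simp
  | none =>
    have h1 : G.follow u [.o, dir .ctr] = nd x e ([] : List Y.Letter) := by
      simp [PGraph.follow, h.base.o u hu, h.base.ctr, nd]
    rw [WindowMachine.lookAt, PathExpr.Holds, hp, h1, nd_inj]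
    cases w <;> simp

variable [Finite α]

/-- Rules apply only to nodes of the trie. -/
theorem Inv.not_proposed (h : Inv x r v G) {u : Node}
    (hu : u = .origin ∨ ∃ i < x.length, u = .cell i) {t : ℕ} {d : D Y e} {y : Node} :
    ¬ (rules Y e).Proposed t G u d y := by
  have hm : u ∈ G.nodes := by
    rcases hu with rfl | ⟨i, hi, rfl⟩
    · exact h.base.origin_mem
    · exact h.base.cell_mem i hi
  have h1 : ∀ w : List Y.Letter, u ≠ nd x e w := by
    rintro w rfl
    rcases hu with h1 | ⟨i, -, h1⟩
    · exact nd_ne_origin x w h1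
    · exact nd_ne_cell x w i h1
  have hup : G.edge u (dir .up) = .origin := by
    rcases hu with rfl | ⟨i, hi, rfl⟩
    · exact h.base.origin_up
    · exact h.base.cell_up i hi
  have hc : ¬ (isCenter Y e).Holds G u := by
    rw [h.base.isCenter hm]; exact h1 []
  by_cases hd : ∃ a, d = dir (.ch a)
  · obtain ⟨a, rfl⟩ := hd
    rw [proposed_ch]
    rintro ⟨⟨-, -, -, h2 | h2, -⟩, -⟩
    · exact hc h2
    · exact h2 (by simp [PathExpr.Holds, PGraph.follow, hup, h.base.o u hm])
  · rw [proposed_iff fun a ha => hd ⟨a, ha⟩]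
    rintro ⟨g, z, h2, h3, -⟩
    rcases guard_of_mem_moves Y e h2 h3.2.2 with h4 | ⟨b, h4⟩
    · exact hc h4
    · obtain ⟨w, h5⟩ := (h.lookAt_some (p := []) hm hm).1 h4
      exact h1 _ h5

/-- The trie grows at its leaves. -/
theorem Inv.fires_grow (h : Inv x r v G) (hv : v = last e x - r) (hr : r ≤ last e x)
    {w : List Y.Letter} (hw : Present x e r w) {a : Y.Letter} :
    (rules Y e).Fires G (grow Y e a) (nd x e w) ↔
      r = growthStart e x + w.length ∧ w.length < width e x := by
  have hm := h.mem w hw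
  have h1 : ((isCenter Y e).or (PathExpr.eq [dir Aux.up] [Dir.o]).not).Holds G (nd x e w) := by
    cases w with
    | nil => exact .inl ((h.base.isCenter hm).2 rfl)
    | cons b w =>
      refine .inr ?_
      simp only [PathExpr.Holds, PGraph.follow, List.foldl, h.base.up hm, h.base.o _ hm]
      exact nd_ne_origin x w
  have h2 : (PathExpr.eq [dir (Aux.ch a)] [dir Aux.up]).Holds G (nd x e w) ↔
      ¬ Present x e r (a :: w) := by
    simp only [PathExpr.Holds, PGraph.follow, List.foldl, h.base.up hm]
    by_cases h3 : Present x e r (a :: w)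
    · rw [(h.ch w hw a).1 h3]
      simp [h3, nd_ne_parent]
    · rw [(h.ch w hw a).2 h3]
      simp [h3]
  -- The phase of growth is translated into bounds on `v`. Together with the absence of the child
  -- they determine the round in which a given node grows.
  have h3 : (rules Y e).Fires G (grow Y e a) (nd x e w) ↔
      (v < (4 - 1) * width e x ∧ ¬ v < (4 - 2) * width e x) ∧ ¬ Present x e r (a :: w) := by
    rw [← h.passed hm (by omega) (by omega), ← h.passed hm (by omega) (by omega), ← h2]
    exact ⟨fun hf => ⟨hf.2.2.1, hf.2.2.2.2⟩, fun hf => ⟨hm, h.live hm, hf.1, h1, hf.2⟩⟩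
  rw [h3]
  have hW : 0 < width e x := width_pos x
  unfold Present at hw ⊢
  simp only [last, growthStart, reduceCtorEq, List.length_cons, false_or, not_and_or] at *
  have h4 : w = [] → w.length = 0 := fun h => by simp [h]
  constructor
  · rintro ⟨⟨h5, h6⟩, h7⟩
    rcases hw with hw | hw
    · have := h4 hw; omega
    · omega
  · rintro ⟨h5, h6⟩
    omega

end

end WindowMachine

namespace WindowMachine

variable {α : Type u} {Y : WindowSystem α} {e : ℕ} [Finite α]

/-! ### One round of odometer and trie -/

section

variable {x : List α} {r v t : ℕ} {G G' : PGraph (D Y e)}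

theorem Inv.fires_center (h : Inv x r v G) {b : PathExpr (D Y e)} {u : Node} :
    (rules Y e).Fires G (.and (isCenter Y e) b) u ↔ u = RuleSet.root x ∧ b.Holds G u := by
  constructor
  · rintro ⟨h1, -, h2, h3⟩
    exact ⟨(h.base.isCenter h1).1 h2, h3⟩
  · rintro ⟨rfl, h2⟩
    exact ⟨h.base.root_mem, h.live h.base.root_mem, (h.base.isCenter h.base.root_mem).2 rfl, h2⟩

theorem Inv.dig_step (h : Inv x r v G) (hv : 0 < v) (hR : (rules Y e).Round t G G') (i : Fin e) :
    G'.edge (RuleSet.root x) (dir (.dig i)) =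
      posNode x ((v - 1) / (x.length + 2) ^ i.val % (x.length + 2)) := by
  have hm := h.base.root_mem
  have hzero : (PathExpr.eq [dir (Aux.dig i)] [Dir.o]).Holds G (RuleSet.root x) ↔
      v / (x.length + 2) ^ i.val % (x.length + 2) = 0 := by
    simp only [PathExpr.Holds, PGraph.follow, List.foldl, h.dig, h.base.o _ hm, posNode_eq_origin]
  rw [digit_pred (by omega) hv]
  by_cases hlow : (x.length + 2) ^ i.val ∣ v
  · rw [if_pos hlow]
    by_cases h0 : v / (x.length + 2) ^ i.val % (x.length + 2) = 0
    · rw [if_pos h0]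
      refine RuleSet.step_eq hR hm ⟨_, proposed_dig.2 ⟨true, h.fires_center.2 ⟨rfl,
        (h.low i.2.le).2 hlow, hzero.2 h0⟩, rfl⟩⟩ fun y hy => ?_
      obtain ⟨_ | _, hf, rfl⟩ := proposed_dig.1 hy
      · exact absurd (hzero.2 h0) (h.fires_center.1 hf).2.2
      · simp [digMove, PGraph.follow, posNode]
    · rw [if_neg h0]
      refine RuleSet.step_eq hR hm ⟨_, proposed_dig.2 ⟨false, h.fires_center.2 ⟨rfl,
        (h.low i.2.le).2 hlow, fun h1 => h0 (hzero.1 h1)⟩, rfl⟩⟩ fun y hy => ?_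
      obtain ⟨_ | _, hf, rfl⟩ := proposed_dig.1 hy
      · simp only [digMove, PGraph.follow, List.foldl, h.dig]
        have hlt : v / (x.length + 2) ^ i.val % (x.length + 2) < x.length + 2 :=
          Nat.mod_lt _ (by omega)
        generalize v / (x.length + 2) ^ i.val % (x.length + 2) = k at *
        obtain ⟨k, rfl⟩ := Nat.exists_eq_succ_of_ne_zero h0
        simp only [Nat.succ_eq_add_one, Nat.add_sub_cancel]
        by_cases hk : k < x.length
        · simp [posNode, hk, h.base.cell_w k hk]
        · obtain rfl : k = x.length := by omega
          have h1 : posNode x (x.length + 1) = RuleSet.root x := by simp [posNode]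
          rw [h1, h.base.root_w, posNode_length]
      · exact absurd (hzero.1 (h.fires_center.1 hf).2.2) h0
  · rw [if_neg hlow, ← h.dig]
    refine RuleSet.step_keep hR hm fun y hy => ?_
    obtain ⟨_ | _, hf, rfl⟩ := proposed_dig.1 hy
    · exact hlow ((h.low i.2.le).1 (h.fires_center.1 hf).2.1)
    · exact hlow ((h.low i.2.le).1 (h.fires_center.1 hf).2.1)

theorem Inv.flag_step (h : Inv x r v G) (hv : v < 4 * width e x)
    (hR : (rules Y e).Round t G G') (i : Fin 4) :
    G'.edge (RuleSet.root x) (dir (.flag i)) = RuleSet.root x ↔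
      v < (3 - i.val) * width e x ∨ (width e x ∣ v ∧ v < (4 - i.val) * width e x) := by
  have hm := h.base.root_mem
  have hfire : (rules Y e).Fires G (flagMove Y e i).1 (RuleSet.root x) ↔
      width e x ∣ v ∧ v < (4 - i.val) * width e x := by
    rw [flagMove, h.fires_center]
    have h1 : (WindowMachine.passed Y e i).Holds G (RuleSet.root x) ↔ v < (4 - i.val) * width e x := by
      by_cases hi : i.val = 0
      · rw [hi, WindowMachine.passed, dif_neg (by omega)]
        simp [PathExpr.Holds, hv]
      · exact h.passed hm (by omega) (by omega)
    constructor
    · rintro ⟨-, h2, h3⟩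
      exact ⟨(h.low le_rfl).1 h2, h1.1 h3⟩
    · rintro ⟨h2, h3⟩
      exact ⟨rfl, (h.low le_rfl).2 h2, h1.2 h3⟩
  by_cases hf : (rules Y e).Fires G (flagMove Y e i).1 (RuleSet.root x)
  · have := RuleSet.step_eq hR hm ⟨_, proposed_flag.2 ⟨hf, rfl⟩⟩
      fun y hy => (proposed_flag.1 hy).2
    simp [this, ← hfire, hf]
  · have := RuleSet.step_keep hR hm (d := dir (.flag i))
      fun y hy => hf (proposed_flag.1 hy).1
    rw [this, h.flag, ← hfire]
    simp [hf]

/-- Since `v = last e x - r`, guards that refer to flags amount to conditions on the round. So a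
node for a word of length `k` grows exactly in round `growthStart + k`, and its children receive the
names predicted by `nd`. -/
theorem Inv.succ (h : Inv x r v G) (hv : v = last e x - r) (hr : r < last e x)
    (hB' : Base x G') (hR : (rules Y e).Round (5 + 5 * r) G G') : Inv x (r + 1) (v - 1) G' := by
  have hW : 0 < width e x := width_pos x
  have hoff : growthStart e x ≤ width e x := growthStart_le_width x
  have hborn : ∀ u, (rules Y e).Born (5 + 5 * r) G u ↔ ∃ (a : Y.Letter) (w : List Y.Letter),
      Present x e r w ∧ r = growthStart e x + w.length ∧ w.length < width e x ∧
        u = nd x e (a :: w) := by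
    intro u
    rw [born_iff]
    constructor
    · rintro ⟨a, c, hf, rfl⟩
      have hp : (rules Y e).Proposed (5 + 5 * r) G c (dir (.ch a)) _ := proposed_ch.2 ⟨hf, rfl⟩
      rcases h.nodes c hf.1 with h1 | h1 | ⟨w, rfl, hw⟩
      · exact absurd hp (h.not_proposed (.inl h1))
      · exact absurd hp (h.not_proposed (.inr h1))
      · obtain ⟨h1, h2⟩ := (h.fires_grow hv hr.le hw).1 hf
        exact ⟨a, w, hw, h1, h2, by rw [nd, ← h1]⟩
    · rintro ⟨a, w, hw, h1, h2, rfl⟩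
      exact ⟨a, nd x e w, (h.fires_grow hv hr.le hw).2 ⟨h1, h2⟩, by rw [nd, ← h1]⟩
  have hpres : ∀ (a : Y.Letter) w, Present x e (r + 1) (a :: w) ↔ Present x e r (a :: w) ∨
      (Present x e r w ∧ r = growthStart e x + w.length ∧ w.length < width e x) := by
    intro a w
    constructor
    · intro h1
      by_cases h2 : Present x e r (a :: w)
      · exact .inl h2
      · right
        simp only [Present, reduceCtorEq, List.length_cons, false_or, not_and_or] at h1 h2 ⊢
        have h4 : r = growthStart e x + w.length := by omega
        exact ⟨.inr (by omega), h4, by omega⟩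
    · rintro (h1 | ⟨-, h1, h2⟩)
      · exact h1.mono (Nat.le_succ r)
      · exact .inr ⟨by simp; omega, by simpa using h2⟩
  refine ⟨hB', fun u hu => ?_, fun w hw => ?_, fun d hd => ?_, fun i hi a => ?_, fun w hw a => ?_,
    h.dig_step (by omega) hR, fun i => ?_⟩
  · rcases (hR.nodes u).1 hu with h1 | h1
    · rcases h.nodes u h1 with h2 | h2 | ⟨w, h2, h3⟩
      · exact .inl h2
      · exact .inr (.inl h2)
      · exact .inr (.inr ⟨w, h2, h3.mono (Nat.le_succ r)⟩)
    · obtain ⟨a, w, h2, h3, h4, rfl⟩ := (hborn u).1 h1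
      exact .inr (.inr ⟨_, rfl, (hpres a w).2 (.inr ⟨h2, h3, h4⟩)⟩)
  · cases w with
    | nil => exact hB'.root_mem
    | cons a w =>
      rcases (hpres a w).1 hw with h1 | ⟨h1, h2, h3⟩
      · exact (hR.nodes _).2 (.inl (h.mem _ h1))
      · exact (hR.nodes _).2 (.inr ((hborn _).2 ⟨a, w, h1, h2, h3, rfl⟩))
  · rw [RuleSet.step_keep hR h.base.origin_mem fun y => h.not_proposed (.inl rfl), h.origin d hd]
  · rw [RuleSet.step_keep hR (h.base.cell_mem i hi) fun y => h.not_proposed (.inr ⟨i, hi, rfl⟩),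
      h.cell_ch i hi]
  · have hkids : ∀ a, Present x e (r + 1) (a :: w) ↔ Present x e r (a :: w) ∨
        (rules Y e).Proposed (5 + 5 * r) G (nd x e w) (dir (.ch a)) (nd x e (a :: w)) := by
      intro a
      rw [hpres, proposed_ch]
      refine or_congr_right ⟨fun h1 => ?_, fun h1 => ?_⟩
      · exact ⟨(h.fires_grow hv hr.le h1.1).2 h1.2, by rw [nd, ← h1.2.1]⟩
      · have h2 := h.present_of_mem h1.1.1
        exact ⟨h2, (h.fires_grow hv hr.le h2).1 h1.1⟩
    by_cases h1 : nd x e w ∈ G.nodes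
    · have h2 := h.present_of_mem h1
      by_cases h3 : (rules Y e).Fires G (grow Y e a) (nd x e w)
      · have h4 := (h.fires_grow hv hr.le h2).1 h3
        refine ⟨fun _ => ?_, fun h5 => absurd ((hpres a w).2 (.inr ⟨h2, h4⟩)) h5⟩
        refine RuleSet.step_eq hR h1 ⟨_, proposed_ch.2 ⟨h3, rfl⟩⟩ fun y hy => ?_
        rw [(proposed_ch.1 hy).2, nd, ← h4.1]
      · have h4 : G'.edge (nd x e w) (dir (.ch a)) = G.edge (nd x e w) (dir (.ch a)) :=
          RuleSet.step_keep hR h1 fun y hy => h3 (proposed_ch.1 hy).1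
        have h5 : Present x e (r + 1) (a :: w) ↔ Present x e r (a :: w) := by
          rw [hkids]
          exact ⟨fun h => h.elim id fun h => absurd (proposed_ch.1 h).1 h3, .inl⟩
        rw [h4, h5]
        exact h.ch w h2 a
    · have hbw : (rules Y e).Born (5 + 5 * r) G (nd x e w) := by
        cases w with
        | nil => exact absurd h.base.root_mem h1
        | cons b w =>
          rcases (hpres b w).1 hw with h2 | h2
          · exact absurd (h.mem _ h2) h1
          · exact (hborn _).2 ⟨b, w, h2.1, h2.2.1, h2.2.2, rfl⟩
      have h2 : ¬ Present x e (r + 1) (a :: w) := by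
        rw [hkids]
        rintro (h2 | h2)
        · exact h1 (h.mem _ h2.tail)
        · exact h1 (proposed_ch.1 h2).1.1
      refine ⟨fun h3 => absurd h3 h2, fun _ => ?_⟩
      rw [hR.born _ hbw _ (by simp)]
      obtain ⟨t, l, h3⟩ := nd_fresh (e := e) x w
      rw [h3]; rfl
  · rw [h.flag_step (by simp only [last, growthStart] at *; omega) hR]
    have hi := i.2
    constructor
    · rintro (h1 | ⟨⟨k, h1⟩, h2⟩)
      · omega
      · have h3 : k < 4 - i.val := by
          rw [h1, mul_comm] at h2
          exact Nat.lt_of_mul_lt_mul_right h2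
        have h4 : width e x * k ≤ width e x * (3 - i.val) := Nat.mul_le_mul_left _ (by omega)
        rw [mul_comm _ (width e x)]
        omega
    · intro h1
      by_cases h2 : v < (3 - i.val) * width e x
      · exact .inl h2
      · have h3 : v = (3 - i.val) * width e x := by omega
        refine .inr ⟨⟨3 - i.val, by rw [h3, mul_comm]⟩, ?_⟩
        rw [h3]
        -- For the last flag `v` would be 0, which `r < last` excludes.
        have h4 : i.val ≠ 3 := by
          rintro h4; rw [h4] at h3; simp only [last] at *; omega
        exact Nat.mul_lt_mul_of_pos_right (by omega) hW

end

theorem inv_graphAt (ρ : Resolution (D Y e)) (x : List α) {r : ℕ} (hr : r ≤ last e x) :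
    Inv x r (last e x - r) ((rules Y e).graphAt ρ x r) := by
  induction r with
  | zero =>
    have hB := base_graphAt ρ x (Y := Y) (e := e) 0
    rw [RuleSet.graphAt_zero] at hB ⊢
    have h0 : ∀ w : List Y.Letter, Present x e 0 w ↔ w = [] := by
      intro w
      simp only [Present, growthStart]
      constructor
      · rintro (h | h)
        · exact h
        · omega
      · exact .inl
    have hctr : (rules Y e).ctr = dir .ctr := rfl
    have hnil : (rules Y e).nil = .e := rfl
    refine ⟨hB, fun u hu => ?_, fun w hw => ?_, fun d hd => ?_, fun i hi a => ?_, fun w hw a => ?_,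
      fun i => ?_, fun i => ?_⟩
    · rcases hu with (h | h) | h
      · exact .inl h
      · exact .inr (.inl h)
      · exact .inr (.inr ⟨[], h, .inl rfl⟩)
    · rw [(h0 w).1 hw]; exact hB.root_mem
    · simp [RuleSet.startGraph, RuleSet.root, hctr, hd, MWSMM.inputGraph]
    · simp [RuleSet.startGraph, RuleSet.root, MWSMM.inputGraph, dir]
    · rw [h0, (h0 w).1 hw]
      simp [nd, parent, RuleSet.startGraph, hnil]
    · have := digit_offset x.length 3 i.2
      simp only [last, width, Nat.sub_zero]
      rw [this, posNode_length]
      simp [RuleSet.startGraph, hnil]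
    · have h1 : (3 - i.val) * width e x ≤ 3 * width e x := Nat.mul_le_mul_right _ (by omega)
      simp only [last, Nat.sub_zero]
      simp [RuleSet.startGraph, hnil, RuleSet.base_ne_root]
      omega
  | succ r ih =>
    have := (ih (by omega)).succ rfl (by omega) (base_graphAt ρ x (r + 1))
      ((rules Y e).round_graphAt ρ x r)
    rwa [show last e x - r - 1 = last e x - (r + 1) by omega] at this

end WindowMachine

namespace WindowMachine

variable {α : Type u} {Y : WindowSystem α} {e : ℕ} [Finite α]

/-! ### Rewriting -/

variable (ρ : Resolution (D Y e)) {x : List α}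

theorem edge_ch {r : ℕ} (hr : r ≤ last e x) {a : Y.Letter} {w : List Y.Letter}
    (h : growthStart e x + w.length + 1 ≤ r) (h' : w.length < width e x) :
    ((rules Y e).graphAt ρ x r).edge (nd x e w) (dir (.ch a)) = nd x e (a :: w) :=
  ((inv_graphAt ρ x hr).ch w (.inr (by omega)) a).1 (.inr (by simp; omega))

-- By induction on the word: the image of the prefix is known one round earlier. The image of a word
-- lies one level above the word itself, so its node has been grown in time, and one round after the
-- birth of a node its images are right.
open Classical in
theorem edge_img {σ : Y.Guess} {b : Y.Letter} {w : List Y.Letter} {r : ℕ} (hr : r ≤ last e x)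
    (h : growthStart e x + w.length + 2 ≤ r) (h' : w.length < width e x) :
    ((rules Y e).graphAt ρ x r).edge (nd x e (b :: w)) (dir (.img σ)) =
      if Y.Ok σ (b :: w) then nd x e (Y.shift σ (b :: w)) else .origin := by
  induction w generalizing b r with
  | nil =>
    simp only [List.length_nil] at h
    obtain ⟨r, rfl⟩ : ∃ r', r = r' + 1 := ⟨r - 1, by omega⟩
    have hI := inv_graphAt ρ x (r := r) (Y := Y) (e := e) (by omega)
    have hp : Present x e r [b] := .inr (by simp; omega)
    have hm := hI.mem _ hp
    have hup : ((rules Y e).graphAt ρ x r).follow (nd x e [b]) [dir .up] =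
        nd x e ([] : List Y.Letter) := hI.base.up hm
    refine RuleSet.step_eq ((rules Y e).round_graphAt ρ x r) hm
      ⟨_, proposed_img.2 ⟨(b, none), ⟨hm, hI.live hm, (hI.lookAt hm hp rfl).2 rfl,
        (hI.lookAt hm (.inl rfl) hup).2 rfl⟩, rfl⟩⟩ fun y hy => ?_
    obtain ⟨⟨b', _ | ⟨a, l⟩⟩, hf, rfl⟩ := proposed_img.1 hy
    · have h1 := (hI.lookAt hm hp rfl).1 hf.2.2.1
      simp only [List.head?_cons, Option.some.injEq] at h1
      subst h1
      simp only [imgMove, WindowSystem.Ok, List.mem_singleton, forall_eq, WindowSystem.shift]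
      split_ifs
      · exact hup
      · exact hI.base.o _ hm
    · have h1 := (hI.lookAt hm (.inl rfl) hup).1 hf.2.2.2.1
      simp at h1
  | cons a w ih =>
    simp only [List.length_cons] at h h'
    obtain ⟨r, rfl⟩ : ∃ r', r = r' + 1 := ⟨r - 1, by omega⟩
    have hI := inv_graphAt ρ x (r := r) (Y := Y) (e := e) (by omega)
    have hp : Present x e r (b :: a :: w) := .inr (by simp; omega)
    have hm := hI.mem _ hp
    have hm1 := hI.mem _ hp.tail
    have hup : ((rules Y e).graphAt ρ x r).edge (nd x e (b :: a :: w)) (dir .up) =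
        nd x e (a :: w) := hI.base.up hm
    have hup1 : ((rules Y e).graphAt ρ x r).follow (nd x e (b :: a :: w)) [dir .up] =
        nd x e (a :: w) := hup
    have hup2 : ((rules Y e).graphAt ρ x r).follow (nd x e (b :: a :: w)) [dir .up, dir .up] =
        nd x e w := by
      simp only [PGraph.follow, List.foldl, hup]
      exact hI.base.up hm1
    refine RuleSet.step_eq ((rules Y e).round_graphAt ρ x r) hm
      ⟨_, proposed_img.2 ⟨(b, some (a, w.head?)), ⟨hm, hI.live hm, (hI.lookAt hm hp rfl).2 rfl,
        (hI.lookAt hm hp.tail hup1).2 rfl, (hI.lookAt hm hp.tail.tail hup2).2 rfl⟩, rfl⟩⟩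
      fun y hy => ?_
    obtain ⟨⟨b', _ | ⟨a', l⟩⟩, hf, rfl⟩ := proposed_img.1 hy
    · have h1 := (hI.lookAt hm hp.tail hup1).1 hf.2.2.2
      simp at h1
    · have h1 := (hI.lookAt hm hp rfl).1 hf.2.2.1
      have h2 := (hI.lookAt hm hp.tail hup1).1 hf.2.2.2.1
      have h3 := (hI.lookAt hm hp.tail.tail hup2).1 hf.2.2.2.2
      simp only [List.head?_cons, Option.some.injEq] at h1 h2
      subst h1 h2 h3
      have hok : Y.Ok σ (b :: a :: w) ↔ Y.Compat σ b ∧ Y.Ok σ (a :: w) := by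
        simp [WindowSystem.Ok]
      have ih' := ih (b := a) (r := r) (by omega) (by omega) (by omega)
      rw [hok]
      by_cases hc : Y.Compat σ b
      · simp only [imgMove, hc, if_true, true_and, PGraph.follow, List.foldl, hup, ih',
          WindowSystem.shift]
        split_ifs with h4
        · exact edge_ch ρ (by omega)
            (by rw [WindowSystem.length_shift]; simp only [List.length_cons]; omega)
            (by rw [WindowSystem.length_shift]; simp only [List.length_cons]; omega)
        · exact hI.origin _ (by simp)
      · simp only [imgMove, hc, if_false, false_and]
        exact hI.base.o _ hm

theorem edge_img_ne_origin {σ : Y.Guess} {w : List Y.Letter} {r : ℕ} (hr : r ≤ last e x)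
    (h : growthStart e x + w.length + 1 ≤ r) (h' : w.length ≤ width e x) (h0 : w ≠ []) :
    ((rules Y e).graphAt ρ x r).edge (nd x e w) (dir (.img σ)) ≠ .origin ↔ Y.Ok σ w := by
  cases w with
  | nil => exact absurd rfl h0
  | cons b w =>
    simp only [List.length_cons] at h h'
    rw [edge_img ρ hr (by omega) (by omega)]
    split_ifs with h1 <;> simp [h1, nd_ne_origin]

/-- The jumps of a leaf before the jumps are composed. -/
theorem edge_jmp_next {σ : Y.Guess} {w : List Y.Letter} {r : ℕ}
    (hr : growthStart e x + width e x + 1 ≤ r) (hr' : r < growthStart e x + 2 * width e x)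
    (hw : w.length = width e x) (hok : ∀ τ, Y.Ok τ w ↔ τ = σ) :
    ((rules Y e).graphAt ρ x (r + 1)).edge (nd x e w) (dir .jmp) = nd x e (Y.next σ w) := by
  have hW : 0 < width e x := width_pos x
  have hlast : r ≤ last e x := by unfold last growthStart at *; omega
  have hI := inv_graphAt ρ x (Y := Y) hlast
  have hp : Present x e r w := .inr (by omega)
  have hm := hI.mem _ hp
  obtain ⟨a, w, rfl⟩ : ∃ a w', w = a :: w' := by
    cases w with
    | nil => simp at hw; omega
    | cons a w => exact ⟨a, w, rfl⟩
  have hpass : ¬ (passed Y e 3).Holds ((rules Y e).graphAt ρ x r) (nd x e (a :: w)) := by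
    rw [hI.passed hm (by omega) (by omega)]
    simp only [last, growthStart] at *; omega
  have hup : ((rules Y e).graphAt ρ x r).follow (nd x e (a :: w)) [dir .up] = nd x e w :=
    hI.base.up hm
  have himg : ∀ τ, (PathExpr.eq [dir (.img τ)] [.o]).not.Holds ((rules Y e).graphAt ρ x r)
      (nd x e (a :: w)) ↔ τ = σ := by
    intro τ
    rw [← hok, ← edge_img_ne_origin ρ hlast (by omega) hw.le (by simp)]
    simp [PathExpr.Holds, PGraph.follow, hI.base.o _ hm]
  refine RuleSet.step_eq ((rules Y e).round_graphAt ρ x r) hm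
    ⟨_, proposed_jmp.2 (.inl ⟨(σ, a, w.head?), ⟨hm, hI.live hm, ⟨hpass, (himg σ).2 rfl⟩,
      (hI.lookAt hm hp rfl).2 rfl, (hI.lookAt hm hp.tail hup).2 rfl⟩, rfl⟩)⟩ fun y hy => ?_
  rcases proposed_jmp.1 hy with ⟨⟨τ, a', l⟩, hf, rfl⟩ | ⟨a', hf, -⟩
  · have h1 := (himg τ).1 hf.2.2.1.2
    have h2 := (hI.lookAt hm hp rfl).1 hf.2.2.2.1
    have h3 := (hI.lookAt hm hp.tail hup).1 hf.2.2.2.2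
    simp only [List.head?_cons, Option.some.injEq] at h2
    subst h1 h2 h3
    simp only [List.length_cons] at hw
    simp only [stepMove, PGraph.follow, List.foldl]
    rw [edge_img ρ hlast (by omega) (by omega), if_pos ((hok τ).2 rfl)]
    exact edge_ch ρ hlast
      (by rw [WindowSystem.length_shift]; simp only [List.length_cons]; omega)
      (by rw [WindowSystem.length_shift]; simp only [List.length_cons]; omega)
  · exact absurd hf.2.2.1 hpass

variable {w : ℕ → List Y.Letter} {σ : ℕ → Y.Guess}

/-- The jumps of leaves are composed with themselves. -/
theorem edge_jmp (hW : 2 ≤ width e x) (h : Y.IsRun x (width e x) w σ) (k : ℕ)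
    (hk : k < width e x) (i : ℕ) :
    ((rules Y e).graphAt ρ x (growthStart e x + 2 * width e x + k)).edge (nd x e (w i)) (dir .jmp) =
      nd x e (w (i + (Nat.card Y.Letter ^ 2) ^ k)) := by
  induction k generalizing i with
  | zero =>
    have := edge_jmp_next ρ (r := growthStart e x + 2 * width e x - 1) (by omega) (by omega) (h.length i)
      (h.ok i)
    rw [show growthStart e x + 2 * width e x - 1 + 1 = growthStart e x + 2 * width e x + 0 by omega] at this
    rw [this, pow_zero, h.succ]
  | succ k ih =>
    set r := growthStart e x + 2 * width e x + k with hr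
    have hlast : r ≤ last e x := by unfold last growthStart at *; omega
    have hI := inv_graphAt ρ x (Y := Y) hlast
    have hp : ∀ i, Present x e r (w i) := fun i => .inr (by rw [h.length]; omega)
    have hm := hI.mem _ (hp i)
    have hpass : (passed Y e 3).Holds ((rules Y e).graphAt ρ x r) (nd x e (w i)) := by
      rw [hI.passed hm (by omega) (by omega)]
      simp only [last, growthStart] at *; omega
    have hpow : ∀ m i, ((rules Y e).graphAt ρ x r).follow (nd x e (w i))
        (List.replicate m (dir .jmp)) = nd x e (w (i + m * (Nat.card Y.Letter ^ 2) ^ k)) := by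
      intro m
      induction m with
      | zero => intro i; simp [PGraph.follow]
      | succ m ihm =>
        intro i
        have := ihm (i + (Nat.card Y.Letter ^ 2) ^ k)
        simp only [PGraph.follow, List.replicate_succ, List.foldl_cons, ih (by omega)] at this ⊢
        rw [this, add_mul, one_mul, add_assoc, add_comm (_ ^ k)]
    obtain ⟨a, w', hw'⟩ : ∃ a w', w i = a :: w' := by
      have := h.length i
      rcases hh : w i with _ | ⟨a, w'⟩
      · rw [hh] at this; simp at this; omega
      · exact ⟨a, w', rfl⟩
    refine RuleSet.step_eq ((rules Y e).round_graphAt ρ x r) hm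
      ⟨_, proposed_jmp.2 (.inr ⟨a, ⟨hm, hI.live hm, hpass,
        (hI.lookAt hm (hp i) rfl).2 (by rw [hw']; rfl)⟩, rfl⟩)⟩ fun y hy => ?_
    rcases proposed_jmp.1 hy with ⟨⟨τ, a', l⟩, hf, -⟩ | ⟨a', hf, rfl⟩
    · exact absurd hpass hf.2.2.1.1
    · rw [powMove, hpow, pow_succ' (Nat.card Y.Letter ^ 2)]

/-! ### The initial word -/

theorem fires_center_iff {r : ℕ} (hr : r ≤ last e x) {b : PathExpr (D Y e)} :
    (rules Y e).Fires ((rules Y e).graphAt ρ x r) (.and (isCenter Y e) b) (RuleSet.root x) ↔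
      b.Holds ((rules Y e).graphAt ρ x r) (RuleSet.root x) := by
  rw [(inv_graphAt ρ x hr).fires_center]
  simp

theorem fires_reset {r : ℕ} (hr : r ≤ last e x) :
    (rules Y e).Fires ((rules Y e).graphAt ρ x r) (.and (isCenter Y e) (.not (passed Y e 2)))
      (RuleSet.root x) ↔ r < growthStart e x + width e x := by
  have hI := inv_graphAt ρ x (Y := Y) hr
  rw [fires_center_iff ρ hr, PathExpr.Holds, hI.passed hI.base.root_mem (by omega) (by omega)]
  have := width_pos (e := e) x
  simp only [last, growthStart] at *; omega

theorem fires_walking {r : ℕ} (hr : r ≤ last e x) :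
    (rules Y e).Fires ((rules Y e).graphAt ρ x r) (walking Y e) (RuleSet.root x) ↔
      growthStart e x + width e x ≤ r ∧ r < growthStart e x + 2 * width e x := by
  have hI := inv_graphAt ρ x (Y := Y) hr
  rw [walking, fires_center_iff ρ hr, PathExpr.Holds, PathExpr.Holds,
    hI.passed hI.base.root_mem (by omega) (by omega),
    hI.passed hI.base.root_mem (by omega) (by omega)]
  have := width_pos (e := e) x
  simp only [last, growthStart] at *; omega

theorem ini_reset {r : ℕ} (hr : r < growthStart e x + width e x) :
    ((rules Y e).graphAt ρ x (r + 1)).edge (RuleSet.root x) (dir .ini) = RuleSet.root x := by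
  have hW : 0 < width e x := width_pos x
  have hlast : r ≤ last e x := by unfold last growthStart at *; omega
  have hI := inv_graphAt ρ x (Y := Y) hlast
  refine RuleSet.step_eq ((rules Y e).round_graphAt ρ x r) hI.base.root_mem
    ⟨_, proposed_ini.2 (.inl ⟨(fires_reset ρ hlast).2 hr, rfl⟩)⟩ fun y hy => ?_
  rcases proposed_ini.1 hy with ⟨-, h⟩ | ⟨h, -⟩
  · exact h
  · have := (fires_walking ρ hlast).1 h; omega

/-- Like all edges of the center, `ip` starts at the last cell. It moves west until the western
neighbour is the origin; there is ample time for this before the lookup begins. -/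
theorem ip_reset {r : ℕ} (hr : r ≤ growthStart e x + width e x) :
    ((rules Y e).graphAt ρ x r).edge (RuleSet.root x) (dir .ip) =
      posNode x (x.length - min r (x.length - 1)) := by
  have hW : 0 < width e x := width_pos x
  induction r with
  | zero =>
    rw [RuleSet.graphAt_zero]
    have hnil : (rules Y e).nil = .e := rfl
    simp [RuleSet.startGraph, hnil, posNode_length]
  | succ r ih =>
    have hlast : r ≤ last e x := by unfold last growthStart at *; omega
    have hI := inv_graphAt ρ x (Y := Y) hlast
    have hm := hI.base.root_mem
    specialize ih (by omega)
    have hw : ((rules Y e).graphAt ρ x r).edge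
        (((rules Y e).graphAt ρ x r).edge (RuleSet.root x) (dir .ip)) .w =
        posNode x (x.length - min r (x.length - 1) - 1) := by
      rw [ih]
      rcases hk : x.length - min r (x.length - 1) with _ | k
      · exact hI.origin _ fun h => dir_ne_w _ h.symm
      · have hk' : k < x.length := by omega
        simp only [posNode, hk', if_true, Nat.add_sub_cancel]
        exact hI.base.cell_w k hk'
    by_cases h0 : posNode x (x.length - min r (x.length - 1) - 1) = .origin
    · rw [RuleSet.step_keep ((rules Y e).round_graphAt ρ x r) hm, ih]
      · rw [posNode_eq_origin] at h0
        congr 1; omega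
      · intro y hy
        rcases proposed_ip.1 hy with ⟨-, h, -⟩ | ⟨h, -⟩
        · rw [hw, hI.base.o _ hm] at h
          exact h h0
        · have := (fires_walking ρ hlast).1 h; omega
    · refine RuleSet.step_eq ((rules Y e).round_graphAt ρ x r) hm
        ⟨_, proposed_ip.2 (.inl ⟨(fires_reset ρ hlast).2 (by omega), ?_, rfl⟩)⟩ fun y hy => ?_
      · rwa [hw, hI.base.o _ hm]
      · rcases proposed_ip.1 hy with ⟨-, -, rfl⟩ | ⟨h, -⟩
        · rw [posNode_eq_origin] at h0
          rw [hw]; congr 1; omega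
        · have := (fires_walking ρ hlast).1 h; omega

/-- The subtraction is truncated: the letter `first` consumes no input, so `ip` is at the first cell
both for `k = 0` and for `k = 1`. -/
theorem ini_ip (hW : x.length + 2 ≤ width e x) {k : ℕ} (hk : k ≤ width e x) :
    ((rules Y e).graphAt ρ x (growthStart e x + width e x + k)).edge (RuleSet.root x) (dir .ini) =
      nd x e (WindowSystem.revWord (Y.initLetter x) k) ∧
    ((rules Y e).graphAt ρ x (growthStart e x + width e x + k)).edge (RuleSet.root x) (dir .ip) =
      if k - 1 < x.length then .cell (k - 1) else .origin := by
  induction k with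
  | zero =>
    constructor
    · have := ini_reset ρ (Y := Y) (x := x) (r := growthStart e x + width e x - 1) (by omega)
      rwa [show growthStart e x + width e x - 1 + 1 = growthStart e x + width e x + 0 by omega] at this
    · rw [add_zero, ip_reset ρ le_rfl]
      rcases Nat.eq_zero_or_pos x.length with h | h
      · simp [h, posNode]
      · rw [show x.length - min (growthStart e x + width e x) (x.length - 1) = 0 + 1 by omega]
        simp [posNode, h]
  | succ k ih =>
    obtain ⟨h1, h2⟩ := ih (by omega)
    set r := growthStart e x + width e x + k with hr
    have hlast : r ≤ last e x := by unfold last growthStart at *; omega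
    have hI := inv_graphAt ρ x (Y := Y) hlast
    have hm := hI.base.root_mem
    have hwalk := (fires_walking ρ (Y := Y) hlast).2 ⟨by omega, by omega⟩
    have hreset : ¬ (rules Y e).Fires ((rules Y e).graphAt ρ x r)
        (.and (isCenter Y e) (.not (passed Y e 2))) (RuleSet.root x) := by
      rw [fires_reset ρ hlast]; omega
    have hroot : nd x e (WindowSystem.revWord (Y.initLetter x) k) = RuleSet.root x ↔ k = 0 := by
      rw [show RuleSet.root x = nd x e ([] : List Y.Letter) from rfl, nd_inj]
      cases k <;> simp [WindowSystem.revWord]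
    have hlen : (WindowSystem.revWord (Y.initLetter x) k).length = k :=
      WindowSystem.length_revWord _ _
    have hch : ∀ a, ((rules Y e).graphAt ρ x r).edge
        (nd x e (WindowSystem.revWord (Y.initLetter x) k)) (dir (.ch a)) =
          nd x e (a :: WindowSystem.revWord (Y.initLetter x) k) :=
      fun a => edge_ch ρ hlast (by omega) (by omega)
    have hsym : ∀ a, k - 1 < x.length →
        (((rules Y e).graphAt ρ x r).edge (.cell (k - 1)) (.sym a) = .cell (k - 1) ↔
          x[k - 1]? = some a) := fun a h => hI.base.cell_sym _ h a
    constructor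
    · rw [WindowSystem.revWord]
      rcases Nat.eq_zero_or_pos k with hk0 | hk0
      · have h3 := h1.trans (hroot.2 hk0)
        refine RuleSet.step_eq ((rules Y e).round_graphAt ρ x r) hm
          ⟨_, proposed_ini.2 (.inr ⟨hwalk, .inl ⟨h3, rfl⟩⟩)⟩ fun y hy => ?_
        rcases proposed_ini.1 hy with ⟨h, -⟩ | ⟨-, ⟨-, rfl⟩ | ⟨h, -⟩⟩
        · exact absurd h hreset
        · rw [h1, hch, hk0]; rfl
        · exact absurd h3 h
      · have h3 : ((rules Y e).graphAt ρ x r).edge (RuleSet.root x) (dir .ini) ≠ RuleSet.root x := by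
          rw [h1, ne_eq, hroot]; omega
        obtain ⟨j, rfl⟩ : ∃ j, k = j + 1 := ⟨k - 1, by omega⟩
        simp only [Nat.add_sub_cancel] at h2 hsym
        by_cases hj : j < x.length
        · rw [if_pos hj] at h2
          have h4 : x[j]? = some x[j] := List.getElem?_eq_getElem hj
          refine RuleSet.step_eq ((rules Y e).round_graphAt ρ x r) hm
            ⟨_, proposed_ini.2 (.inr ⟨hwalk, .inr ⟨h3, .inr ⟨x[j], ?_, ?_, rfl⟩⟩⟩)⟩ fun y hy => ?_
          · rw [h2, hsym _ hj, h4]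
          · rw [h2, hI.base.o _ hm]; simp
          · rcases proposed_ini.1 hy with ⟨h, -⟩ | ⟨-, ⟨h, -⟩ | ⟨-, ⟨h, -⟩ | ⟨a, h, -, rfl⟩⟩⟩
            · exact absurd h hreset
            · exact absurd h h3
            · rw [h2, hI.base.o _ hm] at h; simp at h
            · rw [h2, hsym _ hj] at h
              rw [h1, hch]
              simp [WindowSystem.initLetter, h]
        · rw [if_neg hj] at h2
          have h4 : x[j]? = none := List.getElem?_eq_none (by omega)
          refine RuleSet.step_eq ((rules Y e).round_graphAt ρ x r) hm
            ⟨_, proposed_ini.2 (.inr ⟨hwalk, .inr ⟨h3, .inl ⟨?_, rfl⟩⟩⟩)⟩ fun y hy => ?_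
          · rw [h2, hI.base.o _ hm]
          · rcases proposed_ini.1 hy with ⟨h, -⟩ | ⟨-, ⟨h, -⟩ | ⟨-, ⟨-, rfl⟩ | ⟨a, -, h, -⟩⟩⟩
            · exact absurd h hreset
            · exact absurd h h3
            · rw [h1, hch]
              simp [WindowSystem.initLetter, h4]
            · rw [h2, hI.base.o _ hm] at h; simp at h
    · rw [Nat.add_sub_cancel]
      rcases Nat.eq_zero_or_pos k with hk0 | hk0
      · have h3 := h1.trans (hroot.2 hk0)
        rw [show growthStart e x + width e x + (k + 1) = r + 1 from rfl,
          RuleSet.step_keep ((rules Y e).round_graphAt ρ x r) hm, h2, hk0]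
        intro y hy
        rcases proposed_ip.1 hy with ⟨h, -⟩ | ⟨-, h, -⟩
        · exact hreset h
        · exact h h3
      · have h3 : ((rules Y e).graphAt ρ x r).edge (RuleSet.root x) (dir .ini) ≠ RuleSet.root x := by
          rw [h1, ne_eq, hroot]; omega
        refine RuleSet.step_eq ((rules Y e).round_graphAt ρ x r) hm
          ⟨_, proposed_ip.2 (.inr ⟨hwalk, h3, rfl⟩)⟩ fun y hy => ?_
        rcases proposed_ip.1 hy with ⟨h, -⟩ | ⟨-, -, rfl⟩
        · exact absurd h hreset
        · rw [h2]
          by_cases h4 : k - 1 < x.length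
          · rw [if_pos h4, hI.base.cell_e _ h4, show k - 1 + 1 = k by omega]
          · rw [if_neg h4, hI.origin _ fun h => dir_ne_e _ h.symm, if_neg (by omega)]

theorem ini_final (hW : x.length + 2 ≤ width e x) {r : ℕ}
    (hr : growthStart e x + 2 * width e x ≤ r) (hr' : r ≤ last e x) :
    ((rules Y e).graphAt ρ x r).edge (RuleSet.root x) (dir .ini) =
      nd x e (WindowSystem.revWord (Y.initLetter x) (width e x)) := by
  induction r, hr using Nat.le_induction with
  | base =>
    rw [← (ini_ip ρ hW le_rfl).1]
    congr 2; ring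
  | succ r hr ih =>
    have hI := inv_graphAt ρ x (Y := Y) (r := r) (by omega)
    rw [RuleSet.step_keep ((rules Y e).round_graphAt ρ x r) hI.base.root_mem, ih (by omega)]
    intro y hy
    rcases proposed_ini.1 hy with ⟨h, -⟩ | ⟨h, -⟩
    · have := (fires_reset ρ (by omega)).1 h; omega
    · have := (fires_walking ρ (by omega)).1 h; omega

/-- The machine decides whether the run of the window system accepts after a given number of
steps. -/
theorem decidesWithin_acc (he : 0 < e) (h : Y.IsRun x (width e x) w σ) :
    (rules Y e).machine.DecidesWithin ρ x (20 * width e x + 5)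
      (Y.Acc (σ ((Nat.card Y.Letter ^ 2) ^ (width e x - 1)))) := by
  classical
  have hW : x.length + 2 ≤ width e x := Nat.le_self_pow he.ne' _
  have hb : growthStart e x ≤ width e x := growthStart_le_width x
  have hl : last e x + 1 = growthStart e x + 3 * width e x := by unfold last growthStart; omega
  have hI := inv_graphAt ρ x (Y := Y) (le_refl (last e x))
  have hR := (rules Y e).round_graphAt ρ x (last e x)
  have hB := base_graphAt ρ x (Y := Y) (e := e) (last e x + 1)
  have hm := hI.base.root_mem
  rw [Nat.sub_self] at hI
  -- After `last` rounds the counter is 0. The next round raises the last flag, and simultaneously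
  -- `.v` is written for the last time.
  have hflag := (hI.flag_step (by omega) hR 3).2 (.inr ⟨dvd_zero _, by simp; omega⟩)
  have hini := ini_final ρ (Y := Y) hW (r := last e x) (by omega) le_rfl
  rw [← h.zero] at hini
  have hjmp := edge_jmp ρ (by omega) h (width e x - 1) (by omega) 0
  rw [show growthStart e x + 2 * width e x + (width e x - 1) = last e x by omega, zero_add] at hjmp
  set K := (Nat.card Y.Letter ^ 2) ^ (width e x - 1)
  have hguard : ∀ τ, (rules Y e).Fires ((rules Y e).graphAt ρ x (last e x)) (valMove Y e τ).1
      (RuleSet.root x) ↔ τ = σ K := by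
    intro τ
    have h1 : ((isCenter Y e).Holds ((rules Y e).graphAt ρ x (last e x)) (RuleSet.root x)) :=
      (hI.base.isCenter hm).2 rfl
    have h2 : (passed Y e 3).Holds ((rules Y e).graphAt ρ x (last e x)) (RuleSet.root x) := by
      rw [hI.passed hm (by omega) (by omega)]; omega
    have h3 : w K ≠ [] := by
      intro h3
      have := h.length K
      rw [h3] at this; simp at this; omega
    rw [← h.ok, ← edge_img_ne_origin ρ le_rfl (by rw [h.length]; omega) (h.length K).le h3]
    simp only [RuleSet.Fires, valMove, PathExpr.Holds, hm, hI.live hm, h1, h2, true_and,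
      PGraph.follow, List.foldl, hini, hjmp, hI.base.o _ hm, ne_eq]
  have hv : ((rules Y e).graphAt ρ x (last e x + 1)).edge (RuleSet.root x) .v =
      if Y.Acc (σ K) then .origin else RuleSet.root x := by
    refine RuleSet.step_eq hR hm ⟨_, proposed_v.2 ⟨σ K, (hguard _).2 rfl, rfl⟩⟩ fun y hy => ?_
    obtain ⟨τ, hf, rfl⟩ := proposed_v.1 hy
    obtain rfl := (hguard τ).1 hf
    simp only [valMove]
    split_ifs
    · exact hI.base.o _ hm
    · rfl
  -- There are `last + 1` rounds, at most four times the width, of five steps each; the prologue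
  -- adds five.
  refine (rules Y e).decidesWithin ρ x (last e x + 1) _ _ (by omega) (fun u hu hlive => ?_)
    (fun hA => by rw [hv, if_pos hA]) fun hA => by rw [hv, if_neg hA]
  refine hlive ?_
  rw [passed, dif_pos ⟨by omega, le_rfl⟩]
  simp only [PathExpr.Holds, PGraph.follow, List.foldl, hB.o u hu, hB.ctr]
  exact hflag

end WindowMachine

/-- Polynomial space is contained in the polynomial time of multiway storage modification
machines. -/
theorem recognizedInPolyTimeMWSMM {α : Type u} [Finite α] {L : Language α}
    (h : RecognizedInPolySpace L) : RecognizedInPolyTimeMWSMM L := by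
  obtain ⟨T, p, hp⟩ := h
  obtain ⟨e, he⟩ := p.exists_eval_le_pow
  -- The exponent `e` covers the space of the work tapes; adding 2 makes the words long enough for
  -- the input tape with both end markers even if `e = 0`.
  refine ⟨(WindowMachine.rules T.window (e + 2)).machine,
    20 * (Polynomial.X + 2) ^ (e + 2) + 5, fun ρ x => ?_⟩
  obtain ⟨h1, h2⟩ := hp x
  have hw : x.length + 1 < WindowMachine.width (e + 2) x :=
    Nat.le_self_pow (by omega : e + 2 ≠ 0) (x.length + 2)
  have hs : T.UsesSpace x (WindowMachine.width (e + 2) x) := fun t i =>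
    (h2 t i).trans_le ((he _).trans (Nat.pow_le_pow_right (by omega) (by omega)))
  have hcard : 0 < Nat.card T.Col := Nat.card_pos_iff.2
    ⟨⟨T.col x T.init 0⟩, inferInstance⟩
  -- A width `W` of at least 2 satisfies `W ≤ 2 * (W - 1)`.
  have hN : Nat.card T.Col ^ WindowMachine.width (e + 2) x ≤
      (Nat.card T.Col ^ 2) ^ (WindowMachine.width (e + 2) x - 1) := by
    rw [← pow_mul]
    exact Nat.pow_le_pow_right hcard (by omega)
  have h3 := WindowMachine.decidesWithin_acc (Y := T.window) (e := e + 2) ρ (by omega)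
    (T.isRun_window hw hs)
  have h4 : x ∈ L ↔ _ := h1.trans (T.accepts_iff hw hs hN)
  have h5 : (20 * (Polynomial.X + 2) ^ (e + 2) + 5 : Polynomial ℕ).eval x.length =
      20 * WindowMachine.width (e + 2) x + 5 := by simp [WindowMachine.width]
  rw [propext h4, h5]
  exact h3

theorem mainTheorem1 :
    (∀ (α : Type*) [Finite α] (L : Language α),
      RecognizedInPolySpace L → RecognizedInPolyTimeMWSMM L) ∧
    (∃ (M : MWSMM QSym) (C : ℕ), ∀ (φ : QBF) (ρ : Resolution (Dir QSym M.m)),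
      M.DecidesWithin ρ φ.encode (C * (φ.n + φ.matrix.depth)) φ.IsTrue) :=
  ⟨fun _ _ _ h => recognizedInPolyTimeMWSMM h,
    QBFMachine.rules.machine, 60, QBFMachine.decidesWithin_isTrue⟩
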